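/- Let $a(x)=\sinh(x+\gamma)$, $b(x)=\sinh x$, $c=\sinh\gamma$ with $\gamma\in\mathbb C$, and let $\mathcal R(x)$ be the six-vertex $R$-matrix on $\mathbb C^2\otimes\mathbb C^2$ with rows $(a,0,0,0)$, $(0,b,c,0)$, $(0,c,b,0)$, $(0,0,0,a)$. For $\mu_1,\dots,\mu_L\in\mathbb C$ let $\mathcal R_{a1}(\lambda-\mu_1)\cdots\mathcal R_{aL}(\lambda-\mu_L)=\begin{pmatrix}A(\lambda)&B(\lambda)\\ C(\lambda)&D(\lambda)\end{pmatrix}$ be the monodromy matrix, let $|0\rangle=\binom10^{\otimes L}$, and let $$S_n(\lambda_1^C,\dots,\lambda_n^C|\lambda_1^B,\dots,\lambda_n^B)=\langle 0|\prod_{i=1}^nC(\lambda_i^C)\prod_{i=1}^nB(\lambda_i^B)|0\rangle .$$ For $n\le L$ define $$H(w|\bar w)=(-1)^{Ln+\frac{n(n+1)}2}c^{2n}\,\frac{\prod_{i<j}b(w_i-w_j)^2\,b(\bar w_i-\bar w_j)^2\,a(w_j-\mu_i)\,a(\bar w_j-\mu_i)}{\prod_{i=1}^n b(w_i-\mu_i)\,b(\bar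 w_i-\mu_i)}\prod_{i=1}^nR_i^{-1}\Lambda_i ,$$ $$R_i=\prod_{k=i}^n\frac{a(w_k-\mu_i)}{b(w_k-\mu_i)}-\prod_{k=i}^n\frac{a(\bar w_k-\mu_i)}{b(\bar w_k-\mu_i)},$$ $$\Lambda_i=\prod_{k=i}^La(\bar w_i-\mu_k)b(\mu_k-w_i)\prod_{k=i+1}^n\frac{a(w_i-w_k)}{b(w_i-w_k)}\frac{a(\bar w_k-\bar w_i)}{b(\bar w_k-\bar w_i)}-\prod_{k=i}^La(w_i-\mu_k)b(\mu_k-\bar w_i)\prod_{k=i+1}^n\frac{a(w_k-w_i)}{b(w_k-w_i)}\frac{a(\bar w_i-\bar w_k)}{b(\bar w_i-\bar w_k)} .$$ **(1) Integral formula.** For $n\le L$ and all $\mu,\lambda^C,\lambda^B$, $$S_n(\lambda^C|\lambda^B)=\oint\!\cdots\!\oint\prod_{i=1}^n\frac{dw_i}{2\pi i}\frac{d\bar w_i}{2\pi i}\;\frac{H(w_1,\dots,w_n|\bar w_1,\dots,\bar w_n)}{\prod_{i,j=1}^nb(w_i-\lambda_j^C)\,b(\bar w_i-\lambda_j^B)}$$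 for any contours (finite unions of positively oriented circles bounding disjoint closed discs, possibly different for the different variables) such that every $w_i$-contour encloses all $\lambda^C_j$, every $\bar w_i$-contour encloses all $\lambda_j^B$, and no other singularities of the integrand are enclosed. That is: the closed discs contain no zero of $b(w_i-\lambda_j^C)$, resp. $b(\bar w_i-\lambda_j^B)$, other than $\lambda_j^C$, resp. $\lambda_j^B$; on the contours the denominators $b(w_k-\mu_i)$, $b(\bar w_k-\mu_i)$ ($i\le k$) and $R_i$ of $H$ do not vanish; and $H$ extends holomorphically to a neighbourhood of the product of the closed discs. Such contours exist whenever $\lambda^C,\lambda^B$ are in generic position: no two $\lambda^C_j$ and no two $\lambda_j^B$ differ by a nonzero multiple of $i\pi$, and for every $i$ and all choices of $w_k\in\{\lambda_j^C\}$, $\bar w_k\in\{\lambda_j^B\}$ one has $\prod_{k=i}^n a(w_k-\mu_i)b(\bar w_k-\mu_i)\ne\prod_{k=i}^n a(\bar w_k-\mu_i)b(w_k-\mu_i)$. If $\sinh\gamma\ne0$, then for all $\mu$ generic position holds on a dense set of $(\lambda^C,\lambda^B)\in\mathbb C^{2n}$. **(2) Recursion for the kernel.** For $n=1$, $$H(w_1|\bar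 w_1)=c^2\,\frac{\prod_{k=1}^La(w_1-\mu_k)b(\bar w_1-\mu_k)-\prod_{k=1}^La(\bar w_1-\mu_k)b(w_1-\mu_k)}{b(w_1-\mu_1)b(\bar w_1-\mu_1)\Big[\frac{a(w_1-\mu_1)}{b(w_1-\mu_1)}-\frac{a(\bar w_1-\mu_1)}{b(\bar w_1-\mu_1)}\Big]} .$$ Let $\kappa=(-1)^{L-1}c^2\prod_{k=2}^La(\mu_1-\mu_k)a(\mu_k-\mu_1)$, and let $\bar H$ be $\kappa$ times the kernel for $n-1$, $L-1$ and $\mu_2,\dots,\mu_L$. For $1\le n\le L$, where the denominators do not vanish, $$H(w|\bar w)=\frac{\bar H(w_2,\dots,w_n|\bar w_2,\dots,\bar w_n)}{b(w_1-\mu_1)b(\bar w_1-\mu_1)}\prod_{k=2}^nb(w_1-w_k)^2b(\bar w_1-\bar w_k)^2\;\frac{\prod_{k=2}^na(w_k-\mu_1)a(\bar w_k-\mu_1)}{\prod_{k=2}^La(\mu_1-\mu_k)a(\mu_k-\mu_1)}\;R_1^{-1}\Lambda_1 .$$ **(3) Recursion for the scalar product.** For $1\le n\le L$ let $V(X|Y)$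 be $\kappa$ times the scalar product $S_{n-1}(X|Y)$ on $L-1$ sites with parameters $\mu_2,\dots,\mu_L$. Then $$S_n(\mu_1-\gamma,\lambda_2^C,\dots,\lambda_n^C|\mu_1,\lambda_2^B,\dots,\lambda_n^B)=\prod_{j=2}^nb(\lambda_j^C-\mu_1)a(\lambda_j^B-\mu_1)\;V(\lambda_2^C,\dots,\lambda_n^C|\lambda_2^B,\dots,\lambda_n^B),$$ and, where the denominators do not vanish, $$S_n(\lambda^C|\lambda^B)=\mathcal K\sum_{i,j=1}^n\Omega_{i,j}\,V\big((\lambda_k^C)_{k\ne i}\,\big|\,(\lambda^B_k)_{k\ne j}\big),$$ $$\mathcal K=\frac{\prod_{k=1}^na(\lambda_k^C-\mu_1)a(\lambda_k^B-\mu_1)}{\prod_{k=2}^La(\mu_1-\mu_k)a(\mu_k-\mu_1)}\Big[\prod_{k=1}^n\frac{a(\lambda_k^C-\mu_1)}{b(\lambda_k^C-\mu_1)}-\prod_{k=1}^n\frac{a(\lambda_k^B-\mu_1)}{b(\lambda_k^B-\mu_1)}\Big]^{-1},$$ $$\begin{aligned}\Omega_{i,j}=\;&\frac{1}{a(\lambda_i^C-\mu_1)b(\lambda_i^C-\mu_1)a(\lambda_j^B-\mu_1)b(\lambda_j^B-\mu_1)}\\&\times\Big[\prod_{k=1}^La(\lambda_j^B-\mu_k)b(\mu_k-\lambda_i^C)\prod_{k\ne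 i}\frac{a(\lambda_i^C-\lambda_k^C)}{b(\lambda_i^C-\lambda_k^C)}\prod_{k\ne j}\frac{a(\lambda_k^B-\lambda_j^B)}{b(\lambda_k^B-\lambda_j^B)}\\&\quad-\prod_{k=1}^La(\lambda_i^C-\mu_k)b(\mu_k-\lambda_j^B)\prod_{k\ne i}\frac{a(\lambda_k^C-\lambda_i^C)}{b(\lambda_k^C-\lambda_i^C)}\prod_{k\ne j}\frac{a(\lambda_j^B-\lambda_k^B)}{b(\lambda_j^B-\lambda_k^B)}\Big].\end{aligned}$$ -/

import Mathlib

open scoped BigOperators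

noncomputable section

namespace SixVertex

/-! ### The six-vertex model -/

/-- The Boltzmann weight `a(x) = sinh (x + γ)`. -/
def wtA (γ x : ℂ) : ℂ := Complex.sinh (x + γ)

/-- The Boltzmann weight `b(x) = sinh x`. -/
def wtB (x : ℂ) : ℂ := Complex.sinh x

/-- The Boltzmann weight `c = sinh γ`. -/
def wtC (γ : ℂ) : ℂ := Complex.sinh γ

/-- The R-matrix on `ℂ² ⊗ ℂ²`. In the ordered basis `(0,0), (0,1), (1,0), (1,1)` it has rows
`(a,0,0,0)`, `(0,b,c,0)`, `(0,c,b,0)`, `(0,0,0,a)`. -/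
def Rmat (γ x : ℂ) : Matrix (Fin 2 × Fin 2) (Fin 2 × Fin 2) ℂ := fun p q =>
  if p = q then (if p.1 = p.2 then wtA γ x else wtB x)
  else if p.1 = q.2 ∧ p.2 = q.1 then wtC γ else 0

/-- `R_{aj}(x)`: the R-matrix acting on the auxiliary space `V_a` and the `j`-th site of
`V_a ⊗ V_1 ⊗ ⋯ ⊗ V_L`, and as the identity on all other sites. The standard basis of
`V_1 ⊗ ⋯ ⊗ V_L` is indexed by `Fin L → Fin 2`. -/
def RmatAt (γ x : ℂ) {L : ℕ} (j : Fin L) :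
    Matrix (Fin 2 × (Fin L → Fin 2)) (Fin 2 × (Fin L → Fin 2)) ℂ := fun p q =>
  if ∀ k, k ≠ j → p.2 k = q.2 k then Rmat γ x (p.1, p.2 j) (q.1, q.2 j) else 0

/-- The monodromy matrix `R_{a1}(x - μ₁) R_{a2}(x - μ₂) ⋯ R_{aL}(x - μ_L)`. -/
def monodromy (γ : ℂ) {L : ℕ} (μ : Fin L → ℂ) (x : ℂ) :
    Matrix (Fin 2 × (Fin L → Fin 2)) (Fin 2 × (Fin L → Fin 2)) ℂ :=
  (List.ofFn fun j : Fin L => RmatAt γ (x - μ j) j).prod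

/-- The operator `B(x)`: the upper right block of the monodromy matrix in auxiliary space. -/
def opB (γ : ℂ) {L : ℕ} (μ : Fin L → ℂ) (x : ℂ) :
    Matrix (Fin L → Fin 2) (Fin L → Fin 2) ℂ := fun s t => monodromy γ μ x (0, s) (1, t)

/-- The operator `C(x)`: the lower left block of the monodromy matrix in auxiliary space. -/
def opC (γ : ℂ) {L : ℕ} (μ : Fin L → ℂ) (x : ℂ) :
    Matrix (Fin L → Fin 2) (Fin L → Fin 2) ℂ := fun s t => monodromy γ μ x (1, s) (0, t)

/-- The basis index of the reference state `|0⟩ = (1,0)ᵗ ⊗ ⋯ ⊗ (1,0)ᵗ`. -/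
def vac (L : ℕ) : Fin L → Fin 2 := fun _ => 0

/-- The off-shell scalar product
`S_n = ⟨0| C(λ₁^C) ⋯ C(λ_n^C) B(λ₁^B) ⋯ B(λ_n^B) |0⟩`, a diagonal matrix entry. -/
def scalarProduct (γ : ℂ) {L n : ℕ} (μ : Fin L → ℂ) (lamC lamB : Fin n → ℂ) : ℂ :=
  ((List.ofFn fun i => opC γ μ (lamC i)).prod * (List.ofFn fun i => opB γ μ (lamB i)).prod)
    (vac L) (vac L)

/-! ### The kernel `H` -/

/-- `R_i = ∏_{k=i}^n a(w_k - μ_i)/b(w_k - μ_i) - ∏_{k=i}^n a(w̄_k - μ_i)/b(w̄_k - μ_i)`. -/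
def Rfac (γ : ℂ) {L n : ℕ} (h : n ≤ L) (μ : Fin L → ℂ) (w v : Fin n → ℂ) (i : Fin n) : ℂ :=
  (∏ k ∈ Finset.Ici i, wtA γ (w k - μ (Fin.castLE h i)) / wtB (w k - μ (Fin.castLE h i)))
  - ∏ k ∈ Finset.Ici i, wtA γ (v k - μ (Fin.castLE h i)) / wtB (v k - μ (Fin.castLE h i))

/-- The factor `Λ_i`. The variables `w̄` are written `v`. -/
def Lfac (γ : ℂ) {L n : ℕ} (h : n ≤ L) (μ : Fin L → ℂ) (w v : Fin n → ℂ) (i : Fin n) : ℂ :=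
  (∏ k ∈ Finset.Ici (Fin.castLE h i), wtA γ (v i - μ k) * wtB (μ k - w i))
    * (∏ k ∈ Finset.Ioi i,
        (wtA γ (w i - w k) / wtB (w i - w k)) * (wtA γ (v k - v i) / wtB (v k - v i)))
  - (∏ k ∈ Finset.Ici (Fin.castLE h i), wtA γ (w i - μ k) * wtB (μ k - v i))
    * (∏ k ∈ Finset.Ioi i,
        (wtA γ (w k - w i) / wtB (w k - w i)) * (wtA γ (v i - v k) / wtB (v i - v k)))

/-- The closed formula for the kernel `H(w₁,…,w_n | w̄₁,…,w̄_n)`. -/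
def Hker (γ : ℂ) {L n : ℕ} (h : n ≤ L) (μ : Fin L → ℂ) (w v : Fin n → ℂ) : ℂ :=
  (-1) ^ (L * n + n * (n + 1) / 2) * wtC γ ^ (2 * n)
  * ((∏ i, ∏ j ∈ Finset.Ioi i,
        wtB (w i - w j) ^ 2 * wtB (v i - v j) ^ 2
          * wtA γ (w j - μ (Fin.castLE h i)) * wtA γ (v j - μ (Fin.castLE h i)))
      / ∏ i, wtB (w i - μ (Fin.castLE h i)) * wtB (v i - μ (Fin.castLE h i)))
  * ∏ i, (Rfac γ h μ w v i)⁻¹ * Lfac γ h μ w v i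

/-! ### Contours -/

/-- A contour: a finite union of positively oriented circles bounding disjoint closed discs. -/
structure Contour where
  /-- number of circles -/
  m : ℕ
  center : Fin m → ℂ
  radius : Fin m → ℝ
  radius_pos : ∀ j, 0 < radius j
  disjoint : Pairwise fun j k =>
    Disjoint (Metric.closedBall (center j) (radius j)) (Metric.closedBall (center k) (radius k))

/-- The points on the contour. -/
def Contour.trace (Γ : Contour) : Set ℂ := ⋃ j, Metric.sphere (Γ.center j) (Γ.radius j)

/-- The points enclosed by the contour. -/
def Contour.inside (Γ : Contour) : Set ℂ := ⋃ j, Metric.ball (Γ.center j) (Γ.radius j)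

/-- The points on the contour or enclosed by it. -/
def Contour.filled (Γ : Contour) : Set ℂ := ⋃ j, Metric.closedBall (Γ.center j) (Γ.radius j)

/-- The contour integral `∮_Γ f(z) dz / (2πi)`. -/
def Contour.integral (Γ : Contour) (f : ℂ → ℂ) : ℂ :=
  ∑ j, (2 * Real.pi * Complex.I)⁻¹ * circleIntegral f (Γ.center j) (Γ.radius j)

/-- The multiple contour integral `∮_{Γ₁} ⋯ ∮_{Γ_n} F(w₁,…,w_n) ∏ dw_i / (2πi)`. -/
def multiIntegral : {n : ℕ} → (Fin n → Contour) → ((Fin n → ℂ) → ℂ) → ℂ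
  | 0, _, F => F Fin.elim0
  | _ + 1, Γ, F =>
      (Γ 0).integral fun z => multiIntegral (fun i => Γ i.succ) fun w => F (Fin.cons z w)

/-- None of the denominators `b(w_k - μ_i)`, `b(w̄_k - μ_i)` (`i ≤ k`) and `R_i` of `H`
vanishes. -/
def DenomsNonzero (γ : ℂ) {L n : ℕ} (h : n ≤ L) (μ : Fin L → ℂ) (w v : Fin n → ℂ) : Prop :=
  (∀ i k, i ≤ k →
    wtB (w k - μ (Fin.castLE h i)) ≠ 0 ∧ wtB (v k - μ (Fin.castLE h i)) ≠ 0) ∧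
  ∀ i, Rfac γ h μ w v i ≠ 0

/-- The contour `Γ i` for `w_i` and the contour `Δ i` for `w̄_i` are such that `w_i`-contours
enclose, among the singularities of `H / ∏ b(w_i - λ_j^C) b(w̄_i - λ_j^B)`, only the poles
`w_i = λ_j^C`, and `w̄_i`-contours only the poles `w̄_i = λ_j^B`.

The factors `1 / b(w_i - w_k)` inside `Λ_i` are cancelled by the squares in the numerator of
`H`, so that they produce no singularity; in the last clause points where they vanish are
left out of the comparison of `H` with its holomorphic extension. -/
structure Admissible (γ : ℂ) {L n : ℕ} (h : n ≤ L) (μ : Fin L → ℂ) (lamC lamB : Fin n → ℂ)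
    (Γ Δ : Fin n → Contour) : Prop where
  /-- every `w_i`-contour encloses all the poles `λ_j^C` -/
  mem_C : ∀ i j, lamC j ∈ (Γ i).inside
  /-- every `w̄_i`-contour encloses all the poles `λ_j^B` -/
  mem_B : ∀ i j, lamB j ∈ (Δ i).inside
  /-- no other zeros `λ_j^C + iπm` of `b(w_i - λ_j^C)` are enclosed -/
  only_C : ∀ i, ∀ z ∈ (Γ i).filled, ∀ j, wtB (z - lamC j) = 0 → z = lamC j
  /-- no other zeros `λ_j^B + iπm` of `b(w̄_i - λ_j^B)` are enclosed -/
  only_B : ∀ i, ∀ z ∈ (Δ i).filled, ∀ j, wtB (z - lamB j) = 0 → z = lamB j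
  /-- the contours avoid the zeros of the denominators of `H` -/
  on_contour : ∀ w v : Fin n → ℂ, (∀ i, w i ∈ (Γ i).trace) → (∀ i, v i ∈ (Δ i).trace) →
    DenomsNonzero γ h μ w v
  /-- `H` has no singularities (other than removable ones) on the enclosed region -/
  holomorphic : ∃ G : (Fin n → ℂ) × (Fin n → ℂ) → ℂ,
    AnalyticOnNhd ℂ G {p | (∀ i, p.1 i ∈ (Γ i).filled) ∧ ∀ i, p.2 i ∈ (Δ i).filled} ∧
    ∀ w v : Fin n → ℂ, (∀ i, w i ∈ (Γ i).filled) → (∀ i, v i ∈ (Δ i).filled) →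
      DenomsNonzero γ h μ w v →
      (∀ i k, i ≠ k → wtB (w i - w k) ≠ 0 ∧ wtB (v i - v k) ≠ 0) →
      G (w, v) = Hker γ h μ w v

/-- Generic position of `λ^C, λ^B`: no two `λ_j^C` (no two `λ_j^B`) differ by a nonzero
multiple of `iπ`, and for all choices of `w_k` among the `λ_j^C` and of `w̄_k` among the
`λ_j^B`, all `R_i`, multiplied by their denominators, are nonzero. -/
def Generic (γ : ℂ) {L n : ℕ} (h : n ≤ L) (μ : Fin L → ℂ) (lamC lamB : Fin n → ℂ) : Prop :=
  (∀ j k, wtB (lamC j - lamC k) = 0 → lamC j = lamC k) ∧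
  (∀ j k, wtB (lamB j - lamB k) = 0 → lamB j = lamB k) ∧
  ∀ (f g : Fin n → Fin n) (i : Fin n),
    (∏ k ∈ Finset.Ici i, wtA γ (lamC (f k) - μ (Fin.castLE h i))
        * wtB (lamB (g k) - μ (Fin.castLE h i)))
    - (∏ k ∈ Finset.Ici i, wtA γ (lamB (g k) - μ (Fin.castLE h i))
        * wtB (lamC (f k) - μ (Fin.castLE h i))) ≠ 0

/-! ### The recursion -/

/-- The constant by which `V` differs from `S_{n-1}`, and `H̄` from the kernel for `n - 1`
(there are `L + 1` sites). -/
def recConst (γ : ℂ) {L : ℕ} (μ : Fin (L + 1) → ℂ) : ℂ :=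
  (-1) ^ L * wtC γ ^ 2 * ∏ k : Fin L, wtA γ (μ 0 - μ k.succ) * wtA γ (μ k.succ - μ 0)

/-- The function `V`: a constant times the scalar product `S_n` for the sites `2, …, L + 1`. -/
def Vfun (γ : ℂ) {L n : ℕ} (μ : Fin (L + 1) → ℂ) (X Y : Fin n → ℂ) : ℂ :=
  recConst γ μ * scalarProduct γ (fun k => μ (Fin.succ k)) X Y

/-- The function `H̄`: a constant times the kernel `H` for the sites `2, …, L + 1`. -/
def Hbar (γ : ℂ) {L n : ℕ} (h : n ≤ L) (μ : Fin (L + 1) → ℂ) (w v : Fin n → ℂ) : ℂ :=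
  recConst γ μ * Hker γ h (fun k => μ (Fin.succ k)) w v

/-- `∏_k a(w_k - μ₁)/b(w_k - μ₁) - ∏_k a(w̄_k - μ₁)/b(w̄_k - μ₁)`. -/
def Ffac (γ : ℂ) {L n : ℕ} (μ : Fin (L + 1) → ℂ) (w v : Fin n → ℂ) : ℂ :=
  (∏ k, wtA γ (w k - μ 0) / wtB (w k - μ 0)) - ∏ k, wtA γ (v k - μ 0) / wtB (v k - μ 0)

/-- The prefactor `𝒦` of the recursion. -/
def Kfac (γ : ℂ) {L n : ℕ} (μ : Fin (L + 1) → ℂ) (lamC lamB : Fin n → ℂ) : ℂ :=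
  ((∏ k, wtA γ (lamC k - μ 0) * wtA γ (lamB k - μ 0))
    / ∏ k : Fin L, wtA γ (μ 0 - μ k.succ) * wtA γ (μ k.succ - μ 0))
  * (Ffac γ μ lamC lamB)⁻¹

/-- The coefficient `Ω_{i,j}` of the recursion. -/
def Omega (γ : ℂ) {L n : ℕ} (μ : Fin (L + 1) → ℂ) (lamC lamB : Fin n → ℂ) (i j : Fin n) : ℂ :=
  1 / (wtA γ (lamC i - μ 0) * wtB (lamC i - μ 0) * wtA γ (lamB j - μ 0) * wtB (lamB j - μ 0))
  * ((∏ k, wtA γ (lamB j - μ k) * wtB (μ k - lamC i))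
      * (∏ k ∈ Finset.univ.erase i, wtA γ (lamC i - lamC k) / wtB (lamC i - lamC k))
      * (∏ k ∈ Finset.univ.erase j, wtA γ (lamB k - lamB j) / wtB (lamB k - lamB j))
    - (∏ k, wtA γ (lamC i - μ k) * wtB (μ k - lamB j))
      * (∏ k ∈ Finset.univ.erase i, wtA γ (lamC k - lamC i) / wtB (lamC k - lamC i))
      * (∏ k ∈ Finset.univ.erase j, wtA γ (lamB j - lamB k) / wtB (lamB j - lamB k)))

end SixVertex

end

open SixVertex

namespace SixVertex

/-! ### The blocks of the monodromy matrix -/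

/-! The scalar product satisfies a recursion that removes one site and one pair of parameters, and
the iterated recursion is the sum of residues of the kernel.

Recursion. Insert `A(μ₁)` between the `C`'s and the `B`'s. Moving it to the right and to the left by
the exchange relations (`mulVec_bethe`) and comparing the results expresses `S_n`, times the
difference of products `Ffac`, by scalar products in which one `λ^C` or one `λ^B` has become `μ₁`
(`scalarProduct_insert_opA`). Into each of these insert `D(μ₁ - γ)`. On the side that contains `μ₁`
it gives zero, since `B(μ₁ - γ) B(μ₁) = 0 = C(μ₁ - γ) C(μ₁)`. On the other side it produces scalar
products with the pair `μ₁ - γ`, `μ₁`, and these collapse to the remaining sites: by the quantum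
determinant, `C(μ₁ - γ) B(μ₁)` is a multiple of a projector on the first site
(`opC_mul_opB_special`); in the mirrored case vacuum eigenvalues give the same constant. The result
is `scalarProduct_recursion`. Its denominators `a(μ₁ - μ_k) a(μ_k - μ₁)` cancel against `κ`, so the
cancelled form holds for all `μ` by continuity.

Integral formula. After cancellation the kernel is a quotient `Hnum / ∏ Rnum` of entire functions.
For regular parameters, iterating the recursion gives a sum over all maps `f`, `g` that choose `w_i
= λ^C_{f(i)}` and `w̄_i = λ^B_{g(i)}` (`scalarProduct_eq_sum`): injective maps record the order in
which parameters are removed, the others contribute zero because the numerator keeps a factor `b(w_i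
- w_j) b(w̄_i - w̄_j)`. Cauchy's formula in each variable turns the contour integral into the same
sum (`multiIntegral_eq_sum`). For fixed contours both sides are continuous in the `λ`'s, and regular
points are dense if `sinh γ ≠ 0`; if `sinh γ = 0`, both sides vanish for `n ≥ 1`.

In generic position, small circles around the `λ`'s are admissible, because the `Rnum` stay nonzero
on small polydiscs (`Generic.exists_admissible`). -/

/-- The block `T_{ab}(x)` of the monodromy matrix in auxiliary space. -/
noncomputable def block (γ : ℂ) {L : ℕ} (μ : Fin L → ℂ) (x : ℂ) (a b : Fin 2) :
    Matrix (Fin L → Fin 2) (Fin L → Fin 2) ℂ := fun s t => monodromy γ μ x (a, s) (b, t)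

/-- The block of the R-matrix in its first factor. -/
noncomputable def site (γ x : ℂ) (a b : Fin 2) : Matrix (Fin 2) (Fin 2) ℂ :=
  fun s t => Rmat γ x (a, s) (b, t)

/-- The tensor product of an operator on the first site and an operator on the other sites. -/
noncomputable def tens {L : ℕ} (X : Matrix (Fin 2) (Fin 2) ℂ)
    (Y : Matrix (Fin L → Fin 2) (Fin L → Fin 2) ℂ) :
    Matrix (Fin (L + 1) → Fin 2) (Fin (L + 1) → Fin 2) ℂ :=
  fun s t => X (s 0) (t 0) * Y (Fin.tail s) (Fin.tail t)

section tens
variable {L : ℕ}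

lemma sum_fin_succ_fun {α M : Type*} [Fintype α] [AddCommMonoid M]
    (F : (Fin (L + 1) → α) → M) :
    ∑ s, F s = ∑ a : α, ∑ s : Fin L → α, F (Fin.cons a s) := by
  rw [← Fintype.sum_prod_type']
  exact (Equiv.sum_comp (Fin.consEquiv fun _ : Fin (L + 1) => α) F).symm

lemma eq_iff_zero_tail (s t : Fin (L + 1) → Fin 2) :
    s = t ↔ s 0 = t 0 ∧ Fin.tail s = Fin.tail t :=
  ⟨fun h => by simp [h], fun ⟨h, h'⟩ => by
    rw [← Fin.cons_self_tail s, h, h', Fin.cons_self_tail]⟩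

lemma tens_mul_tens (X X' : Matrix (Fin 2) (Fin 2) ℂ)
    (Y Y' : Matrix (Fin L → Fin 2) (Fin L → Fin 2) ℂ) :
    tens X Y * tens X' Y' = tens (X * X') (Y * Y') := by
  ext s t
  simp only [Matrix.mul_apply, tens, sum_fin_succ_fun, Fin.cons_zero, Fin.tail_cons,
    Finset.sum_mul_sum]
  exact Finset.sum_congr rfl fun a _ => Finset.sum_congr rfl fun b _ => by ring

lemma tens_sum_left {ι : Type*} (s : Finset ι) (X : ι → Matrix (Fin 2) (Fin 2) ℂ)
    (Y : Matrix (Fin L → Fin 2) (Fin L → Fin 2) ℂ) :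
    tens (∑ i ∈ s, X i) Y = ∑ i ∈ s, tens (X i) Y := by
  ext a b
  simp [tens, Matrix.sum_apply, Finset.sum_mul]

lemma tens_sum_right {ι : Type*} (s : Finset ι) (X : Matrix (Fin 2) (Fin 2) ℂ)
    (Y : ι → Matrix (Fin L → Fin 2) (Fin L → Fin 2) ℂ) :
    tens X (∑ i ∈ s, Y i) = ∑ i ∈ s, tens X (Y i) := by
  ext a b
  simp [tens, Matrix.sum_apply, Finset.mul_sum]

lemma tens_add_right (X : Matrix (Fin 2) (Fin 2) ℂ)
    (Y Y' : Matrix (Fin L → Fin 2) (Fin L → Fin 2) ℂ) :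
    tens X (Y + Y') = tens X Y + tens X Y' := by
  ext a b
  simp [tens, mul_add]

lemma tens_sub_left (X X' : Matrix (Fin 2) (Fin 2) ℂ)
    (Y : Matrix (Fin L → Fin 2) (Fin L → Fin 2) ℂ) :
    tens (X - X') Y = tens X Y - tens X' Y := by
  ext a b
  simp [tens, sub_mul]

lemma tens_smul_left (z : ℂ) (X : Matrix (Fin 2) (Fin 2) ℂ)
    (Y : Matrix (Fin L → Fin 2) (Fin L → Fin 2) ℂ) : tens (z • X) Y = z • tens X Y := by
  ext a b
  simp [tens, mul_assoc]

lemma tens_smul_right (z : ℂ) (X : Matrix (Fin 2) (Fin 2) ℂ)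
    (Y : Matrix (Fin L → Fin 2) (Fin L → Fin 2) ℂ) : tens X (z • Y) = z • tens X Y := by
  ext a b
  simp [tens, mul_left_comm]

@[simp] lemma tens_zero_left (Y : Matrix (Fin L → Fin 2) (Fin L → Fin 2) ℂ) :
    tens 0 Y = 0 := by
  ext a b
  simp [tens]

@[simp] lemma tens_zero_right (X : Matrix (Fin 2) (Fin 2) ℂ) :
    tens X (0 : Matrix (Fin L → Fin 2) (Fin L → Fin 2) ℂ) = 0 := by
  ext a b
  simp [tens]

lemma tens_one_one : tens 1 (1 : Matrix (Fin L → Fin 2) (Fin L → Fin 2) ℂ) = 1 := by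
  ext s t
  have := eq_iff_zero_tail s t
  by_cases h : s 0 = t 0 <;> by_cases h' : Fin.tail s = Fin.tail t <;>
    simp [tens, Matrix.one_apply, this, h, h']

end tens

/-! ### Splitting off the first site -/

/-- The extension of an operator by the identity on a new first site. -/
noncomputable def addSite {L : ℕ}
    (M : Matrix (Fin 2 × (Fin L → Fin 2)) (Fin 2 × (Fin L → Fin 2)) ℂ) :
    Matrix (Fin 2 × (Fin (L + 1) → Fin 2)) (Fin 2 × (Fin (L + 1) → Fin 2)) ℂ := fun p q =>
  if p.2 0 = q.2 0 then M (p.1, Fin.tail p.2) (q.1, Fin.tail q.2) else 0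

lemma addSite_one {L : ℕ} : addSite (L := L) 1 = 1 := by
  ext ⟨a, s⟩ ⟨b, t⟩
  have := eq_iff_zero_tail s t
  by_cases h : s 0 = t 0 <;> by_cases h' : Fin.tail s = Fin.tail t <;>
    simp [addSite, Matrix.one_apply, this, h, h']

lemma addSite_mul {L : ℕ}
    (M N : Matrix (Fin 2 × (Fin L → Fin 2)) (Fin 2 × (Fin L → Fin 2)) ℂ) :
    addSite (M * N) = addSite M * addSite N := by
  ext ⟨a, s⟩ ⟨b, t⟩
  simp only [addSite, Matrix.mul_apply, Fintype.sum_prod_type, sum_fin_succ_fun, Fin.cons_zero,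
    Fin.tail_cons]
  by_cases h : s 0 = t 0
  · rw [if_pos h]
    refine Finset.sum_congr rfl fun c _ => ?_
    rw [Finset.sum_eq_single (s 0)]
    · simp [h]
    · intro d _ hd
      simp [Ne.symm hd]
    · simp
  · rw [if_neg h]
    symm
    refine Finset.sum_eq_zero fun c _ => Finset.sum_eq_zero fun d _ =>
      Finset.sum_eq_zero fun u _ => ?_
    by_cases h1 : s 0 = d
    · simp [← h1, h]
    · simp [h1]

lemma addSite_RmatAt (γ x : ℂ) {L : ℕ} (j : Fin L) :
    addSite (RmatAt γ x j) = RmatAt γ x j.succ := by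
  ext ⟨a, s⟩ ⟨b, t⟩
  simp only [addSite, RmatAt, Fin.forall_fin_succ, Fin.tail]
  by_cases h : s 0 = t 0
  · simp only [h, (Fin.succ_ne_zero j).symm, ne_eq, not_false_eq_true, forall_true_left, true_and,
      if_true, Fin.succ_inj]
    congr
  · simp [h, (Fin.succ_ne_zero j).symm]

lemma addSite_list_prod {L : ℕ}
    (l : List (Matrix (Fin 2 × (Fin L → Fin 2)) (Fin 2 × (Fin L → Fin 2)) ℂ)) :
    addSite l.prod = (l.map addSite).prod := by
  induction l with
  | nil => simp [addSite_one]
  | cons M l ih => simp [addSite_mul, ih]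

lemma monodromy_succ (γ : ℂ) {L : ℕ} (μ : Fin (L + 1) → ℂ) (x : ℂ) :
    monodromy γ μ x = RmatAt γ (x - μ 0) 0 * addSite (monodromy γ (fun k => μ k.succ) x) := by
  simp only [monodromy, List.ofFn_succ, List.prod_cons, addSite_list_prod, List.map_ofFn]
  congr 3
  funext j
  simp [addSite_RmatAt]

/-- The coproduct rule of the Yang–Baxter algebra. All inductions on the number of sites rest on it.
-/
lemma block_succ (γ : ℂ) {L : ℕ} (μ : Fin (L + 1) → ℂ) (x : ℂ) (a b : Fin 2) :
    block γ μ x a b =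
      ∑ c, tens (site γ (x - μ 0) a c) (block γ (fun k => μ k.succ) x c b) := by
  ext s t
  simp only [block, monodromy_succ, Matrix.mul_apply, Fintype.sum_prod_type, sum_fin_succ_fun,
    Matrix.sum_apply, tens, site]
  refine Finset.sum_congr rfl fun c _ => ?_
  -- Of the intermediate states only one survives: `addSite` fixes its first spin to `t 0`, and the
  -- R-matrix at the first site fixes the other spins to those of `s`.
  rw [Finset.sum_eq_single (t 0), Finset.sum_eq_single (Fin.tail s)]
  · simp [RmatAt, addSite, Fin.forall_fin_succ, Fin.tail]
  · intro u _ hu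
    have : ¬ ∀ k : Fin L, s k.succ = u k := fun h => hu (funext fun k => (h k).symm)
    simp [RmatAt, Fin.forall_fin_succ, this]
  · simp
  · intro d _ hd
    simp [addSite, hd]
  · simp

lemma block_zero (γ : ℂ) (μ : Fin 0 → ℂ) (x : ℂ) (a b : Fin 2) :
    block γ μ x a b = if a = b then 1 else 0 := by
  ext s t
  have : s = t := Subsingleton.elim _ _
  by_cases h : a = b <;> simp [block, monodromy, h, this, Matrix.one_apply]

/-! ### The Yang–Baxter relations -/

/-- The Yang–Baxter equation of the six-vertex weights. Its 64 entries are trivial or addition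
theorems for `sinh`, which become rational identities in the exponentials. -/
lemma site_yangBaxter (γ x y : ℂ) (a b e f : Fin 2) :
    ∑ c, ∑ d, Rmat γ (x - y) (a, b) (c, d) • (site γ x c e * site γ y d f) =
      ∑ c, ∑ d, Rmat γ (x - y) (c, d) (e, f) • (site γ y b d * site γ x a c) := by
  have hx := Complex.exp_ne_zero x
  have hy := Complex.exp_ne_zero y
  have hg := Complex.exp_ne_zero γ
  ext s t
  simp only [Fin.sum_univ_two, Matrix.add_apply, Matrix.smul_apply]
  simp only [Matrix.mul_apply, Fin.sum_univ_two, site]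
  fin_cases a <;> fin_cases b <;> fin_cases e <;> fin_cases f <;> fin_cases s <;>
    fin_cases t <;> simp [Rmat, -mul_eq_mul_left_iff, -mul_eq_mul_right_iff] <;>
    first
    | ring1
    | (simp only [wtA, wtB, wtC, Complex.sinh, neg_add, neg_sub, Complex.exp_add, Complex.exp_sub,
        Complex.exp_neg]
       field_simp
       ring1)

/-- The R-matrix is pulled through the first site by `site_yangBaxter` and through the remaining
sites by induction. -/
lemma block_yangBaxter (γ : ℂ) {L : ℕ} (μ : Fin L → ℂ) (x y : ℂ) (a b a' b' : Fin 2) :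
    ∑ c, ∑ d, Rmat γ (x - y) (a, b) (c, d) • (block γ μ x c a' * block γ μ y d b') =
      ∑ c, ∑ d, Rmat γ (x - y) (c, d) (a', b') • (block γ μ y b d * block γ μ x a c) := by
  induction L generalizing a b a' b' with
  | zero =>
    simp only [block_zero]
    fin_cases a <;> fin_cases b <;> fin_cases a' <;> fin_cases b' <;> simp
  | succ L ih =>
    set μ' : Fin L → ℂ := fun k => μ k.succ
    have h1 : ∀ c d : Fin 2, block γ μ x c a' * block γ μ y d b' = ∑ e, ∑ f,
        tens (site γ (x - μ 0) c e * site γ (y - μ 0) d f)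
          (block γ μ' x e a' * block γ μ' y f b') := fun c d => by
      simp only [block_succ γ μ, Finset.sum_mul_sum, tens_mul_tens, μ']
    have h2 : ∀ c d : Fin 2, block γ μ y b d * block γ μ x a c = ∑ f, ∑ e,
        tens (site γ (y - μ 0) b f * site γ (x - μ 0) a e)
          (block γ μ' y f d * block γ μ' x e c) := fun c d => by
      simp only [block_succ γ μ, Finset.sum_mul_sum, tens_mul_tens, μ']
    have h3 : ∀ e f : Fin 2,
        ∑ c, ∑ d, Rmat γ (x - y) (a, b) (c, d) •
            (site γ (x - μ 0) c e * site γ (y - μ 0) d f) =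
          ∑ c, ∑ d, Rmat γ (x - y) (c, d) (e, f) •
            (site γ (y - μ 0) b d * site γ (x - μ 0) a c) := fun e f => by
      have := site_yangBaxter γ (x - μ 0) (y - μ 0) a b e f
      rwa [sub_sub_sub_cancel_right] at this
    calc _ = ∑ e, ∑ f, tens (∑ c, ∑ d, Rmat γ (x - y) (a, b) (c, d) •
            (site γ (x - μ 0) c e * site γ (y - μ 0) d f))
            (block γ μ' x e a' * block γ μ' y f b') := by
          simp only [h1, Finset.smul_sum, tens_sum_left, tens_smul_left]
          simp only [Fin.sum_univ_two]
          abel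
      _ = ∑ c, ∑ d, tens (site γ (y - μ 0) b d * site γ (x - μ 0) a c)
            (∑ e, ∑ f, Rmat γ (x - y) (c, d) (e, f) •
              (block γ μ' x e a' * block γ μ' y f b')) := by
          simp only [h3, tens_sum_left, tens_smul_left, tens_sum_right, tens_smul_right]
          simp only [Fin.sum_univ_two]
          abel
      _ = _ := by
          simp only [ih μ', h2, Finset.smul_sum, tens_sum_right, tens_smul_right]
          simp only [Fin.sum_univ_two]
          abel

/-! ### The quantum determinant -/

/-- The antisymmetric symbol on two indices. -/
def antisymm (a b : Fin 2) : ℂ := if a = b then 0 else if a = 0 then 1 else -1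

/-- At difference `-γ` of the spectral parameters `a` vanishes and `b = -c`, so the R-matrix is a
multiple of the antisymmetriser. This is why the antisymmetrised product of rows is scalar on the
site and again antisymmetric in the columns. -/
lemma site_quantumDet (γ x : ℂ) (a b : Fin 2) :
    site γ (x - γ) 0 a * site γ x 1 b - site γ (x - γ) 1 a * site γ x 0 b =
      (antisymm a b * (wtA γ x * wtB (x - γ))) • (1 : Matrix (Fin 2) (Fin 2) ℂ) := by
  have hx := Complex.exp_ne_zero x
  have hg := Complex.exp_ne_zero γ
  ext s t
  simp only [Matrix.sub_apply, Matrix.smul_apply, Matrix.mul_apply, Fin.sum_univ_two, site]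
  fin_cases a <;> fin_cases b <;> fin_cases s <;> fin_cases t <;>
    simp [Rmat, antisymm, -mul_eq_mul_left_iff, -mul_eq_mul_right_iff] <;>
    first
    | done
    | ring1
    | (simp only [wtA, wtB, wtC, Complex.sinh, neg_add, neg_sub, Complex.exp_add, Complex.exp_sub,
        Complex.exp_neg]
       field_simp
       ring1)

/-- The first site returns a scalar times the antisymmetric symbol, so that the same combination on
the remaining sites is left. Distinct columns give the quantum determinant, equal columns give
exchange rules at difference `γ`. -/
lemma block_quantumDet (γ : ℂ) {L : ℕ} (μ : Fin L → ℂ) (x : ℂ) (a b : Fin 2) :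
    block γ μ (x - γ) 0 a * block γ μ x 1 b - block γ μ (x - γ) 1 a * block γ μ x 0 b =
      (antisymm a b * ∏ k, wtA γ (x - μ k) * wtB (x - μ k - γ)) •
        (1 : Matrix (Fin L → Fin 2) (Fin L → Fin 2) ℂ) := by
  induction L with
  | zero =>
    simp only [block_zero]
    fin_cases a <;> fin_cases b <;> simp [antisymm]
  | succ L ih =>
    set μ' : Fin L → ℂ := fun k => μ k.succ with hμ'
    have h1 : ∀ c d, block γ μ (x - γ) c a * block γ μ x d b = ∑ e, ∑ f,
        tens (site γ (x - μ 0 - γ) c e * site γ (x - μ 0) d f)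
          (block γ μ' (x - γ) e a * block γ μ' x f b) := fun c d => by
      simp only [block_succ γ μ, Finset.sum_mul_sum, tens_mul_tens, μ', sub_right_comm]
    have h2 : block γ μ' (x - γ) 0 a * block γ μ' x 1 b =
      (antisymm a b * ∏ k, wtA γ (x - μ' k) * wtB (x - μ' k - γ)) •
        (1 : Matrix (Fin L → Fin 2) (Fin L → Fin 2) ℂ) +
        block γ μ' (x - γ) 1 a * block γ μ' x 0 b := by
      rw [← ih μ']; abel
    rw [h1, h1]
    simp only [← Finset.sum_sub_distrib, ← tens_sub_left, site_quantumDet]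
    have e00 : antisymm 0 0 = 0 := rfl
    have e11 : antisymm 1 1 = 0 := rfl
    have e01 : antisymm 0 1 = 1 := rfl
    have e10 : antisymm 1 0 = -1 := rfl
    simp only [Fin.sum_univ_two, tens_smul_left, e00, e11, e01, e10, h2, tens_add_right,
      tens_smul_right]
    rw [Fin.prod_univ_succ, ← tens_one_one]
    module

/-! ### Density of nonvanishing sets and continuity of the blocks -/

/-- By the identity theorem, a zero set with an interior point would be the whole space. -/
lemma dense_ne_zero {E : Type*} [NormedAddCommGroup E] [NormedSpace ℂ E] {f : E → ℂ}
    (hf : AnalyticOnNhd ℂ f Set.univ) {x₀ : E} (h : f x₀ ≠ 0) : Dense {x | f x ≠ 0} := by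
  intro x
  by_contra hx
  have h0 : ∀ᶠ y in nhds x, f y = 0 := by
    filter_upwards [isClosed_closure.isOpen_compl.mem_nhds hx] with y hy
    by_contra h
    exact hy (subset_closure h)
  exact h (hf.eqOn_zero_of_preconnected_of_eventuallyEq_zero isPreconnected_univ
    (Set.mem_univ x) h0 (Set.mem_univ x₀))

lemma analyticAt_sinh (z : ℂ) : AnalyticAt ℂ Complex.sinh z :=
  Complex.differentiable_sinh.analyticAt z

lemma dense_wtA_sub_ne_zero (γ y : ℂ) : Dense {x | wtA γ (x - y) ≠ 0} := by
  refine dense_ne_zero (fun z _ => (analyticAt_sinh _).comp (by fun_prop))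
    -- Here the argument of `sinh` is `iπ/2`, where `sinh` equals `i`.
    (x₀ := y - γ + Real.pi / 2 * Complex.I) ?_
  have : y - γ + Real.pi / 2 * Complex.I - y + γ = Real.pi / 2 * Complex.I := by ring
  rw [wtA, this, Complex.sinh_mul_I]
  simp

lemma continuous_wtA (γ : ℂ) : Continuous (wtA γ) := by
  unfold wtA; fun_prop

lemma continuous_wtB : Continuous wtB := by
  unfold wtB; fun_prop

lemma continuous_Rmat (γ : ℂ) (p q : Fin 2 × Fin 2) : Continuous fun x => Rmat γ x p q := by
  have := continuous_wtA γ
  have := continuous_wtB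
  unfold Rmat
  split_ifs <;> fun_prop

lemma continuous_block (γ : ℂ) {L : ℕ} (a b : Fin 2) :
    Continuous fun p : (Fin L → ℂ) × ℂ => block γ p.1 p.2 a b := by
  have h : Continuous fun p : (Fin L → ℂ) × ℂ => monodromy γ p.1 p.2 := by
    simp only [monodromy, List.ofFn_eq_map]
    refine continuous_list_prod _ fun j _ => ?_
    refine continuous_matrix fun s t => ?_
    unfold RmatAt
    split_ifs
    · exact (continuous_Rmat γ _ _).comp (by fun_prop)
    · fun_prop
  exact continuous_matrix fun s t => h.matrix_elem _ _

/-! ### Commutation relations -/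

section relations
variable (γ : ℂ) {L : ℕ} (μ : Fin L → ℂ)

/-- The Yang–Baxter relation yields `a(x - y)` times the commutator; this factor can be divided out
on a dense set of `x`, and continuity covers the rest. -/
lemma block_commute (x y : ℂ) (a b : Fin 2) : Commute (block γ μ x a b) (block γ μ y a b) := by
  have hc : ∀ f : ℂ → (Fin L → ℂ) × ℂ, Continuous f →
      Continuous fun x => block γ (f x).1 (f x).2 a b := fun f hf =>
    (continuous_block γ a b).comp hf
  have h1 : Continuous fun x => block γ μ x a b := hc (fun x => (μ, x)) (by fun_prop)
  have key : (fun x => block γ μ x a b * block γ μ y a b) =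
      fun x => block γ μ y a b * block γ μ x a b := by
    refine Continuous.ext_on (dense_wtA_sub_ne_zero γ y) (h1.mul continuous_const)
      (continuous_const.mul h1) fun x hx => ?_
    have := block_yangBaxter γ μ x y a a b b
    fin_cases a <;> fin_cases b <;> simpa [Rmat, (show wtA γ (x - y) ≠ 0 from hx)] using this
  exact congrFun key x

/-- This relation and the next three have one shape, up to the sign of the difference `y - x` and up
to transposition. `mulVec_bethe`, with `ε = ±1`, therefore treats all four at once. -/
lemma opA_mul_opB (x y : ℂ) :
    wtB (y - x) • (block γ μ x 0 0 * block γ μ y 0 1) =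
      wtA γ (y - x) • (block γ μ y 0 1 * block γ μ x 0 0)
        - wtC γ • (block γ μ x 0 1 * block γ μ y 0 0) := by
  have := block_yangBaxter γ μ y x 0 0 1 0
  simp [Rmat] at this
  rw [this]; abel

lemma opD_mul_opB (x y : ℂ) :
    wtB (x - y) • (block γ μ x 1 1 * block γ μ y 0 1) =
      wtA γ (x - y) • (block γ μ y 0 1 * block γ μ x 1 1)
        - wtC γ • (block γ μ x 0 1 * block γ μ y 1 1) := by
  have := block_yangBaxter γ μ x y 1 0 1 1
  simp [Rmat] at this
  rw [← this]; abel

lemma opC_mul_opA (x y : ℂ) :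
    wtB (y - x) • (block γ μ y 1 0 * block γ μ x 0 0) =
      wtA γ (y - x) • (block γ μ x 0 0 * block γ μ y 1 0)
        - wtC γ • (block γ μ y 0 0 * block γ μ x 1 0) := by
  have := block_yangBaxter γ μ y x 1 0 0 0
  simp [Rmat] at this
  rw [← this]; abel

lemma opC_mul_opD (x y : ℂ) :
    wtB (x - y) • (block γ μ y 1 0 * block γ μ x 1 1) =
      wtA γ (x - y) • (block γ μ x 1 1 * block γ μ y 1 0)
        - wtC γ • (block γ μ y 1 1 * block γ μ x 1 0) := by
  have := block_yangBaxter γ μ x y 1 1 1 0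
  simp [Rmat] at this
  rw [this]; abel

end relations

/-- The product `T_{ab}(X₁) ⋯ T_{ab}(X_n)`. -/
noncomputable def prodBlock (γ : ℂ) {L n : ℕ} (μ : Fin L → ℂ) (a b : Fin 2) (X : Fin n → ℂ) :
    Matrix (Fin L → Fin 2) (Fin L → Fin 2) ℂ := (List.ofFn fun i => block γ μ (X i) a b).prod

lemma prodBlock_succ (γ : ℂ) {L n : ℕ} (μ : Fin L → ℂ) (a b : Fin 2) (X : Fin (n + 1) → ℂ) :
    prodBlock γ μ a b X = block γ μ (X 0) a b * prodBlock γ μ a b fun k => X k.succ := by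
  simp [prodBlock, List.ofFn_succ]

lemma prodBlock_cons (γ : ℂ) {L n : ℕ} (μ : Fin L → ℂ) (a b : Fin 2) (x : ℂ) (X : Fin n → ℂ) :
    prodBlock γ μ a b (Fin.cons x X : Fin (n + 1) → ℂ) =
      block γ μ x a b * prodBlock γ μ a b X := by
  simp [prodBlock_succ]

lemma block_commute_prodBlock (γ : ℂ) {L n : ℕ} (μ : Fin L → ℂ) (a b : Fin 2) (x : ℂ)
    (X : Fin n → ℂ) : Commute (block γ μ x a b) (prodBlock γ μ a b X) := by
  refine Commute.list_prod_right _ _ fun M hM => ?_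
  obtain ⟨i, rfl⟩ := (List.mem_ofFn' _ _).1 hM
  exact block_commute γ μ _ _ a b

lemma scalarProduct_eq (γ : ℂ) {L n : ℕ} (μ : Fin L → ℂ) (X Y : Fin n → ℂ) :
    scalarProduct γ μ X Y = (prodBlock γ μ 1 0 X * prodBlock γ μ 0 1 Y) (vac L) (vac L) := rfl

/-! ### The reference state -/

lemma vac_succ_iff {L : ℕ} (s : Fin (L + 1) → Fin 2) :
    s = vac (L + 1) ↔ s 0 = 0 ∧ Fin.tail s = vac L := eq_iff_zero_tail s _

/-- The vanishing of `C` on the reference state must be part of the induction: `A` on `L + 1` sites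
contains `C` of the remaining sites. -/
lemma block_apply_vac (γ : ℂ) {L : ℕ} (μ : Fin L → ℂ) (x : ℂ) (s : Fin L → Fin 2) :
    block γ μ x 0 0 s (vac L) = (∏ k, wtA γ (x - μ k)) * (Pi.single (vac L) 1 : _ → ℂ) s ∧
    block γ μ x 1 1 s (vac L) = (∏ k, wtB (x - μ k)) * (Pi.single (vac L) 1 : _ → ℂ) s ∧
    block γ μ x 1 0 s (vac L) = 0 := by
  induction L with
  | zero => simp [block_zero, Subsingleton.elim s (vac 0)]
  | succ L ih =>
    obtain ⟨h1, h2, h3⟩ := ih (fun k => μ k.succ) (Fin.tail s)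
    have ht : Fin.tail (vac (L + 1)) = vac L := rfl
    have h0 : vac (L + 1) 0 = 0 := rfl
    have hs := vac_succ_iff s
    simp only [block_succ γ μ, Fin.sum_univ_two, Matrix.add_apply, tens, ht, h1, h2, h3, h0,
      Fin.prod_univ_succ]
    rcases Fin.exists_fin_two.1 ⟨s 0, rfl⟩ with h | h <;>
      by_cases h' : Fin.tail s = vac L <;>
      simp_all [site, Rmat, Pi.single_apply]

lemma block_vac_apply (γ : ℂ) {L : ℕ} (μ : Fin L → ℂ) (x : ℂ) (s : Fin L → Fin 2) :
    block γ μ x 0 0 (vac L) s = (∏ k, wtA γ (x - μ k)) * (Pi.single (vac L) 1 : _ → ℂ) s ∧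
    block γ μ x 1 1 (vac L) s = (∏ k, wtB (x - μ k)) * (Pi.single (vac L) 1 : _ → ℂ) s ∧
    block γ μ x 0 1 (vac L) s = 0 := by
  induction L with
  | zero => simp [block_zero, Subsingleton.elim s (vac 0)]
  | succ L ih =>
    obtain ⟨h1, h2, h3⟩ := ih (fun k => μ k.succ) (Fin.tail s)
    have ht : Fin.tail (vac (L + 1)) = vac L := rfl
    have h0 : vac (L + 1) 0 = 0 := rfl
    have hs := vac_succ_iff s
    simp only [block_succ γ μ, Fin.sum_univ_two, Matrix.add_apply, tens, ht, h1, h2, h3, h0,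
      Fin.prod_univ_succ]
    rcases Fin.exists_fin_two.1 ⟨s 0, rfl⟩ with h | h <;>
      by_cases h' : Fin.tail s = vac L <;>
      simp_all [site, Rmat, Pi.single_apply]

/-! ### Specialised spectral parameters -/

section special
variable (γ : ℂ) {L : ℕ} (μ : Fin (L + 1) → ℂ)

/-- The matrix unit `E_{st}`. -/
noncomputable def unit (s t : Fin 2) : Matrix (Fin 2) (Fin 2) ℂ := Matrix.single s t 1

lemma unit_mul_unit (s t u : Fin 2) : unit s t * unit t u = unit s u := by
  simp [unit]

lemma site_zero_zero (x : ℂ) :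
    site γ x 0 0 = wtA γ x • unit 0 0 + wtB x • unit 1 1 := by
  ext s t; fin_cases s <;> fin_cases t <;> simp [site, Rmat, unit]

lemma site_one_one (x : ℂ) :
    site γ x 1 1 = wtB x • unit 0 0 + wtA γ x • unit 1 1 := by
  ext s t; fin_cases s <;> fin_cases t <;> simp [site, Rmat, unit]

lemma site_zero_one (x : ℂ) : site γ x 0 1 = wtC γ • unit 1 0 := by
  ext s t; fin_cases s <;> fin_cases t <;> simp [site, Rmat, unit]

lemma site_one_zero (x : ℂ) : site γ x 1 0 = wtC γ • unit 0 1 := by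
  ext s t; fin_cases s <;> fin_cases t <;> simp [site, Rmat, unit]

lemma unit_mul_unit_of_ne {s t u v : Fin 2} (h : t ≠ u) : unit s t * unit u v = 0 := by
  simp [unit, h]

variable {γ μ}

/-- Next to this matrix unit the off-diagonal part `c E₀₁ ⊗ A` of `C` drops out, so `C` passes to
the remaining sites at the price of a scalar weight. The next three lemmas use the same mechanism.
-/
lemma opC_mul_tens (x : ℂ) (Y : Matrix (Fin L → Fin 2) (Fin L → Fin 2) ℂ) (t : Fin 2) :
    block γ μ x 1 0 * tens (unit 0 t) Y =
      wtB (x - μ 0) • tens (unit 0 t) (block γ (fun k => μ k.succ) x 1 0 * Y) := by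
  simp [block_succ γ μ, Fin.sum_univ_two, add_mul, tens_mul_tens, site_one_zero, site_one_one,
    unit_mul_unit, unit_mul_unit_of_ne, tens_smul_left]

lemma tens_mul_opC (x : ℂ) (Y : Matrix (Fin L → Fin 2) (Fin L → Fin 2) ℂ) (s : Fin 2) :
    tens (unit s 1) Y * block γ μ x 1 0 =
      wtA γ (x - μ 0) • tens (unit s 1) (Y * block γ (fun k => μ k.succ) x 1 0) := by
  simp [block_succ γ μ, Fin.sum_univ_two, mul_add, tens_mul_tens, site_one_zero, site_one_one,
    unit_mul_unit, unit_mul_unit_of_ne, tens_smul_left]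

lemma opB_mul_tens (x : ℂ) (Y : Matrix (Fin L → Fin 2) (Fin L → Fin 2) ℂ) (t : Fin 2) :
    block γ μ x 0 1 * tens (unit 1 t) Y =
      wtB (x - μ 0) • tens (unit 1 t) (block γ (fun k => μ k.succ) x 0 1 * Y) := by
  simp [block_succ γ μ, Fin.sum_univ_two, add_mul, tens_mul_tens, site_zero_one, site_zero_zero,
    unit_mul_unit, unit_mul_unit_of_ne, tens_smul_left]

lemma tens_mul_opB (x : ℂ) (Y : Matrix (Fin L → Fin 2) (Fin L → Fin 2) ℂ) (s : Fin 2) :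
    tens (unit s 0) Y * block γ μ x 0 1 =
      wtA γ (x - μ 0) • tens (unit s 0) (Y * block γ (fun k => μ k.succ) x 0 1) := by
  simp [block_succ γ μ, Fin.sum_univ_two, mul_add, tens_mul_tens, site_zero_one, site_zero_zero,
    unit_mul_unit, unit_mul_unit_of_ne, tens_smul_left]

lemma prodC_mul_tens {n : ℕ} (X : Fin n → ℂ) (Y : Matrix (Fin L → Fin 2) (Fin L → Fin 2) ℂ)
    (t : Fin 2) :
    prodBlock γ μ 1 0 X * tens (unit 0 t) Y = (∏ i, wtB (X i - μ 0)) •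
      tens (unit 0 t) (prodBlock γ (fun k => μ k.succ) 1 0 X * Y) := by
  induction n with
  | zero => simp [prodBlock]
  | succ n ih =>
    simp only [prodBlock_succ, mul_assoc, ih, mul_smul_comm, opC_mul_tens, smul_smul,
      Fin.prod_univ_succ]
    rw [mul_comm]

lemma prodB_mul_tens {n : ℕ} (X : Fin n → ℂ) (Y : Matrix (Fin L → Fin 2) (Fin L → Fin 2) ℂ)
    (t : Fin 2) :
    prodBlock γ μ 0 1 X * tens (unit 1 t) Y = (∏ i, wtB (X i - μ 0)) •
      tens (unit 1 t) (prodBlock γ (fun k => μ k.succ) 0 1 X * Y) := by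
  induction n with
  | zero => simp [prodBlock]
  | succ n ih =>
    simp only [prodBlock_succ, mul_assoc, ih, mul_smul_comm, opB_mul_tens, smul_smul,
      Fin.prod_univ_succ]
    rw [mul_comm]

lemma tens_mul_prodC {n : ℕ} (X : Fin n → ℂ) (Y : Matrix (Fin L → Fin 2) (Fin L → Fin 2) ℂ)
    (s : Fin 2) :
    tens (unit s 1) Y * prodBlock γ μ 1 0 X = (∏ i, wtA γ (X i - μ 0)) •
      tens (unit s 1) (Y * prodBlock γ (fun k => μ k.succ) 1 0 X) := by
  induction n generalizing Y with
  | zero => simp [prodBlock]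
  | succ n ih =>
    simp only [prodBlock_succ, ← mul_assoc, ih, smul_mul_assoc, tens_mul_opC, smul_smul,
      Fin.prod_univ_succ]

lemma tens_mul_prodB {n : ℕ} (X : Fin n → ℂ) (Y : Matrix (Fin L → Fin 2) (Fin L → Fin 2) ℂ)
    (s : Fin 2) :
    tens (unit s 0) Y * prodBlock γ μ 0 1 X = (∏ i, wtA γ (X i - μ 0)) •
      tens (unit s 0) (Y * prodBlock γ (fun k => μ k.succ) 0 1 X) := by
  induction n generalizing Y with
  | zero => simp [prodBlock]
  | succ n ih =>
    simp only [prodBlock_succ, ← mul_assoc, ih, smul_mul_assoc, tens_mul_opB, smul_smul,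
      Fin.prod_univ_succ]

lemma wtA_zero : wtA γ 0 = wtC γ := by simp [wtA, wtC]

lemma wtB_zero : wtB 0 = 0 := by simp [wtB]

lemma wtA_neg_self : wtA γ (-γ) = 0 := by simp [wtA]

lemma wtB_neg (x : ℂ) : wtB (-x) = -wtB x := by simp [wtB]

lemma wtB_neg_self : wtB (-γ) = -wtC γ := by simp [wtB, wtC]

lemma wtB_sub_sub_self (x y : ℂ) : wtB (x - y - γ) = -wtA γ (y - x) := by
  rw [wtA, wtB, ← Complex.sinh_neg]; congr 1; ring

lemma prod_wtB_sub_gamma :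
    ∏ k : Fin L, wtB (μ 0 - μ k.succ - γ) = (-1) ^ L * ∏ k : Fin L, wtA γ (μ k.succ - μ 0) := by
  simp only [wtB_sub_sub_self, neg_eq_neg_one_mul (wtA γ _), Finset.prod_mul_distrib,
    Finset.prod_const, Finset.card_univ, Fintype.card_fin]

/-- On the first site `a` vanishes at `μ 0 - γ` and `b` vanishes at `μ 0`. What is left is `c² E₀₀ ⊗
(AD - CB)`, and `AD - CB` is the quantum determinant of the remaining sites. -/
lemma opC_mul_opB_special :
    block γ μ (μ 0 - γ) 1 0 * block γ μ (μ 0) 0 1 =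
      recConst γ μ • tens (unit 0 0) (1 : Matrix (Fin L → Fin 2) (Fin L → Fin 2) ℂ) := by
  have hq := block_quantumDet γ (fun k : Fin L => μ k.succ) (μ 0) 0 1
  rw [show antisymm 0 1 = 1 from rfl, one_mul, sub_eq_iff_eq_add] at hq
  have h : recConst γ μ =
      wtC γ ^ 2 * ∏ k : Fin L, wtA γ (μ 0 - μ k.succ) * wtB (μ 0 - μ k.succ - γ) := by
    rw [recConst, Finset.prod_mul_distrib, Finset.prod_mul_distrib, prod_wtB_sub_gamma]; ring
  simp only [block_succ γ μ, Fin.sum_univ_two, site_zero_zero, site_zero_one, site_one_one,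
    site_one_zero, sub_self, sub_sub_cancel_left, wtA_zero, wtB_zero, wtA_neg_self, wtB_neg_self,
    zero_smul, add_zero, tens_smul_left, add_mul, mul_add, smul_mul_assoc,
    mul_smul_comm, tens_mul_tens, unit_mul_unit, hq, h, tens_add_right, tens_smul_right]
  simp only [ne_eq, zero_ne_one, one_ne_zero, not_false_eq_true, unit_mul_unit_of_ne,
    tens_zero_left, smul_zero]
  module

/-- The product reduces to `E₁₀ ⊗ (DB - BD)` on the remaining sites, which is zero by the
equal-column case of `block_quantumDet`. This relation makes `D(μ 0 - γ)` annihilate vectors that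
contain `B(μ 0)`. -/
lemma opB_mul_opB_special : block γ μ (μ 0 - γ) 0 1 * block γ μ (μ 0) 0 1 = 0 := by
  have hq := block_quantumDet γ (fun k : Fin L => μ k.succ) (μ 0) 1 1
  rw [show antisymm 1 1 = 0 from rfl, zero_mul, zero_smul, sub_eq_zero] at hq
  simp only [block_succ γ μ, Fin.sum_univ_two, site_zero_zero, site_zero_one, sub_self,
    sub_sub_cancel_left, wtA_zero, wtB_zero, wtA_neg_self, wtB_neg_self,
    zero_smul, add_zero, zero_add, tens_smul_left, add_mul, mul_add, smul_mul_assoc,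
    mul_smul_comm, tens_mul_tens, unit_mul_unit, hq]
  simp only [ne_eq, zero_ne_one, one_ne_zero, not_false_eq_true, unit_mul_unit_of_ne,
    tens_zero_left, smul_zero]
  module

lemma opC_mul_opC_special : block γ μ (μ 0 - γ) 1 0 * block γ μ (μ 0) 1 0 = 0 := by
  have hq := block_quantumDet γ (fun k : Fin L => μ k.succ) (μ 0) 0 0
  rw [show antisymm 0 0 = 0 from rfl, zero_mul, zero_smul, sub_eq_zero] at hq
  simp only [block_succ γ μ, Fin.sum_univ_two, site_one_one, site_one_zero, sub_self,
    sub_sub_cancel_left, wtA_zero, wtB_zero, wtA_neg_self, wtB_neg_self,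
    zero_smul, add_zero, zero_add, tens_smul_left, add_mul, mul_add, smul_mul_assoc,
    mul_smul_comm, tens_mul_tens, unit_mul_unit, hq]
  simp only [ne_eq, zero_ne_one, one_ne_zero, not_false_eq_true, unit_mul_unit_of_ne,
    tens_zero_left, smul_zero]
  module

lemma tens_unit_vac (Y : Matrix (Fin L → Fin 2) (Fin L → Fin 2) ℂ) :
    tens (unit 0 0) Y (vac (L + 1)) (vac (L + 1)) = Y (vac L) (vac L) := by
  have ht : Fin.tail (vac (L + 1)) = vac L := rfl
  have h0 : vac (L + 1) 0 = 0 := rfl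
  simp [tens, unit, ht, h0]

lemma scalarProduct_special_left {n : ℕ} (X Y : Fin n → ℂ) :
    scalarProduct γ μ (Fin.cons (μ 0 - γ) X : Fin (n + 1) → ℂ)
        (Fin.cons (μ 0) Y : Fin (n + 1) → ℂ) =
      (∏ j, wtB (X j - μ 0) * wtA γ (Y j - μ 0)) * Vfun γ μ X Y := by
  -- Commutativity of the `C`'s brings `C(μ 0 - γ)` next to `B(μ 0)` in the middle.
  rw [scalarProduct_eq, prodBlock_cons, prodBlock_cons, (block_commute_prodBlock ..).eq,
    ← mul_assoc, mul_assoc (prodBlock γ μ 1 0 X), opC_mul_opB_special, mul_smul_comm,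
    prodC_mul_tens, smul_mul_assoc, smul_mul_assoc, tens_mul_prodB, Matrix.smul_apply,
    Matrix.smul_apply, Matrix.smul_apply, tens_unit_vac, mul_one, ← scalarProduct_eq, Vfun,
    Finset.prod_mul_distrib]
  simp only [smul_eq_mul]
  ring

lemma unit_mul_mul_unit_vac
    (M : Matrix (Fin (L + 1) → Fin 2) (Fin (L + 1) → Fin 2) ℂ) :
    (tens (unit 0 0) 1 * M * tens (unit 0 0) 1 :
        Matrix (Fin (L + 1) → Fin 2) (Fin (L + 1) → Fin 2) ℂ) (vac (L + 1)) (vac (L + 1)) =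
      M (vac (L + 1)) (vac (L + 1)) := by
  have : tens (unit 0 0) (1 : Matrix (Fin L → Fin 2) (Fin L → Fin 2) ℂ) =
      Matrix.diagonal fun s => if s 0 = 0 then 1 else 0 := by
    ext s t
    have := eq_iff_zero_tail s t
    by_cases h : s 0 = t 0 <;> by_cases h' : Fin.tail s = Fin.tail t <;>
      by_cases h0 : t 0 = 0 <;>
      simp_all [tens, Matrix.one_apply, unit, eq_comm]
  simp [this, Matrix.mul_diagonal, Matrix.diagonal_mul, vac]

lemma opA_mul_mul_opD_vac (ν : Fin L → ℂ) (x y : ℂ)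
    (M : Matrix (Fin L → Fin 2) (Fin L → Fin 2) ℂ) :
    (block γ ν x 0 0 * M * block γ ν y 1 1) (vac L) (vac L) =
      (∏ k, wtA γ (x - ν k)) * (∏ k, wtB (y - ν k)) * M (vac L) (vac L) := by
  rw [Matrix.mul_apply]
  simp only [(block_apply_vac γ ν y _).2.1, Matrix.mul_apply, (block_vac_apply γ ν x _).1]
  simp [Pi.single_apply]
  ring

/-- Here the special operators stay on the outside, next to the reference states. They leave `A(μ
0)` and `D(μ 0 - γ)` of the remaining sites acting on the vacuum, and the eigenvalues multiply to
the constant that the quantum determinant gives in `scalarProduct_special_left`. -/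
lemma scalarProduct_special_right {n : ℕ} (X Y : Fin n → ℂ) :
    scalarProduct γ μ (Fin.cons (μ 0) X : Fin (n + 1) → ℂ)
        (Fin.cons (μ 0 - γ) Y : Fin (n + 1) → ℂ) =
      (∏ j, wtA γ (X j - μ 0) * wtB (Y j - μ 0)) * Vfun γ μ X Y := by
  have h1 : tens (unit 0 0) (1 : Matrix (Fin L → Fin 2) (Fin L → Fin 2) ℂ) *
      block γ μ (μ 0) 1 0 = wtC γ • tens (unit 0 1) (block γ (fun k => μ k.succ) (μ 0) 0 0) := by
    simp [block_succ γ μ, Fin.sum_univ_two, mul_add, tens_mul_tens, site_one_zero, site_one_one,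
      unit_mul_unit, unit_mul_unit_of_ne, tens_smul_left, wtB_zero]
  have h2 : block γ μ (μ 0 - γ) 0 1 *
      tens (unit 0 0) (1 : Matrix (Fin L → Fin 2) (Fin L → Fin 2) ℂ) =
      wtC γ • tens (unit 1 0) (block γ (fun k => μ k.succ) (μ 0 - γ) 1 1) := by
    simp [block_succ γ μ, Fin.sum_univ_two, add_mul, tens_mul_tens, site_zero_one, site_zero_zero,
      unit_mul_unit, unit_mul_unit_of_ne, tens_smul_left, wtA_neg_self]
  rw [scalarProduct_eq, prodBlock_cons, prodBlock_cons, (block_commute_prodBlock γ μ 0 1 _ Y).eq]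
  -- The projector `E₀₀` on the first site fixes the reference state; inserting it on both sides
  -- reduces `C(μ 0)` and `B(μ 0 - γ)` to single tensors.
  refine (unit_mul_mul_unit_vac _).symm.trans ?_
  have h3 : tens (unit 0 0) (1 : Matrix (Fin L → Fin 2) (Fin L → Fin 2) ℂ) *
      (block γ μ (μ 0) 1 0 * prodBlock γ μ 1 0 X *
        (prodBlock γ μ 0 1 Y * block γ μ (μ 0 - γ) 0 1)) * tens (unit 0 0) 1 =
      (tens (unit 0 0) 1 * block γ μ (μ 0) 1 0 * prodBlock γ μ 1 0 X) *
        (prodBlock γ μ 0 1 Y * (block γ μ (μ 0 - γ) 0 1 * tens (unit 0 0) 1)) := by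
    simp only [mul_assoc]
  rw [h3, h1, h2, smul_mul_assoc, mul_smul_comm, tens_mul_prodC, prodB_mul_tens]
  simp only [smul_mul_assoc, mul_smul_comm, tens_mul_tens, unit_mul_unit, Matrix.smul_apply,
    tens_unit_vac]
  rw [← mul_assoc, mul_assoc (block γ _ (μ 0) 0 0), opA_mul_mul_opD_vac, ← scalarProduct_eq, Vfun,
    recConst, Finset.prod_mul_distrib, Finset.prod_mul_distrib]
  simp only [sub_right_comm (μ 0) γ, prod_wtB_sub_gamma, smul_eq_mul]
  ring

end special

/-! ### Products over all indices but one -/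

lemma prod_erase_eq_prod_succAbove {M : Type*} [CommMonoid M] {n : ℕ} (i : Fin (n + 1))
    (f : Fin (n + 1) → M) : ∏ k ∈ Finset.univ.erase i, f k = ∏ k, f (i.succAbove k) := by
  have : Finset.univ.erase i = Finset.univ.map (Fin.succAboveEmb i) := by
    ext k
    simp [Fin.exists_succAbove_eq_iff (x := i) (y := k)]
  rw [this, Finset.prod_map]
  rfl

lemma prod_erase_succ {M : Type*} [CommMonoid M] {n : ℕ} (i : Fin n) (f : Fin (n + 1) → M) :
    ∏ k ∈ Finset.univ.erase i.succ, f k = f 0 * ∏ k ∈ Finset.univ.erase i, f k.succ := by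
  have h : ∀ {m : ℕ} (i : Fin m) (f : Fin m → M),
      ∏ k ∈ Finset.univ.erase i, f k = ∏ k, if k = i then 1 else f k := fun i f => by
    rw [← Finset.filter_ne', Finset.prod_filter]
    exact Finset.prod_congr rfl fun k _ => by by_cases h : k = i <;> simp [h]
  simp [h, Fin.prod_univ_succ, (Fin.succ_ne_zero i).symm]

lemma prod_erase_zero {M : Type*} [CommMonoid M] {n : ℕ} (f : Fin (n + 1) → M) :
    ∏ k ∈ Finset.univ.erase 0, f k = ∏ k : Fin n, f k.succ := by
  simp [prod_erase_eq_prod_succAbove]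

/-! ### The action of a diagonal block on a product of off-diagonal ones -/

/-- The off-shell Bethe vector `X(y₁) ⋯ X(y_n) v`. -/
noncomputable def bethe {N : Type*} [Fintype N] [DecidableEq N] (X : ℂ → Matrix N N ℂ) (v : N → ℂ)
    {n : ℕ} (y : Fin n → ℂ) : N → ℂ :=
  (List.ofFn fun i => X (y i)).prod.mulVec v

/-- The addition formula that merges two unwanted terms into one in the inductive step of
`mulVec_bethe`. -/
lemma three_term (γ p q : ℂ) :
    wtA γ p * wtB q + wtA γ (-q) * wtB p = wtC γ * wtB (p + q) := by
  have hp := Complex.exp_ne_zero p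
  have hq := Complex.exp_ne_zero q
  have hg := Complex.exp_ne_zero γ
  simp only [wtA, wtB, wtC, Complex.sinh, neg_add, neg_neg, Complex.exp_add, Complex.exp_neg]
  field_simp
  ring

section action
variable {N : Type*} [Fintype N] [DecidableEq N] {X Y : ℂ → Matrix N N ℂ} {v : N → ℂ}
  {e : ℂ → ℂ} {γ ε : ℂ}

lemma bethe_cons {n : ℕ} (x : ℂ) (y : Fin n → ℂ) :
    bethe X v (Fin.cons x y : Fin (n + 1) → ℂ) = (X x).mulVec (bethe X v y) := by
  simp [bethe, List.ofFn_succ]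

lemma bethe_comp_perm (hX : ∀ x y, Commute (X x) (X y)) {n : ℕ} (y : Fin n → ℂ)
    (σ : Equiv.Perm (Fin n)) : bethe X v (y ∘ σ) = bethe X v y := by
  unfold bethe
  congr 1
  refine List.Perm.prod_eq' (Equiv.Perm.ofFn_comp_perm σ fun i => X (y i)) ?_
  rw [List.pairwise_ofFn]
  exact fun i j _ => hX _ _

lemma bethe_update (hX : ∀ x y, Commute (X x) (X y)) {n : ℕ} (y : Fin (n + 1) → ℂ)
    (i : Fin (n + 1)) (x : ℂ) :
    bethe X v (Function.update y i x) =
      bethe X v (Fin.cons x (fun k => y (i.succAbove k)) : Fin (n + 1) → ℂ) := by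
  rw [← bethe_comp_perm hX _ i.cycleRange.symm]
  congr 1
  funext k
  refine Fin.cases ?_ (fun k => ?_) k <;> simp

/-- Both vectors are built from the same parameters, and the factors commute. -/
lemma bethe_swap (hX : ∀ x y, Commute (X x) (X y)) {n : ℕ} (y : Fin n → ℂ) (i : Fin n)
    (x z : ℂ) : (X x).mulVec (bethe X v (Function.update y i z)) =
      (X z).mulVec (bethe X v (Function.update y i x)) := by
  obtain _ | n := n
  · exact i.elim0
  · rw [bethe_update hX, bethe_update hX, bethe_cons, bethe_cons, Matrix.mulVec_mulVec,
      Matrix.mulVec_mulVec, (hX x z).eq]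

/-- The algebraic Bethe ansatz for an operator `Y` with vacuum eigenvalue `e`. -/
lemma mulVec_bethe (hX : ∀ x y, Commute (X x) (X y)) (hY : ∀ x, (Y x).mulVec v = e x • v)
    (hXY : ∀ x y, wtB (ε * (y - x)) • (Y x * X y) =
      wtA γ (ε * (y - x)) • (X y * Y x) - wtC γ • (X x * Y y))
    {n : ℕ} (y : Fin n → ℂ) (hy : ∀ i k, i ≠ k → wtB (ε * (y i - y k)) ≠ 0) (x : ℂ)
    (hx : ∀ i, wtB (ε * (y i - x)) ≠ 0) :
    (Y x).mulVec (bethe X v y) =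
      (e x * ∏ k, wtA γ (ε * (y k - x)) / wtB (ε * (y k - x))) • bethe X v y
      - ∑ i, (wtC γ / wtB (ε * (y i - x)) * e (y i) * ∏ k ∈ Finset.univ.erase i,
          wtA γ (ε * (y k - y i)) / wtB (ε * (y k - y i))) • bethe X v (Function.update y i x) := by
  induction n generalizing x with
  | zero => simp [bethe, hY]
  | succ n ih =>
    obtain ⟨y₀, y, rfl⟩ : ∃ (y₀ : ℂ) (y' : Fin n → ℂ), y = Fin.cons y₀ y' :=
      ⟨_, _, (Fin.cons_self_tail y).symm⟩
    have h0 := hx 0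
    simp only [Fin.cons_zero] at h0
    have hx' : ∀ i, wtB (ε * (y i - x)) ≠ 0 := fun i => by simpa using hx i.succ
    have hy' : ∀ i k, i ≠ k → wtB (ε * (y i - y k)) ≠ 0 := fun i k hik => by
      simpa using hy i.succ k.succ (by simpa using hik)
    have hy0 : ∀ i, wtB (ε * (y i - y₀)) ≠ 0 := fun i => by
      simpa using hy i.succ 0 (Fin.succ_ne_zero i)
    have hrel : Y x * X y₀ = (wtA γ (ε * (y₀ - x)) / wtB (ε * (y₀ - x))) • (X y₀ * Y x)
        - (wtC γ / wtB (ε * (y₀ - x))) • (X x * Y y₀) := by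
      rw [← inv_smul_smul₀ h0 (Y x * X y₀), hXY, smul_sub, smul_smul, smul_smul, div_eq_inv_mul,
        div_eq_inv_mul]
    have hu0 : Function.update (Fin.cons y₀ y : Fin (n + 1) → ℂ) 0 x = Fin.cons x y :=
      Fin.update_cons_zero ..
    have hus : ∀ i : Fin n, Function.update (Fin.cons y₀ y : Fin (n + 1) → ℂ) i.succ x =
        Fin.cons y₀ (Function.update y i x) := fun i => (Fin.cons_update ..).symm
    rw [bethe_cons, Matrix.mulVec_mulVec, hrel, Matrix.sub_mulVec, Matrix.smul_mulVec,
      Matrix.smul_mulVec, ← Matrix.mulVec_mulVec, ← Matrix.mulVec_mulVec, ih y hy' x hx',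
      ih y hy' y₀ hy0, Fin.sum_univ_succ, Fin.prod_univ_succ]
    simp only [hu0, hus, bethe_cons, Fin.cons_zero, Fin.cons_succ, prod_erase_succ,
      prod_erase_zero, Matrix.mulVec_sub, Matrix.mulVec_smul,
      Matrix.mulVec_sum, bethe_swap hX y _ x y₀]
    -- The vector in which `x` replaces `y i` arises twice: when `Y` passes `X y₀` and keeps its
    -- argument `x`, and when it takes over the argument `y₀`. `three_term` adds the two
    -- coefficients.
    have hcoef : ∀ i, wtA γ (ε * (y₀ - x)) / wtB (ε * (y₀ - x)) * (wtC γ / wtB (ε * (y i - x)))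
        - wtC γ / wtB (ε * (y₀ - x)) * (wtC γ / wtB (ε * (y i - y₀))) =
        wtC γ / wtB (ε * (y i - x)) *
          (wtA γ (ε * (y₀ - y i)) / wtB (ε * (y₀ - y i))) := fun i => by
      have h := three_term γ (ε * (y₀ - x)) (ε * (y i - y₀))
      have e1 : ε * (y₀ - x) + ε * (y i - y₀) = ε * (y i - x) := by ring
      have e2 : ε * (y₀ - y i) = -(ε * (y i - y₀)) := by ring
      rw [e1] at h
      rw [e2, wtB_neg]
      have := hx' i
      have := hy0 i
      field_simp
      linear_combination wtC γ * h
    have hsum : ∑ i, (wtC γ / wtB (ε * (y i - x)) * e (y i) *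
          (wtA γ (ε * (y₀ - y i)) / wtB (ε * (y₀ - y i)) * ∏ k ∈ Finset.univ.erase i,
          wtA γ (ε * (y k - y i)) / wtB (ε * (y k - y i)))) •
          (X y₀).mulVec (bethe X v (Function.update y i x)) =
        (wtA γ (ε * (y₀ - x)) / wtB (ε * (y₀ - x))) • ∑ i, (wtC γ / wtB (ε * (y i - x)) *
          e (y i) * ∏ k ∈ Finset.univ.erase i,
          wtA γ (ε * (y k - y i)) / wtB (ε * (y k - y i))) •
          (X y₀).mulVec (bethe X v (Function.update y i x)) -
        (wtC γ / wtB (ε * (y₀ - x))) • ∑ i, (wtC γ / wtB (ε * (y i - y₀)) *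
          e (y i) * ∏ k ∈ Finset.univ.erase i,
          wtA γ (ε * (y k - y i)) / wtB (ε * (y k - y i))) •
          (X y₀).mulVec (bethe X v (Function.update y i x)) := by
      rw [Finset.smul_sum, Finset.smul_sum, ← Finset.sum_sub_distrib]
      refine Finset.sum_congr rfl fun i _ => ?_
      rw [smul_smul, smul_smul, ← sub_smul]
      congr 1
      linear_combination (-(e (y i) * ∏ k ∈ Finset.univ.erase i,
          wtA γ (ε * (y k - y i)) / wtB (ε * (y k - y i)))) * hcoef i
    rw [hsum]
    module

/-- The algebraic Bethe ansatz, with the new parameter in first place. -/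
lemma mulVec_bethe_cons (hX : ∀ x y, Commute (X x) (X y)) (hY : ∀ x, (Y x).mulVec v = e x • v)
    (hXY : ∀ x y, wtB (ε * (y - x)) • (Y x * X y) =
      wtA γ (ε * (y - x)) • (X y * Y x) - wtC γ • (X x * Y y))
    {n : ℕ} (y : Fin (n + 1) → ℂ) (hy : ∀ i k, i ≠ k → wtB (ε * (y i - y k)) ≠ 0) (x : ℂ)
    (hx : ∀ i, wtB (ε * (y i - x)) ≠ 0) :
    (Y x).mulVec (bethe X v y) =
      (e x * ∏ k, wtA γ (ε * (y k - x)) / wtB (ε * (y k - x))) • bethe X v y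
      - ∑ i, (wtC γ / wtB (ε * (y i - x)) * e (y i) * ∏ k ∈ Finset.univ.erase i,
          wtA γ (ε * (y k - y i)) / wtB (ε * (y k - y i))) •
          bethe X v (Fin.cons x fun k => y (i.succAbove k) : Fin (n + 1) → ℂ) := by
  simpa only [bethe_update hX] using mulVec_bethe hX hY hXY y hy x hx

end action

/-! ### Scalar products and Bethe vectors -/

section exchange
variable {γ : ℂ} {L : ℕ} {μ : Fin L → ℂ}

/-- After transposition the dual vector is a Bethe vector too, for the commuting family of the
transposed `C`'s. The formulas for the action of `A` and `D` then apply on both sides. -/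
lemma scalarProduct_eq_dotProduct {n : ℕ} (X Y : Fin n → ℂ) :
    scalarProduct γ μ X Y =
      bethe (fun x => (block γ μ x 1 0).transpose) (Pi.single (vac L) 1) X ⬝ᵥ
        bethe (fun x => block γ μ x 0 1) (Pi.single (vac L) 1) Y := by
  have h : (List.ofFn fun i => (block γ μ (X i) 1 0).transpose).prod =
      (prodBlock γ μ 1 0 X).transpose := by
    rw [prodBlock, Matrix.transpose_list_prod, List.map_ofFn]
    -- Transposition reverses the order of the factors, which is immaterial since they commute.
    refine List.Perm.prod_eq' (List.reverse_perm _).symm ?_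
    rw [List.pairwise_ofFn]
    intro i j _
    have := (block_commute γ μ (X i) (X j) 1 0).eq
    change _ * _ = _ * _
    rw [← Matrix.transpose_mul, ← Matrix.transpose_mul, this]
  rw [scalarProduct_eq, Matrix.mul_apply, bethe, bethe, h]
  simp [dotProduct, prodBlock]

lemma mulVec_dotProduct {N : Type*} [Fintype N] (Z : Matrix N N ℂ) (u w : N → ℂ) :
    Z.transpose.mulVec u ⬝ᵥ w = u ⬝ᵥ Z.mulVec w := by
  rw [Matrix.mulVec_transpose, Matrix.dotProduct_mulVec]

lemma transpose_commute (x y : ℂ) :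
    Commute (block γ μ x 1 0).transpose (block γ μ y 1 0).transpose := by
  change _ * _ = _ * _
  rw [← Matrix.transpose_mul, ← Matrix.transpose_mul, (block_commute γ μ x y 1 0).eq]

lemma opA_mulVec_vac (x : ℂ) : (block γ μ x 0 0).mulVec (Pi.single (vac L) 1) =
    (∏ k, wtA γ (x - μ k)) • Pi.single (vac L) 1 := by
  ext s
  simpa using (block_apply_vac γ μ x s).1

lemma opD_mulVec_vac (x : ℂ) : (block γ μ x 1 1).mulVec (Pi.single (vac L) 1) =
    (∏ k, wtB (x - μ k)) • Pi.single (vac L) 1 := by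
  ext s
  simpa using (block_apply_vac γ μ x s).2.1

lemma opA_transpose_mulVec_vac (x : ℂ) :
    (block γ μ x 0 0).transpose.mulVec (Pi.single (vac L) 1) =
      (∏ k, wtA γ (x - μ k)) • Pi.single (vac L) 1 := by
  ext s
  simpa using (block_vac_apply γ μ x s).1

lemma opD_transpose_mulVec_vac (x : ℂ) :
    (block γ μ x 1 1).transpose.mulVec (Pi.single (vac L) 1) =
      (∏ k, wtB (x - μ k)) • Pi.single (vac L) 1 := by
  ext s
  simpa using (block_vac_apply γ μ x s).2.1

lemma opA_mulVec_bethe {n : ℕ} (Y : Fin (n + 1) → ℂ) (hY : ∀ i k, i ≠ k → wtB (Y i - Y k) ≠ 0)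
    (x : ℂ) (hx : ∀ i, wtB (Y i - x) ≠ 0) :
    (block γ μ x 0 0).mulVec (bethe (fun x => block γ μ x 0 1) (Pi.single (vac L) 1) Y) =
      ((∏ k, wtA γ (x - μ k)) * ∏ k, wtA γ (Y k - x) / wtB (Y k - x)) •
        bethe (fun x => block γ μ x 0 1) (Pi.single (vac L) 1) Y
      - ∑ j, (wtC γ / wtB (Y j - x) * (∏ k, wtA γ (Y j - μ k)) *
          ∏ k ∈ Finset.univ.erase j, wtA γ (Y k - Y j) / wtB (Y k - Y j)) •
          bethe (fun x => block γ μ x 0 1) (Pi.single (vac L) 1)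
            (Fin.cons x fun k => Y (j.succAbove k) : Fin (n + 1) → ℂ) := by
  simpa only [one_mul] using mulVec_bethe_cons (ε := 1) (γ := γ)
    (fun x y => block_commute γ μ x y 0 1) opA_mulVec_vac
    (fun x y => by simpa only [one_mul] using opA_mul_opB γ μ x y) Y
    (by simpa only [one_mul] using hY) x (by simpa only [one_mul] using hx)

lemma opA_transpose_mulVec_bethe {n : ℕ} (Y : Fin (n + 1) → ℂ)
    (hY : ∀ i k, i ≠ k → wtB (Y i - Y k) ≠ 0) (x : ℂ) (hx : ∀ i, wtB (Y i - x) ≠ 0) :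
    (block γ μ x 0 0).transpose.mulVec
        (bethe (fun x => (block γ μ x 1 0).transpose) (Pi.single (vac L) 1) Y) =
      ((∏ k, wtA γ (x - μ k)) * ∏ k, wtA γ (Y k - x) / wtB (Y k - x)) •
        bethe (fun x => (block γ μ x 1 0).transpose) (Pi.single (vac L) 1) Y
      - ∑ j, (wtC γ / wtB (Y j - x) * (∏ k, wtA γ (Y j - μ k)) *
          ∏ k ∈ Finset.univ.erase j, wtA γ (Y k - Y j) / wtB (Y k - Y j)) •
          bethe (fun x => (block γ μ x 1 0).transpose) (Pi.single (vac L) 1)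
            (Fin.cons x fun k => Y (j.succAbove k) : Fin (n + 1) → ℂ) := by
  simpa only [one_mul] using mulVec_bethe_cons (ε := 1) (γ := γ)
    (Y := fun x => (block γ μ x 0 0).transpose) transpose_commute opA_transpose_mulVec_vac
    (fun x y => by
      simpa only [one_mul, Matrix.transpose_smul, Matrix.transpose_sub, Matrix.transpose_mul]
        using congrArg Matrix.transpose (opC_mul_opA γ μ x y)) Y
    (by simpa only [one_mul] using hY) x (by simpa only [one_mul] using hx)

lemma opD_mulVec_bethe {n : ℕ} (Y : Fin (n + 1) → ℂ) (hY : ∀ i k, i ≠ k → wtB (Y i - Y k) ≠ 0)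
    (x : ℂ) (hx : ∀ i, wtB (x - Y i) ≠ 0) :
    (block γ μ x 1 1).mulVec (bethe (fun x => block γ μ x 0 1) (Pi.single (vac L) 1) Y) =
      ((∏ k, wtB (x - μ k)) * ∏ k, wtA γ (x - Y k) / wtB (x - Y k)) •
        bethe (fun x => block γ μ x 0 1) (Pi.single (vac L) 1) Y
      - ∑ j, (wtC γ / wtB (x - Y j) * (∏ k, wtB (Y j - μ k)) *
          ∏ k ∈ Finset.univ.erase j, wtA γ (Y j - Y k) / wtB (Y j - Y k)) •
          bethe (fun x => block γ μ x 0 1) (Pi.single (vac L) 1)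
            (Fin.cons x fun k => Y (j.succAbove k) : Fin (n + 1) → ℂ) := by
  simpa only [neg_one_mul, neg_sub] using mulVec_bethe_cons (ε := -1) (γ := γ)
    (fun x y => block_commute γ μ x y 0 1) opD_mulVec_vac
    (fun x y => by simpa only [neg_one_mul, neg_sub] using opD_mul_opB γ μ x y) Y
    (by simpa only [neg_one_mul, neg_sub] using fun i k hik => hY k i (Ne.symm hik)) x
    (by simpa only [neg_one_mul, neg_sub] using hx)

lemma opD_transpose_mulVec_bethe {n : ℕ} (Y : Fin (n + 1) → ℂ)
    (hY : ∀ i k, i ≠ k → wtB (Y i - Y k) ≠ 0) (x : ℂ) (hx : ∀ i, wtB (x - Y i) ≠ 0) :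
    (block γ μ x 1 1).transpose.mulVec
        (bethe (fun x => (block γ μ x 1 0).transpose) (Pi.single (vac L) 1) Y) =
      ((∏ k, wtB (x - μ k)) * ∏ k, wtA γ (x - Y k) / wtB (x - Y k)) •
        bethe (fun x => (block γ μ x 1 0).transpose) (Pi.single (vac L) 1) Y
      - ∑ j, (wtC γ / wtB (x - Y j) * (∏ k, wtB (Y j - μ k)) *
          ∏ k ∈ Finset.univ.erase j, wtA γ (Y j - Y k) / wtB (Y j - Y k)) •
          bethe (fun x => (block γ μ x 1 0).transpose) (Pi.single (vac L) 1)
            (Fin.cons x fun k => Y (j.succAbove k) : Fin (n + 1) → ℂ) := by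
  simpa only [neg_one_mul, neg_sub] using mulVec_bethe_cons (ε := -1) (γ := γ)
    (Y := fun x => (block γ μ x 1 1).transpose) transpose_commute opD_transpose_mulVec_vac
    (fun x y => by
      simpa only [neg_one_mul, neg_sub, Matrix.transpose_smul, Matrix.transpose_sub,
        Matrix.transpose_mul] using congrArg Matrix.transpose (opC_mul_opD γ μ x y)) Y
    (by simpa only [neg_one_mul, neg_sub] using fun i k hik => hY k i (Ne.symm hik)) x
    (by simpa only [neg_one_mul, neg_sub] using hx)

end exchange

/-! ### The recursion for the scalar product -/

section recursion
variable {γ : ℂ} {L : ℕ} {μ : Fin (L + 1) → ℂ}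

lemma bethe_cons_cons_eq_zero {N : Type*} [Fintype N] [DecidableEq N] {X : ℂ → Matrix N N ℂ}
    {v : N → ℂ} {x z : ℂ} (h : X x * X z = 0) {n : ℕ} (y : Fin (n + 1) → ℂ) (hy : y 0 = z) :
    bethe X v (Fin.cons x y : Fin (n + 2) → ℂ) = 0 := by
  rw [bethe_cons, ← Fin.cons_self_tail y, bethe_cons, Matrix.mulVec_mulVec, hy, h,
    Matrix.zero_mulVec]

/-- Every term of the exchange formula vanishes: the diagonal one contains `a(-γ) = 0`, the one that
replaces `μ 0` contains the vacuum eigenvalue `∏ b(μ 0 - μ k) = 0`, and the others contain `B(μ 0 -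
γ) B(μ 0) = 0`. -/
lemma opD_mulVec_bethe_special (hc : wtC γ ≠ 0) {n : ℕ} (Y : Fin n → ℂ)
    (hY : ∀ i k, i ≠ k → wtB (Y i - Y k) ≠ 0)
    (hY0 : ∀ i, wtA γ (Y i - μ 0) ≠ 0 ∧ wtB (Y i - μ 0) ≠ 0) :
    (block γ μ (μ 0 - γ) 1 1).mulVec (bethe (fun x => block γ μ x 0 1)
      (Pi.single (vac (L + 1)) 1) (Fin.cons (μ 0) Y : Fin (n + 1) → ℂ)) = 0 := by
  rw [opD_mulVec_bethe]
  · have h0 : ∏ k, wtA γ (μ 0 - γ - (Fin.cons (μ 0) Y : Fin (n + 1) → ℂ) k) /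
        wtB (μ 0 - γ - (Fin.cons (μ 0) Y : Fin (n + 1) → ℂ) k) = 0 :=
      Finset.prod_eq_zero (Finset.mem_univ 0) (by simp [wtA_neg_self])
    rw [h0, mul_zero, zero_smul, zero_sub, neg_eq_zero, Fin.sum_univ_succ]
    rw [Fin.cons_zero, Fin.prod_univ_succ (fun k => wtB (μ 0 - μ k)), sub_self, wtB_zero, zero_mul,
      mul_zero, zero_mul, zero_smul, zero_add]
    refine Finset.sum_eq_zero fun i _ => ?_
    obtain _ | n := n
    · exact i.elim0
    · rw [bethe_cons_cons_eq_zero (X := fun x => block γ μ x 0 1) (z := μ 0)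
        opB_mul_opB_special _ (by simp), smul_zero]
  · intro i k
    refine Fin.cases ?_ (fun i => ?_) i <;> refine Fin.cases ?_ (fun k => ?_) k <;> intro hik
    · simp at hik
    · rw [Fin.cons_zero, Fin.cons_succ, ← neg_sub, wtB_neg]
      exact neg_ne_zero.2 (hY0 k).2
    · exact (hY0 i).2
    · exact hY i k (by simpa using hik)
  · intro i
    refine Fin.cases ?_ (fun i => ?_) i
    · simpa [wtB_neg_self] using hc
    · rw [Fin.cons_succ, sub_right_comm, wtB_sub_sub_self]
      exact neg_ne_zero.2 (hY0 i).1

lemma opD_transpose_mulVec_bethe_special (hc : wtC γ ≠ 0) {n : ℕ} (Y : Fin n → ℂ)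
    (hY : ∀ i k, i ≠ k → wtB (Y i - Y k) ≠ 0)
    (hY0 : ∀ i, wtA γ (Y i - μ 0) ≠ 0 ∧ wtB (Y i - μ 0) ≠ 0) :
    (block γ μ (μ 0 - γ) 1 1).transpose.mulVec (bethe (fun x => (block γ μ x 1 0).transpose)
      (Pi.single (vac (L + 1)) 1) (Fin.cons (μ 0) Y : Fin (n + 1) → ℂ)) = 0 := by
  rw [opD_transpose_mulVec_bethe]
  · have h0 : ∏ k, wtA γ (μ 0 - γ - (Fin.cons (μ 0) Y : Fin (n + 1) → ℂ) k) /
        wtB (μ 0 - γ - (Fin.cons (μ 0) Y : Fin (n + 1) → ℂ) k) = 0 :=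
      Finset.prod_eq_zero (Finset.mem_univ 0) (by simp [wtA_neg_self])
    rw [h0, mul_zero, zero_smul, zero_sub, neg_eq_zero, Fin.sum_univ_succ]
    rw [Fin.cons_zero, Fin.prod_univ_succ (fun k => wtB (μ 0 - μ k)), sub_self, wtB_zero, zero_mul,
      mul_zero, zero_mul, zero_smul, zero_add]
    refine Finset.sum_eq_zero fun i _ => ?_
    obtain _ | n := n
    · exact i.elim0
    · rw [bethe_cons_cons_eq_zero (X := fun x => (block γ μ x 1 0).transpose) (z := μ 0) _ _
        (by simp), smul_zero]
      rw [(transpose_commute _ _).eq, ← Matrix.transpose_mul, opC_mul_opC_special,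
        Matrix.transpose_zero]
  · intro i k
    refine Fin.cases ?_ (fun i => ?_) i <;> refine Fin.cases ?_ (fun k => ?_) k <;> intro hik
    · simp at hik
    · rw [Fin.cons_zero, Fin.cons_succ, ← neg_sub, wtB_neg]
      exact neg_ne_zero.2 (hY0 k).2
    · exact (hY0 i).2
    · exact hY i k (by simpa using hik)
  · intro i
    refine Fin.cases ?_ (fun i => ?_) i
    · simpa [wtB_neg_self] using hc
    · rw [Fin.cons_succ, sub_right_comm, wtB_sub_sub_self]
      exact neg_ne_zero.2 (hY0 i).1

lemma wtA_sub_gamma_sub (x y : ℂ) : wtA γ (x - γ - y) = -wtB (y - x) := by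
  rw [wtA, wtB, ← Complex.sinh_neg]; congr 1; ring

lemma wtB_sub_gamma_sub (x y : ℂ) : wtB (x - γ - y) = -wtA γ (y - x) := by
  rw [sub_right_comm, wtB_sub_sub_self]

/-- Inserting `D(μ₁ - γ)` expands scalar products containing `B(μ₁)`. -/
lemma scalarProduct_cons_right (hc : wtC γ ≠ 0) {n : ℕ} (X : Fin (n + 1) → ℂ) (Y : Fin n → ℂ)
    (hX : ∀ i k, i ≠ k → wtB (X i - X k) ≠ 0) (hX0 : ∀ i, wtA γ (X i - μ 0) ≠ 0)
    (hY : ∀ i k, i ≠ k → wtB (Y i - Y k) ≠ 0)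
    (hY0 : ∀ i, wtA γ (Y i - μ 0) ≠ 0 ∧ wtB (Y i - μ 0) ≠ 0) :
    (∏ k, wtB (μ 0 - γ - μ k)) * (∏ k, wtB (X k - μ 0) / wtA γ (X k - μ 0)) *
        scalarProduct γ μ X (Fin.cons (μ 0) Y : Fin (n + 1) → ℂ) =
      ∑ i, -(wtC γ / wtA γ (X i - μ 0)) * (∏ k, wtB (X i - μ k)) *
        (∏ k ∈ Finset.univ.erase i, wtA γ (X i - X k) / wtB (X i - X k)) *
        ((∏ j, wtB (X (i.succAbove j) - μ 0) * wtA γ (Y j - μ 0)) *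
          Vfun γ μ (fun k => X (i.succAbove k)) Y) := by
  -- The matrix element of `D(μ 0 - γ)` between the two Bethe vectors: acting to the right it is
  -- zero, acting to the left it yields the asserted expansion.
  have h := mulVec_dotProduct (block γ μ (μ 0 - γ) 1 1)
    (bethe (fun x => (block γ μ x 1 0).transpose) (Pi.single (vac (L + 1)) 1) X)
    (bethe (fun x => block γ μ x 0 1) (Pi.single (vac (L + 1)) 1)
      (Fin.cons (μ 0) Y : Fin (n + 1) → ℂ))
  rw [opD_mulVec_bethe_special hc Y hY hY0, dotProduct_zero, opD_transpose_mulVec_bethe X hX _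
    (fun i => by rw [wtB_sub_gamma_sub]; exact neg_ne_zero.2 (hX0 i)), sub_dotProduct,
    sum_dotProduct, sub_eq_zero] at h
  simp only [smul_dotProduct, ← scalarProduct_eq_dotProduct, scalarProduct_special_left] at h
  simp only [wtA_sub_gamma_sub, wtB_sub_gamma_sub _ (X _), neg_div, neg_neg, smul_eq_mul,
    div_neg] at h
  exact h

/-- Inserting `D(μ₁ - γ)` expands scalar products containing `C(μ₁)`. -/
lemma scalarProduct_cons_left (hc : wtC γ ≠ 0) {n : ℕ} (X : Fin n → ℂ) (Y : Fin (n + 1) → ℂ)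
    (hY : ∀ i k, i ≠ k → wtB (Y i - Y k) ≠ 0) (hY0 : ∀ i, wtA γ (Y i - μ 0) ≠ 0)
    (hX : ∀ i k, i ≠ k → wtB (X i - X k) ≠ 0)
    (hX0 : ∀ i, wtA γ (X i - μ 0) ≠ 0 ∧ wtB (X i - μ 0) ≠ 0) :
    (∏ k, wtB (μ 0 - γ - μ k)) * (∏ k, wtB (Y k - μ 0) / wtA γ (Y k - μ 0)) *
        scalarProduct γ μ (Fin.cons (μ 0) X : Fin (n + 1) → ℂ) Y =
      ∑ j, -(wtC γ / wtA γ (Y j - μ 0)) * (∏ k, wtB (Y j - μ k)) *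
        (∏ k ∈ Finset.univ.erase j, wtA γ (Y j - Y k) / wtB (Y j - Y k)) *
        ((∏ i, wtA γ (X i - μ 0) * wtB (Y (j.succAbove i) - μ 0)) *
          Vfun γ μ X (fun k => Y (j.succAbove k))) := by
  have h := mulVec_dotProduct (block γ μ (μ 0 - γ) 1 1)
    (bethe (fun x => (block γ μ x 1 0).transpose) (Pi.single (vac (L + 1)) 1)
      (Fin.cons (μ 0) X : Fin (n + 1) → ℂ))
    (bethe (fun x => block γ μ x 0 1) (Pi.single (vac (L + 1)) 1) Y)
  rw [opD_transpose_mulVec_bethe_special hc X hX hX0, zero_dotProduct, opD_mulVec_bethe Y hY _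
    (fun i => by rw [wtB_sub_gamma_sub]; exact neg_ne_zero.2 (hY0 i)), dotProduct_sub,
    dotProduct_sum, eq_comm, sub_eq_zero] at h
  simp only [dotProduct_smul, ← scalarProduct_eq_dotProduct, scalarProduct_special_right] at h
  simp only [wtA_sub_gamma_sub, wtB_sub_gamma_sub _ (Y _), neg_div, neg_neg, smul_eq_mul,
    div_neg] at h
  exact h

/-- Inserting `A(μ₁)` expresses a scalar product by scalar products containing `B(μ₁)` or
`C(μ₁)`. -/
lemma scalarProduct_insert_opA {n : ℕ} (X Y : Fin (n + 1) → ℂ)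
    (hX : ∀ i k, i ≠ k → wtB (X i - X k) ≠ 0) (hX0 : ∀ i, wtB (X i - μ 0) ≠ 0)
    (hY : ∀ i k, i ≠ k → wtB (Y i - Y k) ≠ 0) (hY0 : ∀ i, wtB (Y i - μ 0) ≠ 0) :
    (∏ k, wtA γ (μ 0 - μ k)) * Ffac γ μ X Y * scalarProduct γ μ X Y =
      (∑ i, wtC γ / wtB (X i - μ 0) * (∏ k, wtA γ (X i - μ k)) *
        (∏ k ∈ Finset.univ.erase i, wtA γ (X k - X i) / wtB (X k - X i)) *
        scalarProduct γ μ (Fin.cons (μ 0) fun k => X (i.succAbove k) : Fin (n + 1) → ℂ) Y) -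
      ∑ j, wtC γ / wtB (Y j - μ 0) * (∏ k, wtA γ (Y j - μ k)) *
        (∏ k ∈ Finset.univ.erase j, wtA γ (Y k - Y j) / wtB (Y k - Y j)) *
        scalarProduct γ μ X (Fin.cons (μ 0) fun k => Y (j.succAbove k) : Fin (n + 1) → ℂ) := by
  have h := mulVec_dotProduct (block γ μ (μ 0) 0 0)
    (bethe (fun x => (block γ μ x 1 0).transpose) (Pi.single (vac (L + 1)) 1) X)
    (bethe (fun x => block γ μ x 0 1) (Pi.single (vac (L + 1)) 1) Y)
  rw [opA_transpose_mulVec_bethe X hX _ hX0, opA_mulVec_bethe Y hY _ hY0, dotProduct_sub,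
    dotProduct_sum, sub_dotProduct, sum_dotProduct] at h
  simp only [dotProduct_smul, smul_dotProduct, ← scalarProduct_eq_dotProduct, smul_eq_mul] at h
  rw [Ffac]
  linear_combination h

/-- For `c = 0` the R-matrix is diagonal. This settles the degenerate case, in which the recursion
cannot be derived by dividing by `c`. -/
lemma opB_eq_zero (hc : wtC γ = 0) {L : ℕ} (μ : Fin L → ℂ) (x : ℂ) : block γ μ x 0 1 = 0 := by
  induction L with
  | zero => simp [block_zero]
  | succ L ih => simp [block_succ γ μ, Fin.sum_univ_two, ih, site_zero_one, hc]

lemma scalarProduct_eq_zero (hc : wtC γ = 0) {L n : ℕ} (μ : Fin L → ℂ) (X Y : Fin (n + 1) → ℂ) :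
    scalarProduct γ μ X Y = 0 := by
  rw [scalarProduct_eq, prodBlock_succ γ μ 0 1, opB_eq_zero hc, zero_mul, mul_zero]
  rfl

lemma prod_succAbove_eq_div {n : ℕ} (i : Fin (n + 1)) {f : Fin (n + 1) → ℂ} (h : f i ≠ 0) :
    ∏ k, f (i.succAbove k) = (∏ k, f k) / f i := by
  rw [Fin.prod_univ_succAbove f i, mul_div_cancel_left₀ _ h]

lemma prod_wtB_sub_comm (x : ℂ) :
    ∏ k, wtB (μ k - x) = (-1) ^ (L + 1) * ∏ k, wtB (x - μ k) := by
  have : ∀ k, wtB (μ k - x) = -1 * wtB (x - μ k) := fun k => by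
    rw [← neg_sub, wtB_neg, neg_one_mul]
  simp only [this, Finset.prod_mul_distrib, Finset.prod_const, Finset.card_univ, Fintype.card_fin]

/-- The recursion for the scalar product. -/
theorem scalarProduct_recursion {n : ℕ} (X Y : Fin (n + 1) → ℂ)
    (hμ : ∀ k : Fin L, wtA γ (μ 0 - μ k.succ) ≠ 0 ∧ wtA γ (μ k.succ - μ 0) ≠ 0)
    (hX0 : ∀ i, wtA γ (X i - μ 0) ≠ 0 ∧ wtB (X i - μ 0) ≠ 0)
    (hY0 : ∀ i, wtA γ (Y i - μ 0) ≠ 0 ∧ wtB (Y i - μ 0) ≠ 0)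
    (hX : ∀ i k, i ≠ k → wtB (X i - X k) ≠ 0) (hY : ∀ i k, i ≠ k → wtB (Y i - Y k) ≠ 0)
    (hF : Ffac γ μ X Y ≠ 0) :
    scalarProduct γ μ X Y = Kfac γ μ X Y * ∑ i, ∑ j, Omega γ μ X Y i j *
      Vfun γ μ (fun k => X (i.succAbove k)) (fun k => Y (j.succAbove k)) := by
  by_cases hc : wtC γ = 0
  · simp [scalarProduct_eq_zero hc, Vfun, recConst, hc]
  have hsX : ∀ (i : Fin (n + 1)) (k l : Fin n), k ≠ l →
      wtB (X (i.succAbove k) - X (i.succAbove l)) ≠ 0 := fun i k l h =>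
    hX _ _ (fun h' => h (Fin.succAbove_right_injective h'))
  have hsY : ∀ (i : Fin (n + 1)) (k l : Fin n), k ≠ l →
      wtB (Y (i.succAbove k) - Y (i.succAbove l)) ≠ 0 := fun i k l h =>
    hY _ _ (fun h' => h (Fin.succAbove_right_injective h'))
  have hP1 : (∏ k : Fin L, wtA γ (μ 0 - μ k.succ)) ≠ 0 :=
    Finset.prod_ne_zero_iff.2 fun k _ => (hμ k).1
  have hP2 : (∏ k : Fin L, wtA γ (μ k.succ - μ 0)) ≠ 0 :=
    Finset.prod_ne_zero_iff.2 fun k _ => (hμ k).2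
  have hXa : (∏ k, wtA γ (X k - μ 0)) ≠ 0 := Finset.prod_ne_zero_iff.2 fun k _ => (hX0 k).1
  have hXb : (∏ k, wtB (X k - μ 0)) ≠ 0 := Finset.prod_ne_zero_iff.2 fun k _ => (hX0 k).2
  have hYa : (∏ k, wtA γ (Y k - μ 0)) ≠ 0 := Finset.prod_ne_zero_iff.2 fun k _ => (hY0 k).1
  have hYb : (∏ k, wtB (Y k - μ 0)) ≠ 0 := Finset.prod_ne_zero_iff.2 fun k _ => (hY0 k).2
  -- The first factor is `a(0) = c`; in `eD` below it is `b(-γ) = -c`.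
  have eA : ∏ k, wtA γ (μ 0 - μ k) = wtC γ * ∏ k : Fin L, wtA γ (μ 0 - μ k.succ) := by
    rw [Fin.prod_univ_succ, sub_self, wtA_zero]
  have eD : ∏ k, wtB (μ 0 - γ - μ k) =
      -wtC γ * ((-1) ^ L * ∏ k : Fin L, wtA γ (μ k.succ - μ 0)) := by
    simp only [sub_right_comm (μ 0) γ]
    rw [Fin.prod_univ_succ, sub_self, zero_sub, wtB_neg_self, prod_wtB_sub_gamma]
  have hs : ((-1 : ℂ) ^ L) ≠ 0 := pow_ne_zero _ (by norm_num)
  have hDX : (∏ k, wtB (μ 0 - γ - μ k)) * (∏ k, wtB (X k - μ 0) / wtA γ (X k - μ 0)) ≠ 0 := by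
    rw [eD, Finset.prod_div_distrib]
    exact mul_ne_zero (mul_ne_zero (neg_ne_zero.2 hc) (mul_ne_zero hs hP2)) (div_ne_zero hXb hXa)
  have hDY : (∏ k, wtB (μ 0 - γ - μ k)) * (∏ k, wtB (Y k - μ 0) / wtA γ (Y k - μ 0)) ≠ 0 := by
    rw [eD, Finset.prod_div_distrib]
    exact mul_ne_zero (mul_ne_zero (neg_ne_zero.2 hc) (mul_ne_zero hs hP2)) (div_ne_zero hYb hYa)
  have hA : (∏ k, wtA γ (μ 0 - μ k)) * Ffac γ μ X Y ≠ 0 :=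
    mul_ne_zero (by rw [eA]; exact mul_ne_zero hc hP1) hF
  have h := eq_div_of_mul_eq hA ((mul_comm _ _).trans
    (scalarProduct_insert_opA X Y hX (fun i => (hX0 i).2) hY (fun i => (hY0 i).2)))
  have hR := fun j => eq_div_of_mul_eq hDX ((mul_comm _ _).trans
    (scalarProduct_cons_right hc X (fun k => Y (j.succAbove k)) hX
      (fun i => (hX0 i).1) (hsY j) (fun i => hY0 _)))
  have hL := fun i => eq_div_of_mul_eq hDY ((mul_comm _ _).trans
    (scalarProduct_cons_left hc (fun k => X (i.succAbove k)) Y hY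
      (fun i => (hY0 i).1) (hsX i) (fun i => hX0 _)))
  -- The expansions `hR` and `hL`, coming from `D(μ 0 - γ)`, are substituted into the identity `h`,
  -- coming from `A(μ 0)`. The two resulting double sums give the two summands of `Omega`.
  rw [h]
  simp only [hR, hL]
  simp only [Finset.mul_sum, Finset.sum_div]
  rw [Finset.sum_comm (s := Finset.univ) (t := Finset.univ) (f := fun j i => wtC γ / wtB (Y j - μ 0) * _ * _ * (_ / _))]
  rw [← Finset.sum_sub_distrib, Finset.sum_div]
  refine Finset.sum_congr rfl fun i _ => ?_
  rw [← Finset.sum_sub_distrib, Finset.sum_div]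
  refine Finset.sum_congr rfl fun j _ => ?_
  rw [Finset.prod_mul_distrib, Finset.prod_mul_distrib,
    prod_succAbove_eq_div i (f := fun k => wtA γ (X k - μ 0)) (hX0 i).1,
    prod_succAbove_eq_div i (f := fun k => wtB (X k - μ 0)) (hX0 i).2,
    prod_succAbove_eq_div j (f := fun k => wtA γ (Y k - μ 0)) (hY0 j).1,
    prod_succAbove_eq_div j (f := fun k => wtB (Y k - μ 0)) (hY0 j).2, eA, eD, Kfac, Omega]
  have h1 := (hX0 i).1
  have h2 := (hX0 i).2
  have h3 := (hY0 j).1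
  have h4 := (hY0 j).2
  generalize Vfun γ μ (fun k => X (i.succAbove k)) (fun k => Y (j.succAbove k)) = V
  generalize Ffac γ μ X Y = F at *
  generalize ∏ k ∈ Finset.univ.erase i, wtA γ (X k - X i) / wtB (X k - X i) = E₁
  generalize ∏ k ∈ Finset.univ.erase i, wtA γ (X i - X k) / wtB (X i - X k) = E₂
  generalize ∏ k ∈ Finset.univ.erase j, wtA γ (Y k - Y j) / wtB (Y k - Y j) = E₃
  generalize ∏ k ∈ Finset.univ.erase j, wtA γ (Y j - Y k) / wtB (Y j - Y k) = E₄
  simp only [Finset.prod_mul_distrib, Finset.prod_div_distrib, prod_wtB_sub_comm (μ := μ),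
    pow_succ]
  generalize wtA γ (X i - μ 0) = x₁ at *
  generalize wtB (X i - μ 0) = x₂ at *
  generalize wtA γ (Y j - μ 0) = y₁ at *
  generalize wtB (Y j - μ 0) = y₂ at *
  generalize (∏ k : Fin L, wtA γ (μ 0 - μ k.succ)) = P₁ at *
  generalize (∏ k : Fin L, wtA γ (μ k.succ - μ 0)) = P₂ at *
  generalize (∏ k, wtA γ (X k - μ 0)) = X₁ at *
  generalize (∏ k, wtB (X k - μ 0)) = X₂ at *
  generalize (∏ k, wtA γ (Y k - μ 0)) = Y₁ at *
  generalize (∏ k, wtB (Y k - μ 0)) = Y₂ at *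
  generalize (∏ k, wtA γ (X i - μ k)) = Z₁
  generalize (∏ k, wtB (X i - μ k)) = Z₂
  generalize (∏ k, wtA γ (Y j - μ k)) = Z₃
  generalize (∏ k, wtB (Y j - μ k)) = Z₄
  clear h hR hL hA hDX hDY eA eD
  -- The signs `(-1)^L` and `(-1)^(L + 1)` remain on the two sides; fixing the parity leaves a
  -- rational identity.
  rcases neg_one_pow_eq_or ℂ L with hL | hL <;> rw [hL] <;> field_simp <;> ring

end recursion
open Set

/-! ### Contour integrals -/

/-- The entire function `sinh z / z`. -/
noncomputable def sinhDiv : ℂ → ℂ := dslope Complex.sinh 0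

lemma wtB_eq_mul_sinhDiv (z : ℂ) : wtB z = z * sinhDiv z := by
  simpa [wtB, sinhDiv] using (sub_smul_dslope Complex.sinh 0 z).symm

lemma differentiable_sinhDiv : Differentiable ℂ sinhDiv := by
  rw [← differentiableOn_univ, sinhDiv, Complex.differentiableOn_dslope Filter.univ_mem]
  exact Complex.differentiable_sinh.differentiableOn

lemma sinhDiv_zero : sinhDiv 0 = 1 := by simp [sinhDiv]

/-- Nonvanishing of `sinhDiv` says that no zero of `b` other than the origin is met. In this form
the condition is open, and it allows `1 / b` to be split into `1 / z` and a holomorphic factor. -/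
lemma sinhDiv_ne_zero_iff {z : ℂ} : sinhDiv z ≠ 0 ↔ (wtB z = 0 → z = 0) := by
  rw [wtB_eq_mul_sinhDiv, mul_eq_zero]
  refine ⟨fun h h' => h'.resolve_right h, fun h h' => ?_⟩
  rw [h (Or.inr h'), sinhDiv_zero] at h'
  exact one_ne_zero h'

namespace Contour

lemma sphere_subset_trace (Γ : Contour) (j : Fin Γ.m) :
    Metric.sphere (Γ.center j) (Γ.radius j) ⊆ Γ.trace := subset_iUnion_of_subset j subset_rfl

lemma closedBall_subset_filled (Γ : Contour) (j : Fin Γ.m) :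
    Metric.closedBall (Γ.center j) (Γ.radius j) ⊆ Γ.filled := subset_iUnion_of_subset j subset_rfl

lemma trace_subset_filled (Γ : Contour) : Γ.trace ⊆ Γ.filled :=
  iUnion_mono fun _ => Metric.sphere_subset_closedBall

lemma inside_subset_filled (Γ : Contour) : Γ.inside ⊆ Γ.filled :=
  iUnion_mono fun _ => Metric.ball_subset_closedBall

lemma isOpen_inside (Γ : Contour) : IsOpen Γ.inside := isOpen_iUnion fun _ => Metric.isOpen_ball

lemma isCompact_filled (Γ : Contour) : IsCompact Γ.filled :=
  isCompact_iUnion fun _ => isCompact_closedBall _ _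

lemma filled_subset_closure_inside (Γ : Contour) : Γ.filled ⊆ closure Γ.inside := by
  refine iUnion_subset fun j => ?_
  rw [← closure_ball _ (Γ.radius_pos j).ne']
  exact closure_mono (subset_iUnion_of_subset j subset_rfl)

lemma ne_of_mem_trace_of_mem_inside {Γ : Contour} {z c : ℂ} (hz : z ∈ Γ.trace)
    (hc : c ∈ Γ.inside) : z ≠ c := by
  rintro rfl
  obtain ⟨j, hj⟩ := mem_iUnion.1 hz
  obtain ⟨k, hk⟩ := mem_iUnion.1 hc
  rcases eq_or_ne j k with rfl | h
  · exact (Metric.mem_ball.1 hk).ne (Metric.mem_sphere.1 hj)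
  · exact (Γ.disjoint h).le_bot ⟨Metric.sphere_subset_closedBall hj,
      Metric.ball_subset_closedBall hk⟩

lemma integral_congr (Γ : Contour) {f g : ℂ → ℂ} (h : EqOn f g Γ.trace) :
    Γ.integral f = Γ.integral g := by
  unfold Contour.integral
  refine Finset.sum_congr rfl fun j _ => ?_
  rw [circleIntegral.integral_congr (Γ.radius_pos j).le (h.mono (Γ.sphere_subset_trace j))]

lemma integral_const_mul (Γ : Contour) (a : ℂ) (f : ℂ → ℂ) :
    Γ.integral (fun z => a * f z) = a * Γ.integral f := by
  unfold Contour.integral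
  rw [Finset.mul_sum]
  refine Finset.sum_congr rfl fun j _ => ?_
  rw [circleIntegral.integral_const_mul]
  ring

lemma integral_sum (Γ : Contour) {ι : Type*} (s : Finset ι) (f : ι → ℂ → ℂ)
    (hf : ∀ i ∈ s, ContinuousOn (f i) Γ.trace) :
    Γ.integral (fun z => ∑ i ∈ s, f i z) = ∑ i ∈ s, Γ.integral (f i) := by
  unfold Contour.integral
  rw [Finset.sum_comm]
  refine Finset.sum_congr rfl fun j _ => ?_
  rw [circleIntegral.integral_fun_sum, Finset.mul_sum]
  exact fun i hi => ((hf i hi).mono (Γ.sphere_subset_trace j)).circleIntegrable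
    (Γ.radius_pos j).le

/-- Cauchy's integral formula. -/
lemma integral_inv_sub_mul {Γ : Contour} {f : ℂ → ℂ} (hf : DifferentiableOn ℂ f Γ.filled) {c : ℂ}
    (hc : c ∈ Γ.inside) : Γ.integral (fun z => (z - c)⁻¹ * f z) = f c := by
  have h2 : (2 * Real.pi * Complex.I : ℂ) ≠ 0 := Complex.two_pi_I_ne_zero
  obtain ⟨k, hk⟩ := mem_iUnion.1 hc
  unfold Contour.integral
  rw [Finset.sum_eq_single k]
  · have := (hf.mono (Γ.closedBall_subset_filled k)).circleIntegral_sub_inv_smul hk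
    simp only [smul_eq_mul] at this
    rw [this, inv_mul_cancel_left₀ h2]
  · intro j _ hj
    have hne : ∀ z ∈ Metric.closedBall (Γ.center j) (Γ.radius j), z - c ≠ 0 := by
      intro z hz h
      rw [sub_eq_zero.1 h] at hz
      exact (Γ.disjoint hj).le_bot ⟨hz, Metric.ball_subset_closedBall hk⟩
    have hd : DifferentiableOn ℂ (fun z => (z - c)⁻¹ * f z)
        (Metric.closedBall (Γ.center j) (Γ.radius j)) :=
      ((differentiableOn_id.sub_const c).inv hne).mul (hf.mono (Γ.closedBall_subset_filled j))
    rw [DiffContOnCl.circleIntegral_eq_zero (Γ.radius_pos j).le, mul_zero]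
    exact (hd.mono Metric.closure_ball_subset_closedBall).diffContOnCl
  · simp

lemma integral_eq_zero {Γ : Contour} {f : ℂ → ℂ} (hf : DifferentiableOn ℂ f Γ.filled) :
    Γ.integral f = 0 := by
  unfold Contour.integral
  refine Finset.sum_eq_zero fun j _ => ?_
  rw [DiffContOnCl.circleIntegral_eq_zero (Γ.radius_pos j).le, mul_zero]
  exact ((hf.mono (Γ.closedBall_subset_filled j)).mono
    Metric.closure_ball_subset_closedBall).diffContOnCl

end Contour

/-- Partial fractions, obtained from Lagrange interpolation of the constant `1`. -/
lemma inv_prod_sub_eq_sum {n : ℕ} [NeZero n] {c : Fin n → ℂ} (hc : Function.Injective c) {z : ℂ}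
    (hz : ∀ j, z ≠ c j) :
    (∏ j, (z - c j))⁻¹ = ∑ j, (∏ k ∈ Finset.univ.erase j, (c j - c k))⁻¹ * (z - c j)⁻¹ := by
  have h := congrArg (Polynomial.eval z) (Lagrange.sum_basis (s := Finset.univ) (v := c)
    hc.injOn Finset.univ_nonempty)
  simp only [Polynomial.eval_finsetSum, Polynomial.eval_one,
    Lagrange.eval_basis_not_at_node (Finset.mem_univ _) (hz _), ← Finset.mul_sum,
    Lagrange.eval_nodal, Lagrange.nodalWeight, Finset.prod_inv_distrib] at h
  exact inv_eq_of_mul_eq_one_right h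

/-- The factors `sinhDiv` of the denominators are absorbed into the holomorphic function `g`.
Partial fractions then leave simple poles, to which Cauchy's formula applies. -/
lemma Contour.integral_div_prod_wtB {Γ : Contour} {n : ℕ} {c : Fin n → ℂ}
    (hc : Function.Injective c) (mem : ∀ j, c j ∈ Γ.inside)
    (only : ∀ z ∈ Γ.filled, ∀ j, wtB (z - c j) = 0 → z = c j) {F : ℂ → ℂ}
    (hF : DifferentiableOn ℂ F Γ.filled) :
    Γ.integral (fun z => F z / ∏ j, wtB (z - c j)) =
      ∑ j, F (c j) / ∏ k ∈ Finset.univ.erase j, wtB (c j - c k) := by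
  -- Partial fractions need at least one pole. Without poles the sum is empty and the integral is
  -- zero by Cauchy's theorem.
  obtain _ | n := n
  · simpa using Contour.integral_eq_zero hF
  have hs : ∀ z ∈ Γ.filled, ∀ j, sinhDiv (z - c j) ≠ 0 := fun z hz j =>
    sinhDiv_ne_zero_iff.2 fun h => sub_eq_zero.2 (only z hz j h)
  set g : ℂ → ℂ := fun z => F z / ∏ j, sinhDiv (z - c j) with hg
  have hgd : DifferentiableOn ℂ g Γ.filled := by
    refine hF.div (DifferentiableOn.fun_finsetProd fun j _ => ?_)
      fun z hz => Finset.prod_ne_zero_iff.2 fun j _ => hs z hz j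
    exact (differentiable_sinhDiv.comp (differentiable_id.sub_const _)).differentiableOn
  have h1 : EqOn (fun z => F z / ∏ j, wtB (z - c j)) (fun z => ∑ j,
      (∏ k ∈ Finset.univ.erase j, (c j - c k))⁻¹ * ((z - c j)⁻¹ * g z)) Γ.trace := by
    intro z hz
    have hne : ∀ j, z ≠ c j := fun j => Contour.ne_of_mem_trace_of_mem_inside hz (mem j)
    simp only [← mul_assoc, ← Finset.sum_mul, ← inv_prod_sub_eq_sum hc hne, hg,
      wtB_eq_mul_sinhDiv, Finset.prod_mul_distrib]
    rw [div_mul_eq_div_div_swap, inv_mul_eq_div]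
  have h2 : ∀ j, ContinuousOn (fun z => (∏ k ∈ Finset.univ.erase j, (c j - c k))⁻¹ *
      ((z - c j)⁻¹ * g z)) Γ.trace := fun j => by
    refine continuousOn_const.mul (ContinuousOn.mul (ContinuousOn.inv₀ (by fun_prop) fun z hz => ?_)
      (hgd.continuousOn.mono Γ.trace_subset_filled))
    exact sub_ne_zero.2 (Contour.ne_of_mem_trace_of_mem_inside hz (mem j))
  rw [Γ.integral_congr h1, Γ.integral_sum _ _ fun j _ => h2 j]
  refine Finset.sum_congr rfl fun j _ => ?_
  rw [Γ.integral_const_mul, Contour.integral_inv_sub_mul hgd (mem j), hg]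
  simp only [wtB_eq_mul_sinhDiv, Finset.prod_mul_distrib]
  rw [← Finset.mul_prod_erase Finset.univ (fun k => sinhDiv (c j - c k)) (Finset.mem_univ j),
    sub_self, sinhDiv_zero, one_mul, div_mul_eq_div_div_swap, inv_mul_eq_div]

/-! ### Multiple contour integrals -/

lemma multiIntegral_congr {m : ℕ} (Γ : Fin m → Contour) {F G : (Fin m → ℂ) → ℂ}
    (h : ∀ w, (∀ i, w i ∈ (Γ i).trace) → F w = G w) :
    multiIntegral Γ F = multiIntegral Γ G := by
  induction m with
  | zero => exact h _ fun i => i.elim0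
  | succ m ih =>
    refine (Γ 0).integral_congr fun z hz => ih _ fun w hw => h _ fun i => ?_
    refine Fin.cases ?_ (fun i => ?_) i
    · simpa using hz
    · simpa using hw i

lemma multiIntegral_const_mul {m : ℕ} (Γ : Fin m → Contour) (a : ℂ) (F : (Fin m → ℂ) → ℂ) :
    multiIntegral Γ (fun w => a * F w) = a * multiIntegral Γ F := by
  induction m with
  | zero => rfl
  | succ m ih =>
    simp only [multiIntegral, ih]
    exact Contour.integral_const_mul _ _ _

lemma multiIntegral_zero {m : ℕ} (Γ : Fin m → Contour) : multiIntegral Γ (fun _ => 0) = 0 := by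
  simpa using multiIntegral_const_mul Γ 0 (fun _ => 0)

lemma analyticOnNhd_cons_comp {m : ℕ} {K : Fin (m + 1) → Set ℂ} {F : (Fin (m + 1) → ℂ) → ℂ}
    (hF : AnalyticOnNhd ℂ F {w | ∀ i, w i ∈ K i}) {z : ℂ} (hz : z ∈ K 0) :
    AnalyticOnNhd ℂ (fun w : Fin m → ℂ => F (Fin.cons z w)) {w | ∀ i, w i ∈ K i.succ} := by
  intro w hw
  have h : (Fin.cons z w : Fin (m + 1) → ℂ) ∈ {w | ∀ i, w i ∈ K i} := fun i => by
    refine Fin.cases ?_ (fun i => ?_) i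
    · simpa using hz
    · simpa using hw i
  refine (hF _ h).fun_comp (f := fun w : Fin m → ℂ => (Fin.cons z w : Fin (m + 1) → ℂ)) ?_
  refine AnalyticAt.pi fun i => ?_
  refine Fin.cases ?_ (fun i => ?_) i
  · simpa using analyticAt_const
  · simp only [Fin.cons_succ]
    exact (ContinuousLinearMap.proj (R := ℂ) (φ := fun _ : Fin m => ℂ) i).analyticAt w

lemma differentiableOn_cons_comp {m : ℕ} {K : Fin (m + 1) → Set ℂ} {F : (Fin (m + 1) → ℂ) → ℂ}
    (hF : AnalyticOnNhd ℂ F {w | ∀ i, w i ∈ K i}) {w : Fin m → ℂ} (hw : ∀ i, w i ∈ K i.succ) :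
    DifferentiableOn ℂ (fun z => F (Fin.cons z w)) (K 0) := by
  intro z hz
  have h : (Fin.cons z w : Fin (m + 1) → ℂ) ∈ {w | ∀ i, w i ∈ K i} := fun i => by
    refine Fin.cases ?_ (fun i => ?_) i
    · simpa using hz
    · simpa using hw i
  refine DifferentiableAt.differentiableWithinAt ?_
  refine (hF _ h).differentiableAt.comp z
    (f := fun z => (Fin.cons z w : Fin (m + 1) → ℂ)) (differentiableAt_pi.2 fun i => ?_)
  refine Fin.cases ?_ (fun i => ?_) i
  · simp
  · simp

/-- The multiple residue theorem for poles at the zeros of `b(w_i - c_j)`. -/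
lemma multiIntegral_div_prod_wtB {m n : ℕ} {Γ : Fin m → Contour} {c : Fin n → ℂ}
    (hc : Function.Injective c) (mem : ∀ i j, c j ∈ (Γ i).inside)
    (only : ∀ i, ∀ z ∈ (Γ i).filled, ∀ j, wtB (z - c j) = 0 → z = c j) {F : (Fin m → ℂ) → ℂ}
    (hF : AnalyticOnNhd ℂ F {w | ∀ i, w i ∈ (Γ i).filled}) :
    multiIntegral Γ (fun w => F w / ∏ i, ∏ j, wtB (w i - c j)) =
      ∑ f : Fin m → Fin n, F (c ∘ f) /
        ∏ i, ∏ k ∈ Finset.univ.erase (f i), wtB (c (f i) - c k) := by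
  induction m with
  | zero =>
    simp [multiIntegral]
    congr 1
    exact Subsingleton.elim _ _
  | succ m ih =>
    -- For `z` on the first contour the inner integrals are known by induction; what remains is a
    -- one-variable integral with the same poles.
    have h1 : EqOn (fun z => multiIntegral (fun i => Γ i.succ) fun w =>
          F (Fin.cons z w : Fin (m + 1) → ℂ) /
            ∏ i, ∏ j, wtB ((Fin.cons z w : Fin (m + 1) → ℂ) i - c j))
        (fun z => (∑ f : Fin m → Fin n, F (Fin.cons z (c ∘ f)) /
          ∏ i, ∏ k ∈ Finset.univ.erase (f i), wtB (c (f i) - c k)) / ∏ j, wtB (z - c j))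
        (Γ 0).trace := by
      intro z hz
      have hF' := analyticOnNhd_cons_comp (K := fun i => (Γ i).filled) hF
        ((Γ 0).trace_subset_filled hz)
      have := ih (Γ := fun i => Γ i.succ) (fun i j => mem _ j) (fun i => only _) hF'
      simp only [Fin.prod_univ_succ, Fin.cons_zero, Fin.cons_succ]
      rw [← this, div_eq_inv_mul, ← multiIntegral_const_mul]
      refine multiIntegral_congr _ fun w _ => ?_
      rw [div_mul_eq_div_div_swap, div_eq_inv_mul]
    refine ((Γ 0).integral_congr h1).trans ?_
    rw [Contour.integral_div_prod_wtB hc (mem 0) (only 0), sum_fin_succ_fun]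
    · refine Finset.sum_congr rfl fun j _ => ?_
      rw [Finset.sum_div]
      refine Finset.sum_congr rfl fun f _ => ?_
      rw [Fin.prod_univ_succ, div_mul_eq_div_div_swap]
      simp only [Fin.cons_zero, Fin.cons_succ]
      congr 3
      funext i
      refine Fin.cases ?_ (fun i => ?_) i <;> simp
    · refine DifferentiableOn.fun_sum fun f _ => DifferentiableOn.div_const ?_ _
      exact differentiableOn_cons_comp (K := fun i => (Γ i).filled) hF
        fun i => (Γ i.succ).inside_subset_filled (mem _ _)

/-- In the induction the angle on the first circle joins the parameter, which is why the parameter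
space is an arbitrary topological space. Continuity is only required for `w` on the contours. -/
lemma continuous_multiIntegral {X : Type*} [TopologicalSpace X] {m : ℕ} (Γ : Fin m → Contour)
    (F : X → (Fin m → ℂ) → ℂ)
    (hF : Continuous fun p : X × {w : Fin m → ℂ // ∀ i, w i ∈ (Γ i).trace} => F p.1 p.2.1) :
    Continuous fun x => multiIntegral Γ (F x) := by
  induction m generalizing X with
  | zero =>
    exact hF.comp (g := fun p : X × {w : Fin 0 → ℂ // ∀ i, w i ∈ (Γ i).trace} => F p.1 p.2.1)
      (f := fun x => (x, ⟨Fin.elim0, fun i => i.elim0⟩)) (by fun_prop)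
  | succ m ih =>
    simp only [multiIntegral, Contour.integral, circleIntegral]
    refine continuous_finsetSum _ fun j _ => continuous_const.mul ?_
    refine intervalIntegral.continuous_parametric_intervalIntegral_of_continuous' ?_ _ _
    have hm : ∀ θ : ℝ, circleMap ((Γ 0).center j) ((Γ 0).radius j) θ ∈ (Γ 0).trace := fun θ =>
      (Γ 0).sphere_subset_trace j (circleMap_mem_sphere _ ((Γ 0).radius_pos j).le _)
    set C := circleMap ((Γ 0).center j) ((Γ 0).radius j) with hC
    have hCc : Continuous C := continuous_circleMap _ _
    obtain ⟨g, hg⟩ : ∃ g : (X × ℝ) × {w : Fin m → ℂ // ∀ i, w i ∈ (Γ i.succ).trace} →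
        Fin (m + 1) → ℂ, ∀ p, g p = Fin.cons (C p.1.2) p.2.1 := ⟨_, fun _ => rfl⟩
    have hgt : ∀ p i, g p i ∈ (Γ i).trace := fun p i => by
      rw [hg]
      refine Fin.cases ?_ (fun i => ?_) i
      · exact hm _
      · exact p.2.2 i
    have hgc : Continuous g := by
      refine continuous_pi fun i => ?_
      simp only [hg]
      refine Fin.cases ?_ (fun i => ?_) i
      · exact hCc.comp continuous_fst.snd
      · exact (continuous_apply i).comp (continuous_subtype_val.comp continuous_snd)
    have hcomp := hF.comp (continuous_fst.fst.prodMk (hgc.subtype_mk hgt))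
    have h := ih (X := X × ℝ) (fun i => Γ i.succ) (fun p w => F p.1 (Fin.cons (C p.2) w))
      (by simpa only [Function.comp_def, hg] using hcomp)
    change Continuous fun p : X × ℝ => deriv C p.2 •
      multiIntegral (fun i => Γ i.succ) fun w => F p.1 (Fin.cons (C p.2) w)
    have hd : Continuous fun p : X × ℝ => deriv C p.2 := by
      have := continuous_circleMap 0 ((Γ 0).radius j)
      simp only [hC, deriv_circleMap]
      fun_prop
    exact hd.smul h

/-! ### The kernel as a quotient of entire functions -/

/-- `R_i`, multiplied by its denominators. -/
noncomputable def Rnum (γ : ℂ) {L n : ℕ} (h : n ≤ L) (μ : Fin L → ℂ) (w v : Fin n → ℂ)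
    (i : Fin n) : ℂ :=
  (∏ k ∈ Finset.Ici i, wtA γ (w k - μ (Fin.castLE h i)) * wtB (v k - μ (Fin.castLE h i)))
  - ∏ k ∈ Finset.Ici i, wtA γ (v k - μ (Fin.castLE h i)) * wtB (w k - μ (Fin.castLE h i))

/-- `Λ_i`, multiplied by its denominators. -/
noncomputable def Lnum (γ : ℂ) {L n : ℕ} (h : n ≤ L) (μ : Fin L → ℂ) (w v : Fin n → ℂ)
    (i : Fin n) : ℂ :=
  (∏ k ∈ Finset.Ici (Fin.castLE h i), wtA γ (v i - μ k) * wtB (μ k - w i))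
    * (∏ k ∈ Finset.Ioi i, -(wtA γ (w i - w k) * wtA γ (v k - v i)))
  - (∏ k ∈ Finset.Ici (Fin.castLE h i), wtA γ (w i - μ k) * wtB (μ k - v i))
    * (∏ k ∈ Finset.Ioi i, -(wtA γ (w k - w i) * wtA γ (v i - v k)))

/-- The factor of the numerator of the kernel which belongs to a pair `i < j`. -/
noncomputable def pairNum (γ : ℂ) {L n : ℕ} (h : n ≤ L) (μ : Fin L → ℂ) (w v : Fin n → ℂ)
    (i j : Fin n) : ℂ :=
  wtB (w i - w j) * wtB (v i - v j) * (wtA γ (w j - μ (Fin.castLE h i)) *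
    wtA γ (v j - μ (Fin.castLE h i)) * (wtB (w j - μ (Fin.castLE h i)) *
    wtB (v j - μ (Fin.castLE h i))))

/-- The numerator of the kernel. -/
noncomputable def Hnum (γ : ℂ) {L n : ℕ} (h : n ≤ L) (μ : Fin L → ℂ) (w v : Fin n → ℂ) : ℂ :=
  (-1) ^ (L * n + n * (n + 1) / 2) * wtC γ ^ (2 * n) *
    ∏ i, (∏ j ∈ Finset.Ioi i, pairNum γ h μ w v i j) * Lnum γ h μ w v i

section kernel
variable {γ : ℂ} {L n : ℕ} {h : n ≤ L} {μ : Fin L → ℂ} {w v : Fin n → ℂ}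

lemma Rfac_eq_div (i : Fin n) (hb : ∀ k, i ≤ k →
      wtB (w k - μ (Fin.castLE h i)) ≠ 0 ∧ wtB (v k - μ (Fin.castLE h i)) ≠ 0) :
    Rfac γ h μ w v i = Rnum γ h μ w v i /
      ∏ k ∈ Finset.Ici i, wtB (w k - μ (Fin.castLE h i)) * wtB (v k - μ (Fin.castLE h i)) := by
  rw [Rfac, Rnum, sub_div, ← Finset.prod_div_distrib, ← Finset.prod_div_distrib]
  congr 1 <;> refine Finset.prod_congr rfl fun k hk => ?_ <;>
    obtain ⟨h1, h2⟩ := hb k (Finset.mem_Ici.1 hk) <;> field_simp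

/-- Each of the two products has exactly one denominator with its arguments in the opposite order.
Turning it around produces the minus signs in `Lnum`. -/
lemma Lfac_eq_div (i : Fin n) :
    Lfac γ h μ w v i = Lnum γ h μ w v i /
      ∏ k ∈ Finset.Ioi i, wtB (w i - w k) * wtB (v i - v k) := by
  rw [Lfac, Lnum, sub_div, mul_div_assoc, mul_div_assoc, ← Finset.prod_div_distrib,
    ← Finset.prod_div_distrib]
  congr 2 <;> refine Finset.prod_congr rfl fun k hk => ?_
  · rw [← neg_sub (v i) (v k), wtB_neg, div_mul_div_comm, mul_neg, div_neg, neg_div]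
  · rw [← neg_sub (w i) (w k), wtB_neg, div_mul_div_comm, neg_mul, div_neg, neg_div]

/-- One factor of each square `b(w_i - w_j)² b(w̄_i - w̄_j)²` cancels the denominators of `Λ_i`. The
denominators of `R_i` move to the numerator: those with `k = i` cancel the prefactor of the kernel,
those with `k > i` are the `b`-factors at `μ_i` in `pairNum`. -/
lemma Hker_eq_div (hb : ∀ i k, i ≤ k →
      wtB (w k - μ (Fin.castLE h i)) ≠ 0 ∧ wtB (v k - μ (Fin.castLE h i)) ≠ 0)
    (hd : ∀ i k, i ≠ k → wtB (w i - w k) ≠ 0 ∧ wtB (v i - v k) ≠ 0) :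
    Hker γ h μ w v = Hnum γ h μ w v / ∏ i, Rnum γ h μ w v i := by
  rw [Hker, Hnum, ← Finset.prod_div_distrib, mul_assoc _ (∏ i, _), mul_div_assoc,
    ← Finset.prod_div_distrib, ← Finset.prod_mul_distrib]
  congr 1
  refine Finset.prod_congr rfl fun i _ => ?_
  rw [Rfac_eq_div i (hb i), Lfac_eq_div, ← Finset.mul_prod_Ioi_eq_prod_Ici]
  simp only [pairNum, Finset.prod_mul_distrib, Finset.prod_pow]
  have h1 := hb i i le_rfl
  have h2 : ∏ k ∈ Finset.Ioi i, wtB (w i - w k) ≠ 0 := Finset.prod_ne_zero_iff.2 fun k hk =>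
    (hd i k (Finset.mem_Ioi.1 hk).ne).1
  have h3 : ∏ k ∈ Finset.Ioi i, wtB (v i - v k) ≠ 0 := Finset.prod_ne_zero_iff.2 fun k hk =>
    (hd i k (Finset.mem_Ioi.1 hk).ne).2
  obtain ⟨h4, h5⟩ := h1
  generalize Rnum γ h μ w v i = R
  rw [inv_div]
  field_simp

/-- One factor `b(w_i - w_k) b(w̄_i - w̄_k)` per pair survives the cancellation. Hence only
injective choices of residues contribute. -/
lemma Hnum_eq_zero {i k : Fin n} (hik : i ≠ k)
    (h0 : wtB (w i - w k) = 0 ∨ wtB (v i - v k) = 0) : Hnum γ h μ w v = 0 := by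
  wlog hlt : i < k generalizing i k
  · refine this hik.symm ?_ (lt_of_le_of_ne (not_lt.1 hlt) hik.symm)
    rwa [← neg_sub, wtB_neg, neg_eq_zero, ← neg_sub (v i), wtB_neg, neg_eq_zero]
  rw [Hnum, Finset.prod_eq_zero (Finset.mem_univ i), mul_zero]
  rw [Finset.prod_eq_zero (Finset.mem_Ioi.2 hlt), zero_mul]
  rw [pairNum, mul_eq_zero.2 h0, zero_mul]

lemma Hker_eq_zero {i k : Fin n} (hik : i ≠ k)
    (h0 : wtB (w i - w k) = 0 ∨ wtB (v i - v k) = 0) : Hker γ h μ w v = 0 := by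
  wlog hlt : i < k generalizing i k
  · refine this hik.symm ?_ (lt_of_le_of_ne (not_lt.1 hlt) hik.symm)
    rwa [← neg_sub, wtB_neg, neg_eq_zero, ← neg_sub (v i), wtB_neg, neg_eq_zero]
  have : (∏ i, ∏ j ∈ Finset.Ioi i, wtB (w i - w j) ^ 2 * wtB (v i - v j) ^ 2
      * wtA γ (w j - μ (Fin.castLE h i)) * wtA γ (v j - μ (Fin.castLE h i))) = 0 :=
    Finset.prod_eq_zero (Finset.mem_univ i) <| Finset.prod_eq_zero (Finset.mem_Ioi.2 hlt) <| by
      rcases h0 with h0 | h0 <;> simp [h0]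
  rw [Hker, this, zero_div, mul_zero, zero_mul]

/-- On points with nonvanishing denominators, the kernel is the quotient of its numerator and
the product of the `R_i`. -/
lemma Hker_eq_div_of_denomsNonzero (hD : DenomsNonzero γ h μ w v) :
    Hker γ h μ w v = Hnum γ h μ w v / ∏ i, Rnum γ h μ w v i := by
  -- When two arguments coincide modulo `iπ`, division by zero in `Λ_i` has the value zero; the
  -- squares make `Hker` vanish there, in agreement with `Hnum`.
  by_cases hd : ∀ i k, i ≠ k → wtB (w i - w k) ≠ 0 ∧ wtB (v i - v k) ≠ 0
  · exact Hker_eq_div hD.1 hd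
  · push Not at hd
    obtain ⟨i, k, hik, h0⟩ := hd
    have h0 : wtB (w i - w k) = 0 ∨ wtB (v i - v k) = 0 := or_iff_not_imp_left.2 h0
    rw [Hker_eq_zero hik h0, Hnum_eq_zero hik h0, zero_div]

lemma Rnum_ne_zero_of_denomsNonzero (hD : DenomsNonzero γ h μ w v) (i : Fin n) :
    Rnum γ h μ w v i ≠ 0 := by
  intro h0
  apply hD.2 i
  rw [Rfac_eq_div i (hD.1 i), h0, zero_div]

lemma denomsNonzero_of_Rnum_ne_zero (hb : ∀ i k, i ≤ k →
      wtB (w k - μ (Fin.castLE h i)) ≠ 0 ∧ wtB (v k - μ (Fin.castLE h i)) ≠ 0)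
    (hR : ∀ i, Rnum γ h μ w v i ≠ 0) : DenomsNonzero γ h μ w v := by
  refine ⟨hb, fun i => ?_⟩
  rw [Rfac_eq_div i (hb i)]
  exact div_ne_zero (hR i) (Finset.prod_ne_zero_iff.2 fun k hk =>
    mul_ne_zero (hb i k (Finset.mem_Ici.1 hk)).1 (hb i k (Finset.mem_Ici.1 hk)).2)

end kernel

/-! ### Analyticity -/

section analytic
variable {E : Type*} [NormedAddCommGroup E] [NormedSpace ℂ E] {f g : E → ℂ} {x : E}

lemma analyticAt_wtA_sub (γ : ℂ) (hf : AnalyticAt ℂ f x) (hg : AnalyticAt ℂ g x) :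
    AnalyticAt ℂ (fun y => wtA γ (f y - g y)) x :=
  (analyticAt_sinh _).fun_comp (f := fun y => f y - g y + γ) ((hf.sub hg).add analyticAt_const)

lemma analyticAt_wtB_sub (hf : AnalyticAt ℂ f x) (hg : AnalyticAt ℂ g x) :
    AnalyticAt ℂ (fun y => wtB (f y - g y)) x :=
  (analyticAt_sinh _).fun_comp (f := fun y => f y - g y) (hf.sub hg)

variable {γ : ℂ} {L n : ℕ} {h : n ≤ L} {μ : Fin L → ℂ} {w v : E → Fin n → ℂ}

lemma analyticAt_Rnum (hw : ∀ k, AnalyticAt ℂ (fun y => w y k) x)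
    (hv : ∀ k, AnalyticAt ℂ (fun y => v y k) x) (i : Fin n) :
    AnalyticAt ℂ (fun y => Rnum γ h μ (w y) (v y) i) x := by
  refine .sub (Finset.analyticAt_fun_prod _ fun k _ => ?_)
    (Finset.analyticAt_fun_prod _ fun k _ => ?_)
  · exact (analyticAt_wtA_sub γ (hw k) analyticAt_const).mul
      (analyticAt_wtB_sub (hv k) analyticAt_const)
  · exact (analyticAt_wtA_sub γ (hv k) analyticAt_const).mul
      (analyticAt_wtB_sub (hw k) analyticAt_const)

lemma analyticAt_Hnum (hw : ∀ k, AnalyticAt ℂ (fun y => w y k) x)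
    (hv : ∀ k, AnalyticAt ℂ (fun y => v y k) x) :
    AnalyticAt ℂ (fun y => Hnum γ h μ (w y) (v y)) x := by
  have hc : ∀ z : ℂ, AnalyticAt ℂ (fun _ : E => z) x := fun z => analyticAt_const
  refine analyticAt_const.mul (Finset.analyticAt_fun_prod _ fun i _ => .mul
    (Finset.analyticAt_fun_prod _ fun k _ => ?_) (.sub (.mul (Finset.analyticAt_fun_prod _
      fun k _ => ?_) (Finset.analyticAt_fun_prod _ fun k _ => ?_)) (.mul
      (Finset.analyticAt_fun_prod _ fun k _ => ?_) (Finset.analyticAt_fun_prod _ fun k _ => ?_))))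
  · exact ((analyticAt_wtB_sub (hw _) (hw _)).mul (analyticAt_wtB_sub (hv _) (hv _))).mul
      (((analyticAt_wtA_sub _ (hw _) (hc _)).mul (analyticAt_wtA_sub _ (hv _) (hc _))).mul
      ((analyticAt_wtB_sub (hw _) (hc _)).mul (analyticAt_wtB_sub (hv _) (hc _))))
  · exact (analyticAt_wtA_sub _ (hv _) (hc _)).mul (analyticAt_wtB_sub (hc _) (hw _))
  · exact ((analyticAt_wtA_sub _ (hw _) (hw _)).mul (analyticAt_wtA_sub _ (hv _) (hv _))).neg
  · exact (analyticAt_wtA_sub _ (hw _) (hc _)).mul (analyticAt_wtB_sub (hc _) (hv _))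
  · exact ((analyticAt_wtA_sub _ (hw _) (hw _)).mul (analyticAt_wtA_sub _ (hv _) (hv _))).neg

end analytic

lemma analyticAt_fst_apply {n : ℕ} (k : Fin n) (x : (Fin n → ℂ) × (Fin n → ℂ)) :
    AnalyticAt ℂ (fun p : (Fin n → ℂ) × (Fin n → ℂ) => p.1 k) x :=
  ((ContinuousLinearMap.proj (R := ℂ) (φ := fun _ : Fin n => ℂ) k).comp
    (ContinuousLinearMap.fst ℂ (Fin n → ℂ) (Fin n → ℂ))).analyticAt x

lemma analyticAt_snd_apply {n : ℕ} (k : Fin n) (x : (Fin n → ℂ) × (Fin n → ℂ)) :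
    AnalyticAt ℂ (fun p : (Fin n → ℂ) × (Fin n → ℂ) => p.2 k) x :=
  ((ContinuousLinearMap.proj (R := ℂ) (φ := fun _ : Fin n => ℂ) k).comp
    (ContinuousLinearMap.snd ℂ (Fin n → ℂ) (Fin n → ℂ))).analyticAt x

/-! ### Recursions for the kernel -/

lemma Rnum_zero (γ : ℂ) {L n : ℕ} (h : n ≤ L) (μ : Fin (L + 1) → ℂ) (w v : Fin (n + 1) → ℂ) :
    Rnum γ (Nat.succ_le_succ h) μ w v 0 =
      (∏ k, wtA γ (w k - μ 0) * wtB (v k - μ 0)) - ∏ k, wtA γ (v k - μ 0) * wtB (w k - μ 0) := by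
  have : Finset.Ici (0 : Fin (n + 1)) = Finset.univ := Finset.Ici_bot
  rw [Rnum, this, Fin.castLE_zero]

lemma Rnum_succ (γ : ℂ) {L n : ℕ} (h : n ≤ L) (μ : Fin (L + 1) → ℂ) (w v : Fin (n + 1) → ℂ)
    (i : Fin n) : Rnum γ (Nat.succ_le_succ h) μ w v i.succ =
      Rnum γ h (fun k => μ k.succ) (fun k => w k.succ) (fun k => v k.succ) i := by
  simp only [Rnum, Fin.prod_Ici_succ, Fin.castLE_succ]

lemma Lnum_zero (γ : ℂ) {L n : ℕ} (h : n ≤ L) (μ : Fin (L + 1) → ℂ) (w v : Fin (n + 1) → ℂ) :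
    Lnum γ (Nat.succ_le_succ h) μ w v 0 =
      (∏ k, wtA γ (v 0 - μ k) * wtB (μ k - w 0))
        * (∏ k : Fin n, -(wtA γ (w 0 - w k.succ) * wtA γ (v k.succ - v 0)))
      - (∏ k, wtA γ (w 0 - μ k) * wtB (μ k - v 0))
        * (∏ k : Fin n, -(wtA γ (w k.succ - w 0) * wtA γ (v 0 - v k.succ))) := by
  have : Finset.Ici (0 : Fin (L + 1)) = Finset.univ := Finset.Ici_bot
  rw [Lnum, Fin.castLE_zero, this, Fin.prod_Ioi_zero, Fin.prod_Ioi_zero]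

lemma Lnum_succ (γ : ℂ) {L n : ℕ} (h : n ≤ L) (μ : Fin (L + 1) → ℂ) (w v : Fin (n + 1) → ℂ)
    (i : Fin n) : Lnum γ (Nat.succ_le_succ h) μ w v i.succ =
      Lnum γ h (fun k => μ k.succ) (fun k => w k.succ) (fun k => v k.succ) i := by
  simp only [Lnum, Fin.prod_Ici_succ, Fin.prod_Ioi_succ, Fin.castLE_succ]

/-- The triangular number grows by `n + 1`, and so the whole exponent grows by `L + 2(n + 1)`. -/
lemma sign_succ (L n : ℕ) :
    (-1 : ℂ) ^ ((L + 1) * (n + 1) + (n + 1) * (n + 1 + 1) / 2) =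
      (-1) ^ L * (-1) ^ (L * n + n * (n + 1) / 2) := by
  have h1 : (n + 1) * (n + 1 + 1) / 2 = n * (n + 1) / 2 + (n + 1) := by
    have : (n + 1) * (n + 1 + 1) = n * (n + 1) + (n + 1) * 2 := by ring
    rw [this, Nat.add_mul_div_right _ _ two_pos]
  rw [h1, show (L + 1) * (n + 1) + (n * (n + 1) / 2 + (n + 1)) =
    L + (L * n + n * (n + 1) / 2) + 2 * (n + 1) by ring, pow_add, pow_mul]
  simp [pow_add]

lemma Hnum_succ (γ : ℂ) {L n : ℕ} (h : n ≤ L) (μ : Fin (L + 1) → ℂ) (w v : Fin (n + 1) → ℂ) :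
    Hnum γ (Nat.succ_le_succ h) μ w v =
      (-1) ^ L * wtC γ ^ 2 * ((∏ k : Fin n, wtB (w 0 - w k.succ) * wtB (v 0 - v k.succ) *
        (wtA γ (w k.succ - μ 0) * wtA γ (v k.succ - μ 0) *
          (wtB (w k.succ - μ 0) * wtB (v k.succ - μ 0)))) *
        Lnum γ (Nat.succ_le_succ h) μ w v 0) *
      Hnum γ h (fun k => μ k.succ) (fun k => w k.succ) (fun k => v k.succ) := by
  rw [Hnum, Hnum, Fin.prod_univ_succ, Fin.prod_Ioi_zero, sign_succ]
  have hs : ∀ i : Fin n, (∏ j ∈ Finset.Ioi i.succ,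
      pairNum γ (Nat.succ_le_succ h) μ w v i.succ j) * Lnum γ (Nat.succ_le_succ h) μ w v i.succ =
      (∏ j ∈ Finset.Ioi i, pairNum γ h (fun k => μ k.succ) (fun k => w k.succ)
        (fun k => v k.succ) i j) *
        Lnum γ h (fun k => μ k.succ) (fun k => w k.succ) (fun k => v k.succ) i := fun i => by
    rw [Lnum_succ γ h, Fin.prod_Ioi_succ]
    simp only [pairNum, Fin.castLE_succ]
  rw [Finset.prod_congr rfl fun i _ => hs i]
  have h0 : ∀ k : Fin n, pairNum γ (Nat.succ_le_succ h) μ w v 0 k.succ =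
      wtB (w 0 - w k.succ) * wtB (v 0 - v k.succ) *
        (wtA γ (w k.succ - μ 0) * wtA γ (v k.succ - μ 0) *
          (wtB (w k.succ - μ 0) * wtB (v k.succ - μ 0))) := fun k => rfl
  have hp : wtC γ ^ (2 * n.succ) = wtC γ ^ (2 * n) * wtC γ ^ 2 := by
    rw [Nat.succ_eq_add_one, mul_add, pow_add]
  rw [Finset.prod_congr rfl fun k _ => h0 k, hp]
  generalize (∏ k : Fin n, wtB (w 0 - w k.succ) * _ * _) = P
  ring

lemma Hker_one (γ : ℂ) (L : ℕ) (h : 1 ≤ L + 1) (μ : Fin (L + 1) → ℂ) (w v : ℂ) :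
    Hker γ h μ ![w] ![v] =
      wtC γ ^ 2 * ((∏ k, wtA γ (w - μ k) * wtB (v - μ k)) - ∏ k, wtA γ (v - μ k) * wtB (w - μ k))
        / (wtB (w - μ 0) * wtB (v - μ 0)
          * (wtA γ (w - μ 0) / wtB (w - μ 0) - wtA γ (v - μ 0) / wtB (v - μ 0))) := by
  have h0 : Finset.Ici (0 : Fin (L + 1)) = Finset.univ := Finset.Ici_bot
  have h1 : Finset.Ici (0 : Fin 1) = Finset.univ := Finset.Ici_bot
  have h2 : Finset.Ioi (0 : Fin 1) = ∅ := rfl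
  have h3 : (Fin.castLE h 0 : Fin (L + 1)) = 0 := rfl
  have h5 : (-1 : ℂ) ^ L * (-1) ^ L = 1 := by rw [← mul_pow]; simp
  simp only [Hker, Lfac, Rfac, Finset.univ_unique, Fin.default_eq_zero, Finset.prod_singleton, h0,
    h1, h2, h3, Finset.prod_empty, Matrix.cons_val_fin_one, Finset.prod_mul_distrib,
    prod_wtB_sub_comm, mul_one, pow_succ (-1 : ℂ)]
  rw [div_eq_mul_inv, div_eq_mul_inv, mul_inv, ← div_eq_mul_inv, ← div_eq_mul_inv]
  generalize (wtA γ (w - μ 0) / wtB (w - μ 0) - wtA γ (v - μ 0) / wtB (v - μ 0)) = R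
  rw [div_eq_mul_inv _ (_ * R), mul_inv _ R, mul_inv, div_eq_mul_inv]
  linear_combination (wtC γ ^ 2 * ((wtB (w - μ 0))⁻¹ * (wtB (v - μ 0))⁻¹) * R⁻¹ *
    ((∏ k, wtA γ (w - μ k)) * (∏ k, wtB (v - μ k)) -
      (∏ k, wtA γ (v - μ k)) * ∏ k, wtB (w - μ k))) * h5

lemma Hker_succ (γ : ℂ) {L n : ℕ} (h : n ≤ L) (μ : Fin (L + 1) → ℂ)
    (hμ : ∀ k : Fin L, wtA γ (μ 0 - μ k.succ) ≠ 0 ∧ wtA γ (μ k.succ - μ 0) ≠ 0)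
    (w v : Fin (n + 1) → ℂ) :
    Hker γ (Nat.succ_le_succ h) μ w v =
      Hbar γ h μ (fun k => w k.succ) (fun k => v k.succ) / (wtB (w 0 - μ 0) * wtB (v 0 - μ 0))
      * (∏ k : Fin n, wtB (w 0 - w k.succ) ^ 2 * wtB (v 0 - v k.succ) ^ 2)
      * ((∏ k : Fin n, wtA γ (w k.succ - μ 0) * wtA γ (v k.succ - μ 0))
          / ∏ k : Fin L, wtA γ (μ 0 - μ k.succ) * wtA γ (μ k.succ - μ 0))
      * (Ffac γ μ w v)⁻¹
      * ((∏ k, wtA γ (v 0 - μ k) * wtB (μ k - w 0))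
            * (∏ k : Fin n, wtA γ (w 0 - w k.succ) / wtB (w 0 - w k.succ))
            * (∏ k : Fin n, wtA γ (v k.succ - v 0) / wtB (v k.succ - v 0))
          - (∏ k, wtA γ (w 0 - μ k) * wtB (μ k - v 0))
            * (∏ k : Fin n, wtA γ (w k.succ - w 0) / wtB (w k.succ - w 0))
            * (∏ k : Fin n, wtA γ (v 0 - v k.succ) / wtB (v 0 - v k.succ))) := by
  have hP : (∏ k : Fin L, wtA γ (μ 0 - μ k.succ) * wtA γ (μ k.succ - μ 0)) ≠ 0 :=
    Finset.prod_ne_zero_iff.2 fun k _ => mul_ne_zero (hμ k).1 (hμ k).2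
  have hL0 : Lfac γ (Nat.succ_le_succ h) μ w v 0 =
      (∏ k, wtA γ (v 0 - μ k) * wtB (μ k - w 0))
            * (∏ k : Fin n, wtA γ (w 0 - w k.succ) / wtB (w 0 - w k.succ))
            * (∏ k : Fin n, wtA γ (v k.succ - v 0) / wtB (v k.succ - v 0))
          - (∏ k, wtA γ (w 0 - μ k) * wtB (μ k - v 0))
            * (∏ k : Fin n, wtA γ (w k.succ - w 0) / wtB (w k.succ - w 0))
            * (∏ k : Fin n, wtA γ (v 0 - v k.succ) / wtB (v 0 - v k.succ)) := by
    have : Finset.Ici (0 : Fin (L + 1)) = Finset.univ := Finset.Ici_bot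
    rw [Lfac, Fin.castLE_zero, this, Fin.prod_Ioi_zero, Fin.prod_Ioi_zero,
      Finset.prod_mul_distrib (f := fun k : Fin n => wtA γ (w 0 - w k.succ) / _),
      Finset.prod_mul_distrib (f := fun k : Fin n => wtA γ (w k.succ - w 0) / _), mul_assoc,
      mul_assoc]
  have hR0 : Rfac γ (Nat.succ_le_succ h) μ w v 0 = Ffac γ μ w v := by
    have : Finset.Ici (0 : Fin (n + 1)) = Finset.univ := Finset.Ici_bot
    rw [Rfac, Fin.castLE_zero, this, Ffac]
  rw [← hL0, Hbar, recConst, Hker, Hker, sign_succ, Fin.prod_univ_succ, Fin.prod_univ_succ,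
    Fin.prod_univ_succ, Fin.prod_Ioi_zero, hR0]
  have hLs : ∀ i : Fin n, Lfac γ (Nat.succ_le_succ h) μ w v i.succ =
      Lfac γ h (fun k => μ k.succ) (fun k => w k.succ) (fun k => v k.succ) i := fun i => by
    simp only [Lfac, Fin.prod_Ici_succ, Fin.prod_Ioi_succ, Fin.castLE_succ]
  have hRs : ∀ i : Fin n, Rfac γ (Nat.succ_le_succ h) μ w v i.succ =
      Rfac γ h (fun k => μ k.succ) (fun k => w k.succ) (fun k => v k.succ) i := fun i => by
    simp only [Rfac, Fin.prod_Ici_succ, Fin.castLE_succ]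
  have hsplit : (∏ k : Fin n, wtB (w 0 - w k.succ) ^ 2 * wtB (v 0 - v k.succ) ^ 2
      * wtA γ (w k.succ - μ 0) * wtA γ (v k.succ - μ 0)) =
      (∏ k : Fin n, wtB (w 0 - w k.succ) ^ 2 * wtB (v 0 - v k.succ) ^ 2) *
      ∏ k : Fin n, wtA γ (w k.succ - μ 0) * wtA γ (v k.succ - μ 0) := by
    rw [← Finset.prod_mul_distrib]
    exact Finset.prod_congr rfl fun k _ => by ring
  simp only [Fin.castLE_zero, Fin.castLE_succ, hsplit, hLs, hRs, Fin.prod_Ioi_succ]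
  generalize (∏ k : Fin L, wtA γ (μ 0 - μ k.succ) * wtA γ (μ k.succ - μ 0)) = P at *
  rw [div_eq_mul_inv, div_eq_mul_inv, div_eq_mul_inv, div_eq_mul_inv, mul_inv, mul_inv]
  -- The product inside `recConst` cancels against the explicit denominator. All other inverses are
  -- the same on both sides.
  have : P * P⁻¹ = 1 := mul_inv_cancel₀ hP
  have hp : wtC γ ^ (2 * n.succ) = wtC γ ^ (2 * n) * wtC γ ^ 2 := by
    rw [Nat.succ_eq_add_one, mul_add, pow_add]
  rw [hp]
  generalize Lfac γ (Nat.succ_le_succ h) μ w v 0 = A1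
  generalize (∏ k : Fin n, wtA γ (w k.succ - μ 0) * wtA γ (v k.succ - μ 0)) = A2
  generalize (∏ k : Fin n, wtB (w 0 - w k.succ) ^ 2 * wtB (v 0 - v k.succ) ^ 2) = A3
  generalize (∏ i : Fin n, (_ : ℂ)⁻¹ * _) = A4
  generalize (∏ i : Fin n, ∏ j ∈ Finset.Ioi i, (_ : ℂ)) = A5
  generalize (∏ i : Fin n, wtB _ * wtB _)⁻¹ = A6
  generalize (wtB (w 0 - μ 0))⁻¹ = A7
  generalize (wtB (v 0 - μ 0))⁻¹ = A8
  generalize (Ffac γ μ w v)⁻¹ = A9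
  linear_combination (-((-1) ^ L * (-1) ^ (L * n + n * (n + 1) / 2) * wtC γ ^ (2 * n) *
    wtC γ ^ 2 * A1 * A2 * A3 * A4 * A5 * A6 * A7 * A8 * A9)) * this

open Filter Topology

/-! ### Generic position -/

section density
variable {E : Type*} [NormedAddCommGroup E] [NormedSpace ℂ E]

/-- The residual filter allows finitely many generic conditions to be intersected; by Baire's
theorem a residual set in a finite-dimensional space is dense. -/
lemma eventually_residual_ne_zero {f : E → ℂ} (hf : AnalyticOnNhd ℂ f univ) (h : ∃ x, f x ≠ 0) :
    ∀ᶠ x in residual E, f x ≠ 0 := by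
  obtain ⟨x, hx⟩ := h
  refine residual_of_dense_open (isOpen_ne_fun ?_ continuous_const) (dense_ne_zero hf hx)
  exact continuousOn_univ.1 hf.continuousOn

end density

lemma wtB_one_ne_zero : wtB 1 ≠ 0 := by
  rw [wtB, ← Complex.ofReal_one, ← Complex.ofReal_sinh, Complex.ofReal_ne_zero]
  exact (Real.sinh_pos_iff.2 one_pos).ne'

section good
variable {γ : ℂ} {L n : ℕ} (h : n ≤ L) (μ : Fin L → ℂ)

lemma eventually_residual_wtB_fst :
    ∀ᶠ p : (Fin n → ℂ) × (Fin n → ℂ) in residual _, ∀ j k, j ≠ k → wtB (p.1 j - p.1 k) ≠ 0 := by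
  refine eventually_all.2 fun j => eventually_all.2 fun k => eventually_imp_distrib_left.2 fun hjk =>
    eventually_residual_ne_zero (fun x _ => analyticAt_wtB_sub (analyticAt_fst_apply j x)
      (analyticAt_fst_apply k x)) ⟨(Pi.single j 1, 0), ?_⟩
  simpa [Pi.single_apply, hjk.symm] using wtB_one_ne_zero

lemma eventually_residual_wtB_snd :
    ∀ᶠ p : (Fin n → ℂ) × (Fin n → ℂ) in residual _, ∀ j k, j ≠ k → wtB (p.2 j - p.2 k) ≠ 0 := by
  refine eventually_all.2 fun j => eventually_all.2 fun k => eventually_imp_distrib_left.2 fun hjk =>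
    eventually_residual_ne_zero (fun x _ => analyticAt_wtB_sub (analyticAt_snd_apply j x)
      (analyticAt_snd_apply k x)) ⟨(0, Pi.single j 1), ?_⟩
  simpa [Pi.single_apply, hjk.symm] using wtB_one_ne_zero

lemma eventually_residual_Rnum (hc : wtC γ ≠ 0) :
    ∀ᶠ p : (Fin n → ℂ) × (Fin n → ℂ) in residual _, ∀ (f g : Fin n → Fin n) (i : Fin n),
      Rnum γ h μ (p.1 ∘ f) (p.2 ∘ g) i ≠ 0 := by
  refine eventually_all.2 fun f => eventually_all.2 fun g => eventually_all.2 fun i =>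
    eventually_residual_ne_zero (fun x _ => analyticAt_Rnum (fun k => analyticAt_fst_apply (f k) x)
      (fun k => analyticAt_snd_apply (g k) x) i)
      -- With `w̄_k = μ_i` the first product contains `b(0) = 0`, while the second is a power of `c
      -- · sinh 1`.
      ⟨(fun _ => 1 + μ (Fin.castLE h i), fun _ => μ (Fin.castLE h i)), ?_⟩
  have hcard : (Finset.Ici i).card ≠ 0 := Finset.card_ne_zero.2 ⟨i, Finset.mem_Ici.2 le_rfl⟩
  simp only [Rnum, Function.comp_apply, sub_self, add_sub_cancel_right, wtB_zero, wtA_zero,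
    mul_zero, Finset.prod_const, zero_pow hcard, zero_sub]
  exact neg_ne_zero.2 (pow_ne_zero _ (mul_ne_zero hc wtB_one_ne_zero))

lemma dense_generic (hc : wtC γ ≠ 0) :
    Dense {p : (Fin n → ℂ) × (Fin n → ℂ) | Generic γ h μ p.1 p.2} := by
  refine dense_of_mem_residual ?_
  filter_upwards [eventually_residual_wtB_fst (n := n), eventually_residual_wtB_snd (n := n),
    eventually_residual_Rnum h μ hc] with p h1 h2 h3
  exact ⟨fun j k hjk => by_contra fun hne => h1 j k (fun e => hne (by rw [e])) hjk,
    fun j k hjk => by_contra fun hne => h2 j k (fun e => hne (by rw [e])) hjk, h3⟩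

end good

/-! ### Existence of contours -/

/-- Circles of radius `r` around the points `c j`. -/
noncomputable def Contour.circles {n : ℕ} (c : Fin n → ℂ) (r : ℝ) (hr : 0 < r)
    (hd : ∀ j k, c j ≠ c k → 2 * r < dist (c j) (c k)) : Contour where
  -- Coinciding points share one circle, since the closed discs have to be disjoint.
  m := (Finset.univ.image c).card
  center j := ((Finset.univ.image c).equivFin.symm j : ℂ)
  radius _ := r
  radius_pos _ := hr
  disjoint j k hjk := by
    obtain ⟨a, -, ha⟩ := Finset.mem_image.1 ((Finset.univ.image c).equivFin.symm j).2
    obtain ⟨b, -, hb⟩ := Finset.mem_image.1 ((Finset.univ.image c).equivFin.symm k).2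
    refine Metric.closedBall_disjoint_closedBall ?_
    have hne : c a ≠ c b := by
      rw [ha, hb]
      exact fun e => hjk ((Finset.univ.image c).equivFin.symm.injective (Subtype.ext e))
    rw [← ha, ← hb, ← two_mul]
    exact hd a b hne

section circles
variable {n : ℕ} {c : Fin n → ℂ} {r : ℝ} {hr : 0 < r}
  {hd : ∀ j k, c j ≠ c k → 2 * r < dist (c j) (c k)}

lemma iUnion_equivFin_image (S : ℂ → Set ℂ) :
    ⋃ j, S ((Finset.univ.image c).equivFin.symm j : ℂ) = ⋃ j, S (c j) := by
  ext z
  simp only [mem_iUnion]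
  constructor
  · rintro ⟨j, hj⟩
    obtain ⟨a, -, ha⟩ := Finset.mem_image.1 ((Finset.univ.image c).equivFin.symm j).2
    exact ⟨a, ha ▸ hj⟩
  · rintro ⟨a, ha⟩
    refine ⟨(Finset.univ.image c).equivFin ⟨c a, Finset.mem_image_of_mem c (Finset.mem_univ a)⟩, ?_⟩
    rwa [Equiv.symm_apply_apply]

lemma trace_circles : (Contour.circles c r hr hd).trace = ⋃ j, Metric.sphere (c j) r :=
  iUnion_equivFin_image fun z => Metric.sphere z r

lemma inside_circles : (Contour.circles c r hr hd).inside = ⋃ j, Metric.ball (c j) r :=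
  iUnion_equivFin_image fun z => Metric.ball z r

lemma filled_circles : (Contour.circles c r hr hd).filled = ⋃ j, Metric.closedBall (c j) r :=
  iUnion_equivFin_image fun z => Metric.closedBall z r

end circles

lemma eventually_forall_closedBall {X : Type*} [PseudoMetricSpace X] {x : X} {P : X → Prop}
    (hP : ∀ᶠ y in 𝓝 x, P y) : ∀ᶠ r in 𝓝[>] (0 : ℝ), ∀ y ∈ Metric.closedBall x r, P y := by
  obtain ⟨ε, hε, hb⟩ := Metric.nhds_basis_closedBall.eventually_iff.1 hP
  filter_upwards [Ioo_mem_nhdsGT hε] with r hr y hy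
  exact hb (Metric.closedBall_subset_closedBall hr.2.le hy)

/-- The zeros of `sinh` are simple, because `cosh² - sinh² = 1`, and hence isolated. -/
lemma eventually_wtB_sub_ne_zero (z y : ℂ) : ∀ᶠ x in 𝓝 z, x ≠ z → wtB (x - y) ≠ 0 := by
  have hd : HasDerivAt (fun x => wtB (x - y)) (Complex.cosh (z - y)) z := by
    simpa [wtB] using ((hasDerivAt_id z).sub_const y).csinh
  by_cases h0 : wtB (z - y) = 0
  · have hcosh : Complex.cosh (z - y) ≠ 0 := fun h1 => by
      have := Complex.cosh_sq_sub_sinh_sq (z - y)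
      rw [wtB] at h0
      simp [h0, h1] at this
    exact eventually_nhdsWithin_iff.1 (hd.eventually_ne hcosh)
  · exact (hd.continuousAt.eventually_ne h0).mono fun x hx _ => hx

lemma eventually_radius {n : ℕ} {c : Fin n → ℂ}
    (hc : ∀ j k, wtB (c j - c k) = 0 → c j = c k) {L : ℕ} (μ : Fin L → ℂ) :
    ∀ᶠ r in 𝓝[>] (0 : ℝ), (∀ j k, c j ≠ c k → 2 * r < dist (c j) (c k)) ∧
      (∀ j k, ∀ z ∈ Metric.closedBall (c j) r, wtB (z - c k) = 0 → z = c k) ∧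
      ∀ j i, ∀ z ∈ Metric.closedBall (c j) r, z ≠ c j → wtB (z - μ i) ≠ 0 := by
  refine .and (eventually_all.2 fun j => eventually_all.2 fun k => ?_) (.and
    (eventually_all.2 fun j => eventually_all.2 fun k => ?_)
    (eventually_all.2 fun j => eventually_all.2 fun i => ?_))
  · refine eventually_imp_distrib_left.2 fun hjk => ?_
    filter_upwards [Ioo_mem_nhdsGT (half_pos (dist_pos.2 hjk))] with r hr
    linarith [hr.2]
  · refine eventually_forall_closedBall ?_
    have h0 : sinhDiv (c j - c k) ≠ 0 := sinhDiv_ne_zero_iff.2 fun h => sub_eq_zero.2 (hc j k h)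
    have hcont : ContinuousAt (fun z => sinhDiv (z - c k)) (c j) :=
      (differentiable_sinhDiv.continuous.comp (continuous_id.sub continuous_const)).continuousAt
    filter_upwards [hcont.eventually_ne h0] with z hz hz0
    exact sub_eq_zero.1 (sinhDiv_ne_zero_iff.1 hz hz0)
  · exact eventually_forall_closedBall (eventually_wtB_sub_ne_zero _ _)

/-- The `Rnum` are nonzero at each of the finitely many choices of centres, hence on closed
polydiscs of a common small radius. There `Hnum / ∏ Rnum` is the holomorphic extension of the
kernel. The factors `b(w_k - μ_i)` may vanish at a centre; they must be nonzero only on the circles.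
-/
lemma Generic.exists_admissible {γ : ℂ} {L n : ℕ} {h : n ≤ L} {μ : Fin L → ℂ}
    {lamC lamB : Fin n → ℂ} (hG : Generic γ h μ lamC lamB) :
    ∃ Γ Δ : Fin n → Contour, Admissible γ h μ lamC lamB Γ Δ := by
  obtain ⟨hC, hB, hR⟩ := hG
  have hR' : ∀ᶠ r in 𝓝[>] (0 : ℝ), ∀ (f g : Fin n → Fin n) (i : Fin n),
      ∀ p ∈ Metric.closedBall (lamC ∘ f, lamB ∘ g) r, Rnum γ h μ p.1 p.2 i ≠ 0 := by
    refine eventually_all.2 fun f => eventually_all.2 fun g => eventually_all.2 fun i =>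
      eventually_forall_closedBall ?_
    exact ((analyticAt_Rnum (fun k => analyticAt_fst_apply k _)
      (fun k => analyticAt_snd_apply k _) i).continuousAt).eventually_ne (hR f g i)
  obtain ⟨r, ⟨⟨⟨hdC, hoC, hμC⟩, hdB, hoB, hμB⟩, hRr⟩, hr⟩ := (((eventually_radius hC μ).and
    (eventually_radius hB μ)).and hR').and self_mem_nhdsWithin |>.exists
  have hr : 0 < r := hr
  have hRfilled : ∀ w v : Fin n → ℂ, (∀ i, w i ∈ ⋃ j, Metric.closedBall (lamC j) r) →
      (∀ i, v i ∈ ⋃ j, Metric.closedBall (lamB j) r) → ∀ i, Rnum γ h μ w v i ≠ 0 := by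
    intro w v hw hv i
    simp only [mem_iUnion] at hw hv
    choose f hf using hw
    choose g hg using hv
    refine hRr f g i (w, v) ?_
    rw [Metric.mem_closedBall, Prod.dist_eq, max_le_iff]
    exact ⟨(dist_pi_le_iff hr.le).2 hf, (dist_pi_le_iff hr.le).2 hg⟩
  have hsph : ∀ {c z : ℂ}, z ∈ Metric.sphere c r → z ≠ c := fun hz =>
    Metric.ne_of_mem_sphere hz hr.ne'
  refine ⟨fun _ => .circles lamC r hr hdC, fun _ => .circles lamB r hr hdB, ?_⟩
  constructor
  · exact fun _ j => inside_circles ▸ mem_iUnion.2 ⟨j, Metric.mem_ball_self hr⟩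
  · exact fun _ j => inside_circles ▸ mem_iUnion.2 ⟨j, Metric.mem_ball_self hr⟩
  · intro _ z hz k
    rw [filled_circles, mem_iUnion] at hz
    obtain ⟨j, hj⟩ := hz
    exact hoC j k z hj
  · intro _ z hz k
    rw [filled_circles, mem_iUnion] at hz
    obtain ⟨j, hj⟩ := hz
    exact hoB j k z hj
  · intro w v hw hv
    simp only [trace_circles] at hw hv
    refine denomsNonzero_of_Rnum_ne_zero (fun i k _ => ⟨?_, ?_⟩) (hRfilled w v
      (fun i => iUnion_mono (fun j => Metric.sphere_subset_closedBall) (hw i))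
      (fun i => iUnion_mono (fun j => Metric.sphere_subset_closedBall) (hv i)))
    · obtain ⟨j, hj⟩ := mem_iUnion.1 (hw k)
      exact hμC j _ _ (Metric.sphere_subset_closedBall hj) (hsph hj)
    · obtain ⟨j, hj⟩ := mem_iUnion.1 (hv k)
      exact hμB j _ _ (Metric.sphere_subset_closedBall hj) (hsph hj)
  · simp only [filled_circles]
    refine ⟨fun p => Hnum γ h μ p.1 p.2 / ∏ i, Rnum γ h μ p.1 p.2 i, fun p hp => ?_,
      fun w v _ _ hD _ => (Hker_eq_div_of_denomsNonzero hD).symm⟩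
    exact (analyticAt_Hnum (fun k => analyticAt_fst_apply k _)
      (fun k => analyticAt_snd_apply k _)).fun_div
      (Finset.analyticAt_fun_prod _ fun i _ => analyticAt_Rnum
        (fun k => analyticAt_fst_apply k _) (fun k => analyticAt_snd_apply k _) i)
      (Finset.prod_ne_zero_iff.2 fun i _ => hRfilled p.1 p.2 hp.1 hp.2 i)

/-! ### Continuity of the scalar product -/

lemma continuous_prodBlock (γ : ℂ) {L n : ℕ} (a b : Fin 2) :
    Continuous fun p : (Fin L → ℂ) × (Fin n → ℂ) => prodBlock γ p.1 a b p.2 := by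
  induction n with
  | zero => simpa [prodBlock] using continuous_const
  | succ n ih =>
    simp only [prodBlock_succ]
    exact ((continuous_block γ a b).comp (g := fun p : (Fin L → ℂ) × ℂ => block γ p.1 p.2 a b)
      (f := fun p : (Fin L → ℂ) × (Fin (n + 1) → ℂ) => (p.1, p.2 0)) (by fun_prop)).mul
      (ih.comp (f := fun p : (Fin L → ℂ) × (Fin (n + 1) → ℂ) => (p.1, fun k => p.2 (Fin.succ k)))
        (by fun_prop))

lemma continuous_scalarProduct (γ : ℂ) {L n : ℕ} :
    Continuous fun p : (Fin L → ℂ) × (Fin n → ℂ) × (Fin n → ℂ) =>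
      scalarProduct γ p.1 p.2.1 p.2.2 := by
  simp only [scalarProduct_eq]
  exact (((continuous_prodBlock γ 1 0).comp
    (f := fun p : (Fin L → ℂ) × (Fin n → ℂ) × (Fin n → ℂ) => (p.1, p.2.1)) (by fun_prop)).mul
    ((continuous_prodBlock γ 0 1).comp
    (f := fun p : (Fin L → ℂ) × (Fin n → ℂ) × (Fin n → ℂ) => (p.1, p.2.2))
      (by fun_prop))).matrix_elem _ _

/-! ### The recursion with cancelled denominators -/

lemma dense_inhomogeneities (γ : ℂ) (m₀ : ℂ) (L : ℕ) :
    Dense {μ : Fin L → ℂ | ∀ k, wtA γ (m₀ - μ k) ≠ 0 ∧ wtA γ (μ k - m₀) ≠ 0} := by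
  obtain ⟨x, hx⟩ := (dense_wtA_sub_ne_zero γ 0).nonempty
  have hp : ∀ (k : Fin L) (μ : Fin L → ℂ), AnalyticAt ℂ (fun μ : Fin L → ℂ => μ k) μ :=
    fun k μ => (ContinuousLinearMap.proj (R := ℂ) (φ := fun _ : Fin L => ℂ) k).analyticAt μ
  have hx : wtA γ x ≠ 0 := by simpa using hx
  refine dense_of_mem_residual (eventually_all.2 fun k => .and ?_ ?_)
  · exact eventually_residual_ne_zero (fun μ _ => analyticAt_wtA_sub γ analyticAt_const (hp k μ))
      ⟨fun _ => m₀ - x, by simpa using hx⟩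
  · exact eventually_residual_ne_zero (fun μ _ => analyticAt_wtA_sub γ (hp k μ) analyticAt_const)
      ⟨fun _ => x + m₀, by simpa using hx⟩

lemma continuous_Omega_inhomogeneities (γ : ℂ) {L n : ℕ} (m₀ : ℂ) (X Y : Fin n → ℂ) (i j : Fin n) :
    Continuous fun μ : Fin L → ℂ => Omega γ (Fin.cons m₀ μ : Fin (L + 1) → ℂ) X Y i j := by
  have hA : ∀ x : ℂ, Continuous fun μ : Fin L → ℂ => ∏ k, wtA γ (x - μ k) := fun x =>
    continuous_finsetProd _ fun k _ =>
      (continuous_wtA γ).comp (continuous_const.sub (continuous_apply k))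
  have hB : ∀ x : ℂ, Continuous fun μ : Fin L → ℂ => ∏ k, wtB (μ k - x) := fun x =>
    continuous_finsetProd _ fun k _ => continuous_wtB.comp ((continuous_apply k).sub continuous_const)
  unfold Omega
  simp only [Fin.cons_zero, Fin.cons_succ, Finset.prod_mul_distrib, Fin.prod_univ_succ]
  refine continuous_const.mul (.sub ?_ ?_) <;>
  exact (((continuous_const.mul (hA _)).mul (continuous_const.mul (hB _))).mul
    continuous_const).mul continuous_const

/-- The products `a(μ₁ - μ_k) a(μ_k - μ₁)` in `Kfac` and in `recConst` cancel. What is left is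
continuous in the inhomogeneities other than `μ 0`, so the condition on them can be dropped by
density. -/
lemma scalarProduct_recursion_cancelled (γ : ℂ) {L n : ℕ} (μ : Fin (L + 1) → ℂ)
    (X Y : Fin (n + 1) → ℂ)
    (hX0 : ∀ i, wtA γ (X i - μ 0) ≠ 0 ∧ wtB (X i - μ 0) ≠ 0)
    (hY0 : ∀ i, wtA γ (Y i - μ 0) ≠ 0 ∧ wtB (Y i - μ 0) ≠ 0)
    (hX : ∀ i k, i ≠ k → wtB (X i - X k) ≠ 0) (hY : ∀ i k, i ≠ k → wtB (Y i - Y k) ≠ 0)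
    (hF : Ffac γ μ X Y ≠ 0) :
    scalarProduct γ μ X Y = (∏ k, wtA γ (X k - μ 0) * wtA γ (Y k - μ 0)) * (Ffac γ μ X Y)⁻¹ *
      ((-1) ^ L * wtC γ ^ 2) * ∑ i, ∑ j, Omega γ μ X Y i j *
        scalarProduct γ (fun k => μ k.succ) (fun k => X (i.succAbove k))
          (fun k => Y (j.succAbove k)) := by
  have hcons : Continuous fun ν : Fin L → ℂ => (Fin.cons (μ 0) ν : Fin (L + 1) → ℂ) := by
    refine continuous_pi fun k => ?_
    refine Fin.cases ?_ (fun k => ?_) k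
    · simpa using continuous_const
    · simpa using continuous_apply k
  have hS : ∀ {N m : ℕ} (f : (Fin L → ℂ) → Fin N → ℂ) (Z W : Fin m → ℂ), Continuous f →
      Continuous fun ν => scalarProduct γ (f ν) Z W := fun f Z W hf =>
    (continuous_scalarProduct γ).comp (f := fun ν => (f ν, Z, W)) (hf.prodMk continuous_const)
  have key : (fun ν : Fin L → ℂ => scalarProduct γ (Fin.cons (μ 0) ν : Fin (L + 1) → ℂ) X Y) =
      fun ν => (∏ k, wtA γ (X k - μ 0) * wtA γ (Y k - μ 0)) * (Ffac γ μ X Y)⁻¹ *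
      ((-1) ^ L * wtC γ ^ 2) * ∑ i, ∑ j, Omega γ (Fin.cons (μ 0) ν : Fin (L + 1) → ℂ) X Y i j *
        scalarProduct γ ν (fun k => X (i.succAbove k)) (fun k => Y (j.succAbove k)) := by
    refine Continuous.ext_on (dense_inhomogeneities γ (μ 0) L) (hS _ X Y hcons) ?_ fun ν hν => ?_
    · exact continuous_const.mul (continuous_finsetSum _ fun i _ => continuous_finsetSum _
        fun j _ => (continuous_Omega_inhomogeneities γ _ _ _ _ _).mul (hS _ _ _ continuous_id))
    · have hP : (∏ k, wtA γ (μ 0 - ν k) * wtA γ (ν k - μ 0)) ≠ 0 :=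
        Finset.prod_ne_zero_iff.2 fun k _ => mul_ne_zero (hν k).1 (hν k).2
      have := scalarProduct_recursion (γ := γ) (μ := (Fin.cons (μ 0) ν : Fin (L + 1) → ℂ)) X Y
        (by simpa using hν) (by simpa using hX0) (by simpa using hY0) hX hY
        (by simpa [Ffac] using hF)
      simp only [this, Vfun, Kfac, recConst, Ffac, Fin.cons_zero, Fin.cons_succ]
      simp only [Finset.mul_sum]
      refine Finset.sum_congr rfl fun i _ => Finset.sum_congr rfl fun j _ => ?_
      generalize (_ - _ : ℂ)⁻¹ = F
      field_simp
  have := congrFun key (Fin.tail μ)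
  simp only [Fin.cons_self_tail] at this
  exact this

/-! ### The scalar product as a sum -/

/-- The denominators which arise from the residues at `w_i = x_{f(i)}` of the integrand. -/
noncomputable def residueDenom {m n : ℕ} (X : Fin n → ℂ) (f : Fin m → Fin n) : ℂ :=
  ∏ i, ∏ k ∈ Finset.univ.erase (f i), wtB (X (f i) - X k)

/-- No denominator of the recursion vanishes, at any of its steps. -/
def Regular (γ : ℂ) {L n : ℕ} (h : n ≤ L) (μ : Fin L → ℂ) (X Y : Fin n → ℂ) : Prop :=
  (∀ j k, j ≠ k → wtB (X j - X k) ≠ 0) ∧ (∀ j k, j ≠ k → wtB (Y j - Y k) ≠ 0) ∧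
  (∀ i k, wtA γ (X k - μ (Fin.castLE h i)) ≠ 0 ∧ wtB (X k - μ (Fin.castLE h i)) ≠ 0) ∧
  (∀ i k, wtA γ (Y k - μ (Fin.castLE h i)) ≠ 0 ∧ wtB (Y k - μ (Fin.castLE h i)) ≠ 0) ∧
  ∀ (f g : Fin n → Fin n) (i : Fin n), Rnum γ h μ (X ∘ f) (Y ∘ g) i ≠ 0

lemma prod_erase_succAbove {n : ℕ} (i : Fin (n + 1)) (m : Fin n) (F : Fin (n + 1) → ℂ) :
    ∏ k ∈ Finset.univ.erase (i.succAbove m), F k =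
      F i * ∏ k ∈ Finset.univ.erase m, F (i.succAbove k) := by
  have : Finset.univ.erase (i.succAbove m) =
      insert i ((Finset.univ.erase m).map (Fin.succAboveEmb i)) := by
    ext k
    simp only [Finset.mem_erase, Finset.mem_univ, and_true, Finset.mem_insert, Finset.mem_map,
      Fin.coe_succAboveEmb]
    rcases eq_or_ne k i with rfl | hk
    · simp [(Fin.succAbove_ne k m).symm]
    · obtain ⟨l, rfl⟩ := Fin.exists_succAbove_eq hk
      simp [Fin.succAbove_ne]
  rw [this, Finset.prod_insert (by simp [Fin.succAbove_ne]), Finset.prod_map]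
  rfl

lemma Regular.succAbove {γ : ℂ} {L n : ℕ} {h : n ≤ L} {μ : Fin (L + 1) → ℂ}
    {X Y : Fin (n + 1) → ℂ} (hG : Regular γ (Nat.succ_le_succ h) μ X Y) (i j : Fin (n + 1)) :
    Regular γ h (fun k => μ k.succ) (fun k => X (i.succAbove k)) (fun k => Y (j.succAbove k)) := by
  obtain ⟨h1, h2, h3, h4, h5⟩ := hG
  refine ⟨fun k l hkl => h1 _ _ fun e => hkl (Fin.succAbove_right_injective e),
    fun k l hkl => h2 _ _ fun e => hkl (Fin.succAbove_right_injective e),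
    fun l k => h3 l.succ _, fun l k => h4 l.succ _, fun f g l => ?_⟩
  -- A choice among the remaining parameters is a choice among all of them, preceded by the removed
  -- `i` and `j`; the conditions for the later sites are thus inherited.
  have := h5 (Fin.cons i (i.succAbove ∘ f)) (Fin.cons j (j.succAbove ∘ g)) l.succ
  rw [Rnum_succ γ h] at this
  exact this

/-- One step of the recursion, for one summand. -/
lemma residue_succ {γ : ℂ} {L n : ℕ} {h : n ≤ L} {μ : Fin (L + 1) → ℂ}
    {X Y : Fin (n + 1) → ℂ} (hG : Regular γ (Nat.succ_le_succ h) μ X Y) (i j : Fin (n + 1))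
    (f g : Fin n → Fin n) :
    (∏ k, wtA γ (X k - μ 0) * wtA γ (Y k - μ 0)) * (Ffac γ μ X Y)⁻¹ *
      ((-1) ^ L * wtC γ ^ 2) * (Omega γ μ X Y i j *
      (Hnum γ h (fun k => μ k.succ) (fun k => X (i.succAbove (f k)))
          (fun k => Y (j.succAbove (g k))) /
        (∏ l, Rnum γ h (fun k => μ k.succ) (fun k => X (i.succAbove (f k)))
          (fun k => Y (j.succAbove (g k))) l) /
        residueDenom (fun k => X (i.succAbove k)) f /
        residueDenom (fun k => Y (j.succAbove k)) g)) =
    Hnum γ (Nat.succ_le_succ h) μ (X ∘ (Fin.cons i (i.succAbove ∘ f) : Fin (n + 1) → Fin (n + 1)))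
        (Y ∘ (Fin.cons j (j.succAbove ∘ g) : Fin (n + 1) → Fin (n + 1))) /
      (∏ l, Rnum γ (Nat.succ_le_succ h) μ
        (X ∘ (Fin.cons i (i.succAbove ∘ f) : Fin (n + 1) → Fin (n + 1)))
        (Y ∘ (Fin.cons j (j.succAbove ∘ g) : Fin (n + 1) → Fin (n + 1))) l) /
      residueDenom X (Fin.cons i (i.succAbove ∘ f) : Fin (n + 1) → Fin (n + 1)) /
      residueDenom Y (Fin.cons j (j.succAbove ∘ g) : Fin (n + 1) → Fin (n + 1)) := by
  rw [Hnum_succ γ h]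
  have hRs : ∀ l : Fin n, Rnum γ (Nat.succ_le_succ h) μ
      (X ∘ (Fin.cons i (i.succAbove ∘ f) : Fin (n + 1) → Fin (n + 1)))
      (Y ∘ (Fin.cons j (j.succAbove ∘ g) : Fin (n + 1) → Fin (n + 1))) l.succ =
      Rnum γ h (fun k => μ k.succ) (fun k => X (i.succAbove (f k)))
        (fun k => Y (j.succAbove (g k))) l := fun l => Rnum_succ γ h _ _ _ l
  rw [Fin.prod_univ_succ (fun l => Rnum γ (Nat.succ_le_succ h) μ _ _ l),
    Finset.prod_congr rfl fun l _ => hRs l]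
  simp only [Function.comp_apply, Fin.cons_succ, Fin.cons_zero]
  -- A repeated choice makes the smaller numerator, and with it both sides, vanish. Otherwise `f` is
  -- a permutation, and products along it are products over all indices except `i`.
  by_cases hf : Function.Injective f
  swap
  · obtain ⟨k, l, hkl, hne⟩ : ∃ k l, f k = f l ∧ k ≠ l := by
      simpa [Function.Injective] using hf
    rw [Hnum_eq_zero (μ := fun k => μ k.succ) hne (.inl (by simp [hkl, wtB_zero]))]
    simp
  by_cases hg : Function.Injective g
  swap
  · obtain ⟨k, l, hkl, hne⟩ : ∃ k l, g k = g l ∧ k ≠ l := by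
      simpa [Function.Injective] using hg
    rw [Hnum_eq_zero (μ := fun k => μ k.succ) hne (.inr (by simp [hkl, wtB_zero]))]
    simp
  have hpX : ∀ F : Fin (n + 1) → ℂ, ∏ k, F (i.succAbove (f k)) = ∏ k ∈ Finset.univ.erase i, F k :=
    fun F => by
      rw [prod_erase_eq_prod_succAbove]
      exact (Finite.injective_iff_bijective.1 hf).prod_comp fun k => F (i.succAbove k)
  have hpY : ∀ F : Fin (n + 1) → ℂ, ∏ k, F (j.succAbove (g k)) = ∏ k ∈ Finset.univ.erase j, F k :=
    fun F => by
      rw [prod_erase_eq_prod_succAbove]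
      exact (Finite.injective_iff_bijective.1 hg).prod_comp fun k => F (j.succAbove k)
  have hallX : ∀ F : Fin (n + 1) → ℂ,
      ∏ k, F ((Fin.cons i (i.succAbove ∘ f) : Fin (n + 1) → Fin (n + 1)) k) = ∏ k, F k := fun F => by
    rw [Fin.prod_univ_succ, ← Finset.mul_prod_erase _ _ (Finset.mem_univ i), ← hpX]
    rfl
  have hallY : ∀ F : Fin (n + 1) → ℂ,
      ∏ k, F ((Fin.cons j (j.succAbove ∘ g) : Fin (n + 1) → Fin (n + 1)) k) = ∏ k, F k := fun F => by
    rw [Fin.prod_univ_succ, ← Finset.mul_prod_erase _ _ (Finset.mem_univ j), ← hpY]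
    rfl
  have hq : ∀ (Z : Fin (n + 1) → ℂ) (i : Fin (n + 1)),
      ∏ k ∈ Finset.univ.erase i, wtB (Z k - Z i) =
        (-1) ^ n * ∏ k ∈ Finset.univ.erase i, wtB (Z i - Z k) := fun Z i => by
    rw [prod_erase_eq_prod_succAbove, prod_erase_eq_prod_succAbove]
    simp only [← neg_sub (Z i), wtB_neg, Finset.prod_neg, Finset.card_univ, Fintype.card_fin]
  have hn : ((-1 : ℂ) ^ n) * (-1) ^ n = 1 := by rw [← mul_pow]; simp
  -- The first residue gives `∏ b(X i - X k)`. Each later residue has one additional factor `b(X k -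
  -- X i)`, and together these give a second copy of that product, with sign `(-1)^n`.
  have hdX : residueDenom X (Fin.cons i (i.succAbove ∘ f) : Fin (n + 1) → Fin (n + 1)) =
      (∏ k ∈ Finset.univ.erase i, wtB (X i - X k)) * (((-1) ^ n *
        ∏ k ∈ Finset.univ.erase i, wtB (X i - X k)) *
        residueDenom (fun k => X (i.succAbove k)) f) := by
    rw [residueDenom, Fin.prod_univ_succ, Fin.cons_zero, ← hq, residueDenom,
      ← hpX fun x => wtB (X x - X i),
      ← Finset.prod_mul_distrib]
    simp only [Fin.cons_succ, Function.comp_apply, prod_erase_succAbove]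
  have hdY : residueDenom Y (Fin.cons j (j.succAbove ∘ g) : Fin (n + 1) → Fin (n + 1)) =
      (∏ k ∈ Finset.univ.erase j, wtB (Y j - Y k)) * (((-1) ^ n *
        ∏ k ∈ Finset.univ.erase j, wtB (Y j - Y k)) *
        residueDenom (fun k => Y (j.succAbove k)) g) := by
    rw [residueDenom, Fin.prod_univ_succ, Fin.cons_zero, ← hq, residueDenom,
      ← hpY fun x => wtB (Y x - Y j),
      ← Finset.prod_mul_distrib]
    simp only [Fin.cons_succ, Function.comp_apply, prod_erase_succAbove]
  obtain ⟨h1, h2, h3, h4, h5⟩ := hG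
  have h3 : ∀ k, wtA γ (X k - μ 0) ≠ 0 ∧ wtB (X k - μ 0) ≠ 0 := h3 0
  have h4 : ∀ k, wtA γ (Y k - μ 0) ≠ 0 ∧ wtB (Y k - μ 0) ≠ 0 := h4 0
  -- The first `R` is symmetric in the parameters, so it does not depend on the order of removal and
  -- equals the `Ffac` of the recursion up to its denominators.
  have hR0 : Rnum γ (Nat.succ_le_succ h) μ
      (X ∘ (Fin.cons i (i.succAbove ∘ f) : Fin (n + 1) → Fin (n + 1)))
      (Y ∘ (Fin.cons j (j.succAbove ∘ g) : Fin (n + 1) → Fin (n + 1))) 0 =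
      Ffac γ μ X Y * ((∏ k, wtB (X k - μ 0)) * ∏ k, wtB (Y k - μ 0)) := by
    have hBX : (∏ k, wtB (X k - μ 0)) ≠ 0 := Finset.prod_ne_zero_iff.2 fun k _ => (h3 k).2
    have hBY : (∏ k, wtB (Y k - μ 0)) ≠ 0 := Finset.prod_ne_zero_iff.2 fun k _ => (h4 k).2
    rw [Rnum_zero γ h, Ffac]
    simp only [Function.comp_apply, Finset.prod_mul_distrib, Finset.prod_div_distrib,
      hallX fun k => wtA γ (X k - μ 0), hallX fun k => wtB (X k - μ 0),
      hallY fun k => wtA γ (Y k - μ 0), hallY fun k => wtB (Y k - μ 0)]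
    field_simp
  have hL0 : Lnum γ (Nat.succ_le_succ h) μ
      (X ∘ (Fin.cons i (i.succAbove ∘ f) : Fin (n + 1) → Fin (n + 1)))
      (Y ∘ (Fin.cons j (j.succAbove ∘ g) : Fin (n + 1) → Fin (n + 1))) 0 =
      (-1) ^ n * ((∏ k, wtA γ (Y j - μ k) * wtB (μ k - X i)) *
        (∏ k ∈ Finset.univ.erase i, wtA γ (X i - X k)) *
        (∏ k ∈ Finset.univ.erase j, wtA γ (Y k - Y j)) -
      (∏ k, wtA γ (X i - μ k) * wtB (μ k - Y j)) *
        (∏ k ∈ Finset.univ.erase i, wtA γ (X k - X i)) *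
        (∏ k ∈ Finset.univ.erase j, wtA γ (Y j - Y k))) := by
    rw [Lnum_zero γ h]
    simp only [Function.comp_apply, Fin.cons_zero, Fin.cons_succ, Finset.prod_neg,
      Finset.card_univ, Fintype.card_fin]
    rw [Finset.prod_mul_distrib (f := fun k => wtA γ (X i - X (i.succAbove (f k)))),
      Finset.prod_mul_distrib (f := fun k => wtA γ (X (i.succAbove (f k)) - X i)),
      hpX fun x => wtA γ (X i - X x), hpX fun x => wtA γ (X x - X i),
      hpY fun x => wtA γ (Y j - Y x), hpY fun x => wtA γ (Y x - Y j)]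
    ring
  -- The coefficient of the recursion is `Λ₁` evaluated at the chosen residues, with the chosen pair
  -- in first place.
  have hO : Omega γ μ X Y i j =
      1 / (wtA γ (X i - μ 0) * wtB (X i - μ 0) * wtA γ (Y j - μ 0) * wtB (Y j - μ 0)) *
      (Lnum γ (Nat.succ_le_succ h) μ
        (X ∘ (Fin.cons i (i.succAbove ∘ f) : Fin (n + 1) → Fin (n + 1)))
        (Y ∘ (Fin.cons j (j.succAbove ∘ g) : Fin (n + 1) → Fin (n + 1))) 0 /
      ((∏ k ∈ Finset.univ.erase i, wtB (X i - X k)) *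
        ∏ k ∈ Finset.univ.erase j, wtB (Y j - Y k))) := by
    have e : ∀ x y : ℂ, x / ((-1) ^ n * y) = (-1) ^ n * (x / y) := fun x y => by
      rw [div_mul_eq_div_div, ← mul_div_assoc]
      congr 1
      rw [div_eq_iff (pow_ne_zero _ (by norm_num)), mul_right_comm, hn, one_mul]
    rw [hL0, Omega]
    simp only [Finset.prod_div_distrib, hq, e]
    ring
  have hHX : (∏ k : Fin n, wtB (X i - X (i.succAbove (f k))) *
        wtB (Y j - Y (j.succAbove (g k))) *
        (wtA γ (X (i.succAbove (f k)) - μ 0) * wtA γ (Y (j.succAbove (g k)) - μ 0) *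
          (wtB (X (i.succAbove (f k)) - μ 0) * wtB (Y (j.succAbove (g k)) - μ 0)))) =
      (∏ k ∈ Finset.univ.erase i, wtB (X i - X k)) *
        (∏ k ∈ Finset.univ.erase j, wtB (Y j - Y k)) *
      ((∏ k ∈ Finset.univ.erase i, wtA γ (X k - μ 0)) *
        (∏ k ∈ Finset.univ.erase j, wtA γ (Y k - μ 0)) *
      ((∏ k ∈ Finset.univ.erase i, wtB (X k - μ 0)) *
        (∏ k ∈ Finset.univ.erase j, wtB (Y k - μ 0)))) := by
    simp only [Finset.prod_mul_distrib]
    rw [hpX fun x => wtB (X i - X x), hpX fun x => wtA γ (X x - μ 0), hpX fun x => wtB (X x - μ 0),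
      hpY fun x => wtB (Y j - Y x), hpY fun x => wtA γ (Y x - μ 0), hpY fun x => wtB (Y x - μ 0)]
  rw [hHX, hdX, hdY, hR0, hO, Finset.prod_mul_distrib,
    ← Finset.mul_prod_erase _ (fun k => wtA γ (X k - μ 0)) (Finset.mem_univ i),
    ← Finset.mul_prod_erase _ (fun k => wtB (X k - μ 0)) (Finset.mem_univ i),
    ← Finset.mul_prod_erase _ (fun k => wtA γ (Y k - μ 0)) (Finset.mem_univ j),
    ← Finset.mul_prod_erase _ (fun k => wtB (Y k - μ 0)) (Finset.mem_univ j)]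
  have hqX : (∏ k ∈ Finset.univ.erase i, wtB (X i - X k)) ≠ 0 :=
    Finset.prod_ne_zero_iff.2 fun k hk => h1 _ _ (Finset.ne_of_mem_erase hk).symm
  have hqY : (∏ k ∈ Finset.univ.erase j, wtB (Y j - Y k)) ≠ 0 :=
    Finset.prod_ne_zero_iff.2 fun k hk => h2 _ _ (Finset.ne_of_mem_erase hk).symm
  have hbX : (∏ k ∈ Finset.univ.erase i, wtB (X k - μ 0)) ≠ 0 :=
    Finset.prod_ne_zero_iff.2 fun k _ => (h3 k).2
  have hbY : (∏ k ∈ Finset.univ.erase j, wtB (Y k - μ 0)) ≠ 0 :=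
    Finset.prod_ne_zero_iff.2 fun k _ => (h4 k).2
  have hi := h3 i
  have hj := h4 j
  generalize Lnum γ (Nat.succ_le_succ h) μ _ _ 0 = A1
  generalize Hnum γ h _ _ _ = A2
  generalize residueDenom _ f = A3
  generalize residueDenom _ g = A4
  generalize (∏ l : Fin n, Rnum γ h _ _ _ l) = A5
  generalize Ffac γ μ X Y = A6
  generalize (∏ k ∈ Finset.univ.erase i, wtB (X i - X k)) = A7 at *
  generalize (∏ k ∈ Finset.univ.erase j, wtB (Y j - Y k)) = A8 at *
  generalize (∏ k ∈ Finset.univ.erase i, wtB (X k - μ 0)) = A9 at *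
  generalize (∏ k ∈ Finset.univ.erase j, wtB (Y k - μ 0)) = A10 at *
  generalize (∏ k ∈ Finset.univ.erase i, wtA γ (X k - μ 0)) = A11 at *
  generalize (∏ k ∈ Finset.univ.erase j, wtA γ (Y k - μ 0)) = A12 at *
  generalize wtA γ (X i - μ 0) = A13 at *
  generalize wtB (X i - μ 0) = A14 at *
  generalize wtA γ (Y j - μ 0) = A15 at *
  generalize wtB (Y j - μ 0) = A16 at *
  clear * - hqX hqY hbX hbY hi hj hn
  obtain ⟨hi1, hi2⟩ := hi
  obtain ⟨hj1, hj2⟩ := hj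
  generalize (-1 : ℂ) ^ n = ε at *
  have hε : ε ≠ 0 := left_ne_zero_of_mul_eq_one hn
  field_simp
  rw [pow_two ε, hn, mul_one]

/-- The scalar product as a sum over residues. -/
lemma scalarProduct_eq_sum {γ : ℂ} {L n : ℕ} (h : n ≤ L) (μ : Fin L → ℂ) (X Y : Fin n → ℂ)
    (hG : Regular γ h μ X Y) :
    scalarProduct γ μ X Y = ∑ f : Fin n → Fin n, ∑ g : Fin n → Fin n,
      Hnum γ h μ (X ∘ f) (Y ∘ g) / (∏ i, Rnum γ h μ (X ∘ f) (Y ∘ g) i) /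
        residueDenom X f / residueDenom Y g := by
  induction n generalizing L with
  | zero => simp [scalarProduct, Hnum, residueDenom]
  | succ n ih =>
    obtain _ | L := L
    · exact absurd h (Nat.not_succ_le_zero n)
    have h' : n ≤ L := Nat.le_of_succ_le_succ h
    have hG' := hG
    obtain ⟨h1, h2, h3, h4, h5⟩ := hG'
    have h3 : ∀ k, wtA γ (X k - μ 0) ≠ 0 ∧ wtB (X k - μ 0) ≠ 0 := h3 0
    have h4 : ∀ k, wtA γ (Y k - μ 0) ≠ 0 ∧ wtB (Y k - μ 0) ≠ 0 := h4 0
    have hF : Ffac γ μ X Y ≠ 0 := by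
      intro h0
      apply h5 id id 0
      rw [Rnum_zero γ h']
      simp only [Function.comp_apply, id, Finset.prod_mul_distrib]
      have hBX : (∏ k, wtB (X k - μ 0)) ≠ 0 := Finset.prod_ne_zero_iff.2 fun k _ => (h3 k).2
      have hBY : (∏ k, wtB (Y k - μ 0)) ≠ 0 := Finset.prod_ne_zero_iff.2 fun k _ => (h4 k).2
      rw [Ffac, Finset.prod_div_distrib, Finset.prod_div_distrib, sub_eq_zero,
        div_eq_div_iff hBX hBY] at h0
      exact sub_eq_zero.2 h0
    rw [scalarProduct_recursion_cancelled γ μ X Y h3 h4 h1 h2 hF]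
    set T : (Fin (n + 1) → Fin (n + 1)) → (Fin (n + 1) → Fin (n + 1)) → ℂ := fun f g =>
      Hnum γ h μ (X ∘ f) (Y ∘ g) / (∏ i, Rnum γ h μ (X ∘ f) (Y ∘ g) i) /
        residueDenom X f / residueDenom Y g with hT
    have hTf : ∀ f g k l, k ≠ l → f k = f l → T f g = 0 := fun f g k l hkl hf => by
      simp only [hT]
      rw [Hnum_eq_zero hkl (.inl (by simp [hf, wtB_zero]))]
      simp
    have hTg : ∀ f g k l, k ≠ l → g k = g l → T f g = 0 := fun f g k l hkl hg => by
      simp only [hT]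
      rw [Hnum_eq_zero hkl (.inr (by simp [hg, wtB_zero]))]
      simp
    have hinj : ∀ i : Fin (n + 1), Function.Injective fun f : Fin n → Fin n => i.succAbove ∘ f :=
      fun i => Fin.succAbove_right_injective.comp_left
    have hrange : ∀ (i : Fin (n + 1)) (f : Fin n → Fin (n + 1)),
        f ∉ Set.range (fun f : Fin n → Fin n => i.succAbove ∘ f) → ∃ k, f k = i := fun i f hf => by
      by_contra! hne
      choose f' hf' using fun k => Fin.exists_succAbove_eq (hne k)
      exact hf ⟨f', funext hf'⟩
    -- Terms that choose `i` or `j` again vanish, so the later choices can be taken among the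
    -- remaining parameters.
    have hrestr : ∀ i j, ∑ f : Fin n → Fin (n + 1), ∑ g : Fin n → Fin (n + 1),
        T (Fin.cons i f) (Fin.cons j g) = ∑ f : Fin n → Fin n, ∑ g : Fin n → Fin n,
        T (Fin.cons i (i.succAbove ∘ f)) (Fin.cons j (j.succAbove ∘ g)) := fun i j => by
      symm
      refine Fintype.sum_of_injective _ (hinj i) _ _ (fun f hf => ?_) fun f => ?_
      · obtain ⟨k, hk⟩ := hrange i f hf
        exact Finset.sum_eq_zero fun g _ => hTf _ _ 0 k.succ (Fin.succ_ne_zero k).symm (by simp [hk])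
      · refine Fintype.sum_of_injective _ (hinj j) _ _ (fun g hg => ?_) fun g => rfl
        obtain ⟨k, hk⟩ := hrange j g hg
        exact hTg _ _ 0 k.succ (Fin.succ_ne_zero k).symm (by simp [hk])
    have hsum : ∑ f, ∑ g, T f g = ∑ i, ∑ j, ∑ f : Fin n → Fin n, ∑ g : Fin n → Fin n,
        T (Fin.cons i (i.succAbove ∘ f)) (Fin.cons j (j.succAbove ∘ g)) := by
      rw [sum_fin_succ_fun]
      refine Finset.sum_congr rfl fun i _ => ?_
      simp only [sum_fin_succ_fun (α := Fin (n + 1)) (L := n) fun g => T _ g]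
      rw [Finset.sum_comm]
      exact Finset.sum_congr rfl fun j _ => hrestr i j
    rw [hsum]
    simp only [Finset.mul_sum]
    refine Finset.sum_congr rfl fun i _ => Finset.sum_congr rfl fun j _ => ?_
    rw [ih h' _ _ _ (hG.succAbove i j)]
    simp only [Finset.mul_sum]
    exact Finset.sum_congr rfl fun f _ => Finset.sum_congr rfl fun g _ =>
      residue_succ hG i j f g

/-! ### The integral formula -/

lemma continuous_scalarProduct_spectral (γ : ℂ) {L n : ℕ} (μ : Fin L → ℂ) :
    Continuous fun p : (Fin n → ℂ) × (Fin n → ℂ) => scalarProduct γ μ p.1 p.2 :=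
  Continuous.comp (g := fun p : (Fin L → ℂ) × (Fin n → ℂ) × (Fin n → ℂ) =>
      scalarProduct γ p.1 p.2.1 p.2.2) (f := fun p => (μ, p)) (continuous_scalarProduct γ)
    (continuous_const.prodMk continuous_id)

lemma Regular.denomsNonzero {γ : ℂ} {L n : ℕ} {h : n ≤ L} {μ : Fin L → ℂ} {X Y : Fin n → ℂ}
    (hG : Regular γ h μ X Y) : DenomsNonzero γ h μ X Y :=
  denomsNonzero_of_Rnum_ne_zero (fun i k _ => ⟨(hG.2.2.1 i k).2, (hG.2.2.2.1 i k).2⟩)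
    (hG.2.2.2.2 id id)

lemma dense_regular {γ : ℂ} (hc : wtC γ ≠ 0) {L n : ℕ} (h : n ≤ L) (μ : Fin L → ℂ) :
    Dense {p : (Fin n → ℂ) × (Fin n → ℂ) | Regular γ h μ p.1 p.2} := by
  obtain ⟨x, hx⟩ := (dense_wtA_sub_ne_zero γ 0).nonempty
  have hx : wtA γ x ≠ 0 := by simpa using hx
  refine dense_of_mem_residual (Filter.Eventually.and eventually_residual_wtB_fst (.and
    eventually_residual_wtB_snd (.and (eventually_all.2 fun i => eventually_all.2 fun k => .and ?_ ?_) (.and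
    (eventually_all.2 fun i => eventually_all.2 fun k => .and ?_ ?_)
    (eventually_residual_Rnum h μ hc)))))
  · exact eventually_residual_ne_zero (fun p _ => analyticAt_wtA_sub γ (analyticAt_fst_apply k p)
      analyticAt_const) ⟨(fun _ => x + μ (Fin.castLE h i), 0), by simpa using hx⟩
  · exact eventually_residual_ne_zero (fun p _ => analyticAt_wtB_sub (analyticAt_fst_apply k p)
      analyticAt_const) ⟨(fun _ => 1 + μ (Fin.castLE h i), 0), by simpa using wtB_one_ne_zero⟩
  · exact eventually_residual_ne_zero (fun p _ => analyticAt_wtA_sub γ (analyticAt_snd_apply k p)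
      analyticAt_const) ⟨(0, fun _ => x + μ (Fin.castLE h i)), by simpa using hx⟩
  · exact eventually_residual_ne_zero (fun p _ => analyticAt_wtB_sub (analyticAt_snd_apply k p)
      analyticAt_const) ⟨(0, fun _ => 1 + μ (Fin.castLE h i)), by simpa using wtB_one_ne_zero⟩

/-- The holomorphic extension of the kernel, times the product of the `R_i`, is its numerator. -/
lemma extension_mul_prod_Rnum {γ : ℂ} (hc : wtC γ ≠ 0) {L n : ℕ} {h : n ≤ L} {μ : Fin L → ℂ}
    {Γ Δ : Fin n → Contour} {G : (Fin n → ℂ) × (Fin n → ℂ) → ℂ}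
    (hG : AnalyticOnNhd ℂ G {p | (∀ i, p.1 i ∈ (Γ i).filled) ∧ ∀ i, p.2 i ∈ (Δ i).filled})
    (hH : ∀ w v : Fin n → ℂ, (∀ i, w i ∈ (Γ i).filled) → (∀ i, v i ∈ (Δ i).filled) →
      DenomsNonzero γ h μ w v →
      (∀ i k, i ≠ k → wtB (w i - w k) ≠ 0 ∧ wtB (v i - v k) ≠ 0) →
      G (w, v) = Hker γ h μ w v) {w v : Fin n → ℂ}
    (hw : ∀ i, w i ∈ (Γ i).filled) (hv : ∀ i, v i ∈ (Δ i).filled) :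
    G (w, v) * ∏ i, Rnum γ h μ w v i = Hnum γ h μ w v := by
  set O : Set ((Fin n → ℂ) × (Fin n → ℂ)) :=
    (univ.pi fun i => (Γ i).inside) ×ˢ (univ.pi fun i => (Δ i).inside) with hO
  have hOo : IsOpen O := (isOpen_set_pi finite_univ fun i _ => (Γ i).isOpen_inside).prod
    (isOpen_set_pi finite_univ fun i _ => (Δ i).isOpen_inside)
  set T : Set ((Fin n → ℂ) × (Fin n → ℂ)) :=
    {p | (∀ i, p.1 i ∈ (Γ i).filled) ∧ ∀ i, p.2 i ∈ (Δ i).filled} with hT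
  have hTO : T ⊆ closure O := fun p hp => by
    rw [hO, closure_prod_eq, closure_pi_set, closure_pi_set]
    exact ⟨fun i _ => (Γ i).filled_subset_closure_inside (hp.1 i),
      fun i _ => (Δ i).filled_subset_closure_inside (hp.2 i)⟩
  have hOT : O ⊆ T := fun p hp => ⟨fun i => (Γ i).inside_subset_filled (hp.1 i trivial),
    fun i => (Δ i).inside_subset_filled (hp.2 i trivial)⟩
  -- The identity holds at regular points of the open polydiscs. These are dense in the closed
  -- polydiscs, and both sides are continuous there.
  refine EqOn.of_subset_closure (s := O ∩ {p | Regular γ h μ p.1 p.2}) (t := T)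
    (f := fun p => G p * ∏ i, Rnum γ h μ p.1 p.2 i) (g := fun p => Hnum γ h μ p.1 p.2)
    (fun p hp => ?_) (hG.continuousOn.mul fun p _ => ?_) (fun p _ => ?_)
    (inter_subset_left.trans hOT) ?_ (show (w, v) ∈ T from ⟨hw, hv⟩)
  · have hD := Regular.denomsNonzero hp.2
    have hpT := hOT hp.1
    have := hH p.1 p.2 hpT.1 hpT.2 hD fun i k hik => ⟨hp.2.1 i k hik, hp.2.2.1 i k hik⟩
    simp only [Prod.mk.eta] at this
    simp only [this, Hker_eq_div_of_denomsNonzero hD]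
    exact div_mul_cancel₀ _ (Finset.prod_ne_zero_iff.2 fun i _ =>
      Rnum_ne_zero_of_denomsNonzero hD i)
  · exact (Finset.analyticAt_fun_prod _ fun i _ => analyticAt_Rnum
      (fun k => analyticAt_fst_apply k _) (fun k => analyticAt_snd_apply k _)
      i).continuousAt.continuousWithinAt
  · exact (analyticAt_Hnum (fun k => analyticAt_fst_apply k _)
      (fun k => analyticAt_snd_apply k _)).continuousAt.continuousWithinAt
  · exact hTO.trans (closure_minimal ((dense_regular hc h μ).open_subset_closure_inter hOo)
      isClosed_closure)

/-! ### Dependence of the contour integral on its poles -/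

/-- The points which are enclosed by all contours, and none of whose other translates by `iπℤ` are
enclosed. -/
def poleDomain {n : ℕ} (Γ : Fin n → Contour) : Set (Fin n → ℂ) :=
  {X | ∀ i j, X j ∈ (Γ i).inside ∧ ∀ z ∈ (Γ i).filled, sinhDiv (z - X j) ≠ 0}

section poleDomain
variable {n : ℕ} {Γ : Fin n → Contour} {X : Fin n → ℂ}

/-- The second condition is open because the filled contours are compact. -/
lemma isOpen_poleDomain (Γ : Fin n → Contour) : IsOpen (poleDomain Γ) := by
  refine isOpen_iff_eventually.2 fun X hX => eventually_all.2 fun i => eventually_all.2 fun j =>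
    .and ?_ ?_
  · exact (continuous_apply j).continuousAt.eventually ((Γ i).isOpen_inside.mem_nhds (hX i j).1)
  · refine (Γ i).isCompact_filled.eventually_forall_of_forall_eventually fun z hz => ?_
    have hcont : Continuous fun p : (Fin n → ℂ) × ℂ => sinhDiv (p.2 - p.1 j) :=
      differentiable_sinhDiv.continuous.comp (by fun_prop)
    exact hcont.continuousAt.eventually_ne ((hX i j).2 z hz)

lemma wtB_sub_ne_zero_of_mem_poleDomain (hX : X ∈ poleDomain Γ) {i j : Fin n} {z : ℂ}
    (hz : z ∈ (Γ i).trace) : wtB (z - X j) ≠ 0 := fun h0 =>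
  Contour.ne_of_mem_trace_of_mem_inside hz (hX i j).1 (sub_eq_zero.1
    (sinhDiv_ne_zero_iff.1 ((hX i j).2 z ((Γ i).trace_subset_filled hz)) h0))

lemma continuousOn_multiIntegral_poleDomain {Γ Δ : Fin n → Contour}
    {G : (Fin n → ℂ) × (Fin n → ℂ) → ℂ}
    (hG : ContinuousOn G {p | (∀ i, p.1 i ∈ (Γ i).filled) ∧ ∀ i, p.2 i ∈ (Δ i).filled}) :
    ContinuousOn (fun p : (Fin n → ℂ) × (Fin n → ℂ) =>
      multiIntegral Γ fun w => multiIntegral Δ fun v =>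
        G (w, v) / ∏ i, ∏ j, wtB (w i - p.1 j) * wtB (v i - p.2 j))
      (poleDomain Γ ×ˢ poleDomain Δ) := by
  rw [continuousOn_iff_continuous_domRestrict]
  refine continuous_multiIntegral (X := ↥(poleDomain Γ ×ˢ poleDomain Δ)) Γ
    (fun p w => multiIntegral Δ fun v =>
        G (w, v) / ∏ i, ∏ j, wtB (w i - p.1.1 j) * wtB (v i - p.1.2 j)) ?_
  refine continuous_multiIntegral
    (X := ↥(poleDomain Γ ×ˢ poleDomain Δ) × {w : Fin n → ℂ // ∀ i, w i ∈ (Γ i).trace}) Δ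
    (fun p v => G (p.2.1, v) / ∏ i, ∏ j, wtB (p.2.1 i - p.1.1.1 j) * wtB (v i - p.1.1.2 j)) ?_
  refine Continuous.div ?_ (continuous_finsetProd _ fun i _ => continuous_finsetProd _ fun j _ =>
    (continuous_wtB.comp (.sub ?_ ?_)).mul (continuous_wtB.comp (.sub ?_ ?_))) fun p => ?_
  · exact hG.comp_continuous (by fun_prop)
      fun p => ⟨fun i => (Γ i).trace_subset_filled (p.1.2.2 i),
        fun i => (Δ i).trace_subset_filled (p.2.2 i)⟩
  · exact (continuous_apply i).comp
      (continuous_subtype_val.comp (continuous_snd.comp continuous_fst))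
  · exact (continuous_apply j).comp (continuous_fst.comp
      (continuous_subtype_val.comp (continuous_fst.comp continuous_fst)))
  · exact (continuous_apply i).comp (continuous_subtype_val.comp continuous_snd)
  · exact (continuous_apply j).comp (continuous_snd.comp
      (continuous_subtype_val.comp (continuous_fst.comp continuous_fst)))
  · exact Finset.prod_ne_zero_iff.2 fun i _ => Finset.prod_ne_zero_iff.2 fun j _ => mul_ne_zero
      (wtB_sub_ne_zero_of_mem_poleDomain p.1.1.2.1 (p.1.2.2 i))
      (wtB_sub_ne_zero_of_mem_poleDomain p.1.1.2.2 (p.2.2 i))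

lemma only_of_mem_poleDomain (hX : X ∈ poleDomain Γ) (i : Fin n) (z : ℂ) (hz : z ∈ (Γ i).filled)
    (j : Fin n) (h0 : wtB (z - X j) = 0) : z = X j :=
  sub_eq_zero.1 (sinhDiv_ne_zero_iff.1 ((hX i j).2 z hz) h0)

lemma multiIntegral_eq_sum {Γ Δ : Fin n → Contour} {G : (Fin n → ℂ) × (Fin n → ℂ) → ℂ}
    (hG : AnalyticOnNhd ℂ G {p | (∀ i, p.1 i ∈ (Γ i).filled) ∧ ∀ i, p.2 i ∈ (Δ i).filled})
    {X Y : Fin n → ℂ} (hX : X ∈ poleDomain Γ) (hY : Y ∈ poleDomain Δ)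
    (hXi : Function.Injective X) (hYi : Function.Injective Y) :
    (multiIntegral Γ fun w => multiIntegral Δ fun v =>
      G (w, v) / ∏ i, ∏ j, wtB (w i - X j) * wtB (v i - Y j)) =
    ∑ f : Fin n → Fin n, ∑ g : Fin n → Fin n,
      G (X ∘ f, Y ∘ g) / residueDenom X f / residueDenom Y g := by
  have h1 : ∀ w : Fin n → ℂ, (∀ i, w i ∈ (Γ i).trace) →
      (multiIntegral Δ fun v => G (w, v) / ∏ i, ∏ j, wtB (w i - X j) * wtB (v i - Y j)) =
      (∑ g : Fin n → Fin n, G (w, Y ∘ g) / residueDenom Y g) / ∏ i, ∏ j, wtB (w i - X j) := by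
    intro w hw
    have hGv : AnalyticOnNhd ℂ (fun v => G (w, v)) {v | ∀ i, v i ∈ (Δ i).filled} := fun v hv =>
      (hG (w, v) ⟨fun i => (Γ i).trace_subset_filled (hw i), hv⟩).fun_comp
        (f := fun v => (w, v)) (analyticAt_const.prod analyticAt_id)
    have := multiIntegral_div_prod_wtB hYi (fun i j => (hY i j).1) (only_of_mem_poleDomain hY) hGv
    rw [div_eq_inv_mul]
    simp only [residueDenom]
    rw [← this, ← multiIntegral_const_mul]
    refine multiIntegral_congr _ fun v _ => ?_
    simp only [Finset.prod_mul_distrib]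
    rw [div_mul_eq_div_div_swap, div_eq_inv_mul]
  rw [multiIntegral_congr Γ h1, multiIntegral_div_prod_wtB hXi (fun i j => (hX i j).1)
    (only_of_mem_poleDomain hX)]
  · refine Finset.sum_congr rfl fun f _ => ?_
    rw [Finset.sum_div]
    exact Finset.sum_congr rfl fun g _ => div_right_comm _ _ _
  · intro w hw
    refine Finset.analyticAt_fun_sum _ fun g _ => ?_
    exact ((hG (w, Y ∘ g) ⟨hw, fun i => (Δ i).inside_subset_filled (hY i (g i)).1⟩).fun_comp
      (f := fun w => (w, Y ∘ g)) (analyticAt_id.prod analyticAt_const)).fun_div analyticAt_const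
      (Finset.prod_ne_zero_iff.2 fun i _ => Finset.prod_ne_zero_iff.2 fun k hk h0 =>
        Finset.ne_of_mem_erase hk (hYi (only_of_mem_poleDomain hY i _
          ((Δ i).inside_subset_filled (hY i _).1) _ h0)).symm)

end poleDomain

/-- The contours are kept fixed while the poles vary in `poleDomain`. At regular points both sides
are the same sum of residues, and continuity carries the equality to the given, possibly coinciding,
parameters. -/
lemma Admissible.scalarProduct_eq_multiIntegral {γ : ℂ} {L n : ℕ} {h : n ≤ L} {μ : Fin L → ℂ}
    {lamC lamB : Fin n → ℂ} {Γ Δ : Fin n → Contour} (ha : Admissible γ h μ lamC lamB Γ Δ) :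
    scalarProduct γ μ lamC lamB = multiIntegral Γ fun w => multiIntegral Δ fun v =>
      Hker γ h μ w v / ∏ i, ∏ j, wtB (w i - lamC j) * wtB (v i - lamB j) := by
  by_cases hc : wtC γ = 0
  · obtain _ | n := n
    · simp [scalarProduct, multiIntegral, Hker]
    · rw [scalarProduct_eq_zero hc]
      simp [Hker, hc, multiIntegral_zero]
  obtain ⟨G, hG, hH⟩ := ha.holomorphic
  have hGH : ∀ w v : Fin n → ℂ, (∀ i, w i ∈ (Γ i).trace) → (∀ i, v i ∈ (Δ i).trace) →
      Hker γ h μ w v = G (w, v) := fun w v hw hv => by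
    -- The extension `G` is compared with the kernel only where no `b(w_i - w_k)` vanishes. Its
    -- product formula with the `Rnum` gives the equality on the whole contour, coinciding arguments
    -- included.
    have hD := ha.on_contour w v hw hv
    rw [Hker_eq_div_of_denomsNonzero hD, div_eq_iff (Finset.prod_ne_zero_iff.2 fun i _ =>
      Rnum_ne_zero_of_denomsNonzero hD i), extension_mul_prod_Rnum hc hG hH
      (fun i => (Γ i).trace_subset_filled (hw i)) (fun i => (Δ i).trace_subset_filled (hv i))]
  have hI : (multiIntegral Γ fun w => multiIntegral Δ fun v =>
      Hker γ h μ w v / ∏ i, ∏ j, wtB (w i - lamC j) * wtB (v i - lamB j)) =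
      multiIntegral Γ fun w => multiIntegral Δ fun v =>
        G (w, v) / ∏ i, ∏ j, wtB (w i - lamC j) * wtB (v i - lamB j) :=
    multiIntegral_congr _ fun w hw => multiIntegral_congr _ fun v hv => by rw [hGH w v hw hv]
  rw [hI]
  have hU : IsOpen (poleDomain Γ ×ˢ poleDomain Δ) :=
    (isOpen_poleDomain Γ).prod (isOpen_poleDomain Δ)
  have hmem : (lamC, lamB) ∈ poleDomain Γ ×ˢ poleDomain Δ :=
    ⟨fun i j => ⟨ha.mem_C i j, fun z hz => sinhDiv_ne_zero_iff.2 fun h0 =>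
      sub_eq_zero.2 (ha.only_C i z hz j h0)⟩,
    fun i j => ⟨ha.mem_B i j, fun z hz => sinhDiv_ne_zero_iff.2 fun h0 =>
      sub_eq_zero.2 (ha.only_B i z hz j h0)⟩⟩
  have hS := continuous_scalarProduct_spectral γ (n := n) μ
  have hI' := continuousOn_multiIntegral_poleDomain hG.continuousOn
  have hcl := (dense_regular hc h μ).open_subset_closure_inter hU
  generalize hSd : (fun p : (Fin n → ℂ) × (Fin n → ℂ) => scalarProduct γ μ p.1 p.2) = S at hS
  generalize hId : (fun p : (Fin n → ℂ) × (Fin n → ℂ) =>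
    multiIntegral Γ fun w => multiIntegral Δ fun v =>
    G (w, v) / ∏ i, ∏ j, wtB (w i - p.1 j) * wtB (v i - p.2 j)) = I at hI'
  suffices key : EqOn S I ((poleDomain Γ ×ˢ poleDomain Δ) ∩ {p | Regular γ h μ p.1 p.2}) by
    have := key.of_subset_closure hS.continuousOn hI' inter_subset_left hcl hmem
    rwa [← hSd, ← hId] at this
  intro p hp
  obtain ⟨⟨hX, hY⟩, hR⟩ := hp
  -- Regular parameters are distinct, so all poles of the integrand are simple.
  have hinj : ∀ Z : Fin n → ℂ, (∀ j k, j ≠ k → wtB (Z j - Z k) ≠ 0) →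
      Function.Injective Z := fun Z hZ j k hjk => by_contra fun hne => hZ j k hne (by
    rw [hjk, sub_self, wtB_zero])
  rw [← hSd, ← hId]
  simp only
  rw [scalarProduct_eq_sum h μ _ _ hR, multiIntegral_eq_sum hG hX hY (hinj _ hR.1)
    (hinj _ hR.2.1)]
  refine Finset.sum_congr rfl fun f _ => Finset.sum_congr rfl fun g _ => ?_
  rw [← extension_mul_prod_Rnum hc hG hH (w := p.1 ∘ f) (v := p.2 ∘ g)
    (fun i => (Γ i).inside_subset_filled (hX i (f i)).1)
    (fun i => (Δ i).inside_subset_filled (hY i (g i)).1), mul_div_cancel_right₀ _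
    (Finset.prod_ne_zero_iff.2 fun i _ => hR.2.2.2.2 f g i)]

end SixVertex

theorem mainTheorem1 (γ : ℂ) :
    -- the multiple contour integral formula, for all admissible contours
    (∀ (L n : ℕ) (h : n ≤ L) (μ : Fin L → ℂ) (lamC lamB : Fin n → ℂ) (Γ Δ : Fin n → Contour),
      Admissible γ h μ lamC lamB Γ Δ →
      scalarProduct γ μ lamC lamB =
        multiIntegral Γ fun w => multiIntegral Δ fun v =>
          Hker γ h μ w v / ∏ i, ∏ j, wtB (w i - lamC j) * wtB (v i - lamB j)) ∧
    -- such contours exist for `λ` in generic position, and generic position is a dense condition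
    (∀ (L n : ℕ) (h : n ≤ L) (μ : Fin L → ℂ) (lamC lamB : Fin n → ℂ),
      Generic γ h μ lamC lamB → ∃ Γ Δ : Fin n → Contour, Admissible γ h μ lamC lamB Γ Δ) ∧
    (Complex.sinh γ ≠ 0 → ∀ (L n : ℕ) (h : n ≤ L) (μ : Fin L → ℂ),
      Dense {p : (Fin n → ℂ) × (Fin n → ℂ) | Generic γ h μ p.1 p.2}) ∧
    -- the kernel for `n = 1`
    (∀ (L : ℕ) (h : 1 ≤ L + 1) (μ : Fin (L + 1) → ℂ) (w v : ℂ),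
      Hker γ h μ ![w] ![v] =
        wtC γ ^ 2 * ((∏ k, wtA γ (w - μ k) * wtB (v - μ k)) - ∏ k, wtA γ (v - μ k) * wtB (w - μ k))
          / (wtB (w - μ 0) * wtB (v - μ 0)
            * (wtA γ (w - μ 0) / wtB (w - μ 0) - wtA γ (v - μ 0) / wtB (v - μ 0)))) ∧
    -- the recursion for the kernel
    (∀ (L n : ℕ) (h : n ≤ L) (μ : Fin (L + 1) → ℂ),
      (∀ k : Fin L, wtA γ (μ 0 - μ k.succ) ≠ 0 ∧ wtA γ (μ k.succ - μ 0) ≠ 0) →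
      ∀ w v : Fin (n + 1) → ℂ, DenomsNonzero γ (Nat.succ_le_succ h) μ w v →
      (∀ i k, i ≠ k → wtB (w i - w k) ≠ 0 ∧ wtB (v i - v k) ≠ 0) →
      Hker γ (Nat.succ_le_succ h) μ w v =
        Hbar γ h μ (fun k => w k.succ) (fun k => v k.succ) / (wtB (w 0 - μ 0) * wtB (v 0 - μ 0))
        * (∏ k : Fin n, wtB (w 0 - w k.succ) ^ 2 * wtB (v 0 - v k.succ) ^ 2)
        * ((∏ k : Fin n, wtA γ (w k.succ - μ 0) * wtA γ (v k.succ - μ 0))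
            / ∏ k : Fin L, wtA γ (μ 0 - μ k.succ) * wtA γ (μ k.succ - μ 0))
        * (Ffac γ μ w v)⁻¹
        * ((∏ k, wtA γ (v 0 - μ k) * wtB (μ k - w 0))
              * (∏ k : Fin n, wtA γ (w 0 - w k.succ) / wtB (w 0 - w k.succ))
              * (∏ k : Fin n, wtA γ (v k.succ - v 0) / wtB (v k.succ - v 0))
            - (∏ k, wtA γ (w 0 - μ k) * wtB (μ k - v 0))
              * (∏ k : Fin n, wtA γ (w k.succ - w 0) / wtB (w k.succ - w 0))
              * (∏ k : Fin n, wtA γ (v 0 - v k.succ) / wtB (v 0 - v k.succ)))) ∧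
    -- the function `V` arises from the scalar product by specialisation
    (∀ (L n : ℕ) (_ : n ≤ L) (μ : Fin (L + 1) → ℂ) (X Y : Fin n → ℂ),
      scalarProduct γ μ (Fin.cons (μ 0 - γ) X : Fin (n + 1) → ℂ)
          (Fin.cons (μ 0) Y : Fin (n + 1) → ℂ) =
        (∏ j, wtB (X j - μ 0) * wtA γ (Y j - μ 0)) * Vfun γ μ X Y) ∧
    -- the recursion for the scalar product
    (∀ (L n : ℕ) (_ : n ≤ L) (μ : Fin (L + 1) → ℂ) (lamC lamB : Fin (n + 1) → ℂ),
      (∀ k : Fin L, wtA γ (μ 0 - μ k.succ) ≠ 0 ∧ wtA γ (μ k.succ - μ 0) ≠ 0) →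
      (∀ i, wtA γ (lamC i - μ 0) ≠ 0 ∧ wtB (lamC i - μ 0) ≠ 0) →
      (∀ i, wtA γ (lamB i - μ 0) ≠ 0 ∧ wtB (lamB i - μ 0) ≠ 0) →
      (∀ i k, i ≠ k → wtB (lamC i - lamC k) ≠ 0 ∧ wtB (lamB i - lamB k) ≠ 0) →
      Ffac γ μ lamC lamB ≠ 0 →
      scalarProduct γ μ lamC lamB =
        Kfac γ μ lamC lamB * ∑ i, ∑ j, Omega γ μ lamC lamB i j
          * Vfun γ μ (fun k => lamC (i.succAbove k)) (fun k => lamB (j.succAbove k))) := by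
  exact ⟨fun _ _ _ _ _ _ _ _ ha => ha.scalarProduct_eq_multiIntegral,
    fun _ _ _ _ _ _ hG => hG.exists_admissible,
    fun hc _ _ h μ => dense_generic h μ hc,
    fun L h μ w v => Hker_one γ L h μ w v,
    fun _ _ h μ hμ w v _ _ => Hker_succ γ h μ hμ w v,
    fun _ _ _ μ X Y => scalarProduct_special_left X Y,
    fun _ _ _ μ X Y hμ hX hY hd hF => scalarProduct_recursion X Y hμ hX hY
      (fun i k hik => (hd i k hik).1) (fun i k hik => (hd i k hik).2) hF⟩
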